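/- Fix a finite relational schema whose attributes range over one of two disjoint infinite domains (the rationals, or uninterpreted constants identified by their names); an instance is a finite set $I$ of facts $R(t)$. Let $F$ be a set of functional dependencies over the schema that contains at most one functional dependency per relation name (and no other constraints). A *conflict* in $I$ is a pair of facts $\{R(t),R(u)\}\subseteq I$ such that for some $R:X\to Y$ in $F$ the tuples $t,u$ agree on $X$ and disagree on $Y$; two facts are *neighbors* if some conflict contains both. A *repair* of $I$ is a maximal subset of $I$ that is consistent with $F$. A *priority* of $I$ w.r.t. $F$ is an acyclic binary relation $\succ$ on $I$ that relates only neighbors; it is *total* if no other priority of $I$ w.r.t. $F$ extends it. A repair $I'$ of $I$ is - *Pareto optimal* w.r.t. $\succ$ if there are no nonempty $X\subseteq I'$ and nonempty $Y\subseteq I\setminus I'$ such that $y\succ x$ for all $x\in X$ and all $y\in Y$, and $(I'\setminus X)\cup Y$ is consistent with $F$; - *globally optimal* w.r.t. $\succ$ if there are no nonempty $X\subseteq I'$ and $Y\subseteq I\setminus I'$ such that for every $x\in X$ there is $y\in Y$ with $y\succ x$, and $(I'\setminus X)\cup Y$ is consistent with $F$; - *common optimal* w.r.t. $\succ$ if it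 is globally optimal w.r.t. some total priority $\succ'\supseteq\succ$. Write $\mathcal{P}Rep(I,F,\succ)$, $\mathcal{G}Rep(I,F,\succ)$ and $\mathcal{C}Rep(I,F,\succ)$ for the sets of Pareto, globally and common optimal repairs. For a family $\mathcal{X}Rep$ of preferred repairs, a closed query $Q$ and a truth value $b\in\{\mathbf{true},\mathbf{false}\}$, $b$ is the *$\mathcal{X}$-preferred consistent answer* to $Q$ in $I$ w.r.t. $F$ and $\succ$ if $Q$ has truth value $b$ in every $I'\in\mathcal{X}Rep(I,F,\succ)$. **Theorem.** For every such fixed $F$, every fixed closed quantifier-free query $Q$ (a Boolean combination of facts and of built-in comparisons $=,\neq$ between uninterpreted constants and $=,\neq,<,\leq,>,\geq$ between rationals), every $b\in\{\mathbf{true},\mathbf{false}\}$ and every $\mathcal{X}\in\{\mathcal{P},\mathcal{G},\mathcal{C}\}$, the following problem is in PTIME, i.e. it is decided by a deterministic Turing machine in time polynomial in the length of the input: given an instance $I$ and a binary relation $\succ$ on facts (written as lists of facts and of pairs of facts, with numbers in binary), decide whether $\succ$ is a priority of $I$ w.r.t. $F$ and $b$ is the $\mathcal{X}$-preferred consistent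 answer to $Q$ in $I$ w.r.t. $F$ and $\succ$. -/

import Mathlib

namespace CQA

/-! ### Relational databases -/

/-- The two disjoint domains of constants. -/
inductive DomainKind
  | rational
  | name

/-- Constants of each domain: the rationals, and uninterpreted constants. An uninterpreted constant
is its name (a finite binary word): two of them are equal iff they have the same name. -/
abbrev Const : DomainKind → Type
  | .rational => ℚ
  | .name => List Bool

instance constDecidableEq : (k : DomainKind) → DecidableEq (Const k)
  | .rational => inferInstanceAs (DecidableEq ℚ)
  | .name => inferInstanceAs (DecidableEq (List Bool))

/-- A (finite) database schema: relation names with their arities, every attribute being typed by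
one of the two domains. Attributes of a relation are identified with their positions. -/
structure Schema where
  numRel : ℕ
  arity : Fin numRel → ℕ
  dom : (R : Fin numRel) → Fin (arity R) → DomainKind

/-- Well-typed tuples of constants of the relation `R`. -/
abbrev Tuple (S : Schema) (R : Fin S.numRel) : Type :=
  (i : Fin (S.arity R)) → Const (S.dom R i)

/-- Facts `R(t)`. -/
abbrev Fact (S : Schema) : Type :=
  Σ R : Fin S.numRel, Tuple S R

/-- Database instances: finite sets of facts. -/
abbrev DBInstance (S : Schema) : Type :=
  Finset (Fact S)

/-! ### Functional dependencies -/

/-- A functional dependency `rel : lhs → rhs`. -/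
structure FD (S : Schema) where
  rel : Fin S.numRel
  lhs : Finset (Fin (S.arity rel))
  rhs : Finset (Fin (S.arity rel))

/-- The facts `p = R(t)` and `q = R(u)` jointly violate the functional dependency `R : X → Y`:
`t` and `u` have the same values in `X` and different values in `Y`. -/
def FD.Violates {S : Schema} (f : FD S) (p q : Fact S) : Prop :=
  ∃ t u : Tuple S f.rel, p = ⟨f.rel, t⟩ ∧ q = ⟨f.rel, u⟩ ∧
    (∀ i ∈ f.lhs, t i = u i) ∧ ¬ ∀ i ∈ f.rhs, t i = u i

/-- `I ⊨ F`. -/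
def Consistent {S : Schema} (F : Set (FD S)) (I : DBInstance S) : Prop :=
  ∀ f ∈ F, ∀ p ∈ I, ∀ q ∈ I, ¬ f.Violates p q

/-- `C` is a conflict in `I` w.r.t. `F`. -/
def IsConflict {S : Schema} (F : Set (FD S)) (I C : DBInstance S) : Prop :=
  C ⊆ I ∧ ∃ f ∈ F, ∃ p q : Fact S, C = {p, q} ∧ f.Violates p q

/-- `p` and `q` are neighbors: some conflict in `I` contains both. -/
def Neighbors {S : Schema} (F : Set (FD S)) (I : DBInstance S) (p q : Fact S) : Prop :=
  ∃ C : DBInstance S, IsConflict F I C ∧ p ∈ C ∧ q ∈ C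

/-- `J` is a repair of `I` w.r.t. `F`: a maximal subset of `I` consistent with `F`. -/
def IsRepair {S : Schema} (F : Set (FD S)) (I J : DBInstance S) : Prop :=
  J ⊆ I ∧ Consistent F J ∧ ∀ K : DBInstance S, J ⊆ K → K ⊆ I → Consistent F K → K = J

/-! ### Priorities and families of preferred repairs

A relation `r` stands for `≻`: `r p q` means `p ≻ q`. -/

/-- `r` is a priority of `I` w.r.t. `F`: an acyclic binary relation on `I` that relates neighbors
only. -/
def IsPriority {S : Schema} (F : Set (FD S)) (I : DBInstance S)
    (r : Fact S → Fact S → Prop) : Prop :=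
  (∀ p q, r p q → p ∈ I ∧ q ∈ I) ∧
  (∀ p, ¬ Relation.TransGen r p p) ∧
  (∀ p q, r p q → Neighbors F I p q)

/-- A total priority: one that no other priority extends. -/
def IsTotalPriority {S : Schema} (F : Set (FD S)) (I : DBInstance S)
    (r : Fact S → Fact S → Prop) : Prop :=
  IsPriority F I r ∧
    ∀ r' : Fact S → Fact S → Prop, IsPriority F I r' → (∀ p q, r p q → r' p q) → r' = r

/-- `J` is globally optimal: no nonempty `X ⊆ J` can be replaced with some `Y ⊆ I \ J` such that
every `x ∈ X` is dominated by some `y ∈ Y` and the result is consistent. -/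
def GloballyOptimal {S : Schema} (F : Set (FD S)) (I : DBInstance S)
    (r : Fact S → Fact S → Prop) (J : DBInstance S) : Prop :=
  J ⊆ I ∧ ¬ ∃ X Y : DBInstance S, X.Nonempty ∧ X ⊆ J ∧ Y ⊆ I \ J ∧
    (∀ x ∈ X, ∃ y ∈ Y, r y x) ∧ Consistent F ((J \ X) ∪ Y)

/-- `J` is Pareto optimal: no nonempty `X ⊆ J` can be replaced with some nonempty `Y ⊆ I \ J` such
that every `x ∈ X` is dominated by every `y ∈ Y` and the result is consistent. -/
def ParetoOptimal {S : Schema} (F : Set (FD S)) (I : DBInstance S)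
    (r : Fact S → Fact S → Prop) (J : DBInstance S) : Prop :=
  J ⊆ I ∧ ¬ ∃ X Y : DBInstance S, X.Nonempty ∧ X ⊆ J ∧ Y.Nonempty ∧ Y ⊆ I \ J ∧
    (∀ x ∈ X, ∀ y ∈ Y, r y x) ∧ Consistent F ((J \ X) ∪ Y)

/-- `J` is common optimal: it is globally optimal w.r.t. some total priority extending `r`. -/
def CommonOptimal {S : Schema} (F : Set (FD S)) (I : DBInstance S)
    (r : Fact S → Fact S → Prop) (J : DBInstance S) : Prop :=
  J ⊆ I ∧ ∃ r' : Fact S → Fact S → Prop, IsTotalPriority F I r' ∧ (∀ p q, r p q → r' p q) ∧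
    GloballyOptimal F I r' J

/-- Families of preferred repairs. -/
abbrev RepairFamily (S : Schema) : Type :=
  Set (FD S) → DBInstance S → (Fact S → Fact S → Prop) → Set (DBInstance S)

/-- The globally optimal repairs. -/
def globalRep (S : Schema) : RepairFamily S :=
  fun F I r => {J | IsRepair F I J ∧ GloballyOptimal F I r J}

/-- The Pareto optimal repairs. -/
def paretoRep (S : Schema) : RepairFamily S :=
  fun F I r => {J | IsRepair F I J ∧ ParetoOptimal F I r J}

/-- The common optimal repairs. -/
def commonRep (S : Schema) : RepairFamily S :=
  fun F I r => {J | IsRepair F I J ∧ CommonOptimal F I r J}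

/-! ### Quantifier-free queries -/

/-- The built-in relations over the rationals. -/
inductive CompOp
  | eq
  | ne
  | lt
  | le
  | gt
  | ge

/-- Interpretation of the built-in relations over the rationals. -/
def CompOp.Holds : CompOp → ℚ → ℚ → Prop
  | .eq, a, b => a = b
  | .ne, a, b => a ≠ b
  | .lt, a, b => a < b
  | .le, a, b => a ≤ b
  | .gt, a, b => a > b
  | .ge, a, b => a ≥ b

/-- Quantifier-free closed queries. Being closed and quantifier-free, such a formula has no
variables: it is a Boolean combination of facts and of built-in atoms between constants. -/
inductive Query (S : Schema)
  | fact (p : Fact S)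
  | nameEq (a b : Const .name)
  | nameNe (a b : Const .name)
  | comp (op : CompOp) (a b : Const .rational)
  | neg (φ : Query S)
  | conj (φ ψ : Query S)
  | disj (φ ψ : Query S)

/-- `J ⊨ Q`. -/
def Query.Holds {S : Schema} (J : DBInstance S) : Query S → Prop
  | .fact p => p ∈ J
  | .nameEq a b => a = b
  | .nameNe a b => a ≠ b
  | .comp op a b => op.Holds a b
  | .neg φ => ¬ φ.Holds J
  | .conj φ ψ => φ.Holds J ∧ ψ.Holds J
  | .disj φ ψ => φ.Holds J ∨ ψ.Holds J

/-- The truth value `b` is the preferred consistent answer to `Q` w.r.t. the family `X`: `Q` has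
the truth value `b` in every preferred repair. -/
def PreferredAnswer {S : Schema} (X : RepairFamily S) (F : Set (FD S)) (I : DBInstance S)
    (r : Fact S → Fact S → Prop) (Q : Query S) (b : Bool) : Prop :=
  ∀ J ∈ X F I r, (Q.Holds J ↔ b = true)

/-! ### The decision problem -/

/-- An input to the decision problem: an instance, given by a list of its facts, and a binary
relation on facts, given by a list of its pairs. -/
structure Input (S : Schema) where
  facts : List (Fact S)
  pairs : List (Fact S × Fact S)

/-- The instance given by an input. -/
def Input.inst {S : Schema} (x : Input S) : DBInstance S :=
  x.facts.toFinset

/-- The relation given by an input. -/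
def Input.prec {S : Schema} (x : Input S) : Fact S → Fact S → Prop :=
  fun p q => (p, q) ∈ x.pairs

/-- The set of the pairs `(I, ≻)` such that `≻` is a priority of `I` w.r.t. `F` and `b` is the
`X`-preferred consistent answer to `Q` in `I` w.r.t. `F` and `≻`. -/
def answerProblem {S : Schema} (X : RepairFamily S) (F : Set (FD S)) (Q : Query S) (b : Bool) :
    Set (Input S) :=
  {x | IsPriority F x.inst x.prec ∧ PreferredAnswer X F x.inst x.prec Q b}

open Computability (Γ' encodeNat encodeBool)

/-- A constant as a string: a name is written as it is, a rational as a sign bit, the binary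
numerator, a separator and the binary denominator (in lowest terms). -/
def encodeConst : (k : DomainKind) → Const k → List Γ'
  | .rational, (q : ℚ) =>
      Γ'.bit (decide (q.num < 0)) :: (encodeNat q.num.natAbs).map Γ'.bit
        ++ Γ'.blank :: (encodeNat q.den).map Γ'.bit
  | .name, (w : List Bool) => w.map Γ'.bit

/-- A fact as a string: the index of the relation and the constants, separated by commas, between
brackets. -/
def encodeFact {S : Schema} (p : Fact S) : List Γ' :=
  Γ'.bra :: (encodeNat p.1.val).map Γ'.bit
    ++ ((List.ofFn fun i => encodeConst (S.dom p.1 i) (p.2 i)).map (Γ'.comma :: ·)).flatten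
    ++ [Γ'.ket]

/-- An input as a string: the facts, a comma, and the pairs of the relation. -/
def encodeInput {S : Schema} (x : Input S) : List Γ' :=
  x.facts.flatMap encodeFact
    ++ Γ'.comma :: x.pairs.flatMap fun pq => encodeFact pq.1 ++ encodeFact pq.2

/-! Different inputs have different encodings. -/

theorem bit_map_inj : Function.Injective (List.map Γ'.bit) :=
  List.map_injective_iff.2 fun a b h => by injection h

theorem encodeNat_inj : Function.Injective encodeNat := fun a b h => by
  rw [← Computability.decode_encodeNat a, h, Computability.decode_encodeNat]

theorem split_inj {α : Type} {c : α} : ∀ {A B X Y : List α}, c ∉ A → c ∉ B →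
    A ++ c :: X = B ++ c :: Y → A = B ∧ X = Y
  | [], [], _, _, _, _, h => by simpa using h
  | [], b :: B, _, _, _, hB, h => by simp at h hB; exact absurd h.1 hB.1
  | a :: A, [], _, _, hA, _, h => by simp at h hA; exact absurd h.1.symm hA.1
  | a :: A, b :: B, X, Y, hA, hB, h => by
    simp at h hA hB
    obtain ⟨h1, h2⟩ := split_inj hA.2 hB.2 h.2
    exact ⟨by rw [h.1, h1], h2⟩

theorem encodeConst_inj : ∀ k, Function.Injective (encodeConst k)
  | .name => bit_map_inj
  | .rational => fun (p : ℚ) (q : ℚ) h => by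
    simp only [encodeConst] at h
    have := split_inj (by simp) (by simp) h
    obtain ⟨h1, h2⟩ := this
    injection h1 with h0 h1
    injection h0 with h0
    have hn := encodeNat_inj (bit_map_inj h1)
    have hd := encodeNat_inj (bit_map_inj h2)
    apply Rat.ext _ hd
    have : (p.num < 0 ↔ q.num < 0) := by simpa using h0
    omega

theorem encodeConst_clean (k : DomainKind) (v : Const k) :
    Γ'.comma ∉ encodeConst k v ∧ Γ'.ket ∉ encodeConst k v := by
  cases k <;> simp [encodeConst]

theorem segs_inj : ∀ {A B : List Γ'} {L M : List (List Γ')}, Γ'.comma ∉ A → Γ'.comma ∉ B →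
    (∀ l ∈ L, Γ'.comma ∉ l) → (∀ l ∈ M, Γ'.comma ∉ l) →
    A ++ (L.map (Γ'.comma :: ·)).flatten = B ++ (M.map (Γ'.comma :: ·)).flatten → A = B ∧ L = M
  | A, B, [], [], _, _, _, _, h => by simpa using h
  | A, B, [], m :: M, hA, _, _, _, h => by simp at h; subst h; simp at hA
  | A, B, l :: L, [], _, hB, _, _, h => by simp at h; subst h; simp at hB
  | A, B, l :: L, m :: M, hA, hB, hL, hM, h => by
    simp only [List.map_cons, List.flatten_cons, List.cons_append] at h
    obtain ⟨h1, h2⟩ := split_inj hA hB h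
    obtain ⟨h3, h4⟩ := segs_inj (hL l (by simp)) (hM m (by simp))
      (fun x hx => hL x (by simp [hx])) (fun x hx => hM x (by simp [hx])) h2
    exact ⟨h1, by rw [h3, h4]⟩

theorem encodeFact_prefix {S : Schema} {p q : Fact S} {X Y : List Γ'}
    (h : encodeFact p ++ X = encodeFact q ++ Y) : p = q ∧ X = Y := by
  obtain ⟨R, t⟩ := p
  obtain ⟨R', u⟩ := q
  simp only [encodeFact, List.append_assoc, List.cons_append, List.nil_append] at h
  injection h with _ h
  rw [← List.append_assoc, ← List.append_assoc] at h
  have key : ∀ (R : Fin S.numRel) (t : Tuple S R), Γ'.ket ∉ (encodeNat R.val).map Γ'.bit ++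
      ((List.ofFn fun i => encodeConst (S.dom R i) (t i)).map (Γ'.comma :: ·)).flatten := by
    intro R t
    simp only [List.mem_append, List.mem_map, List.mem_flatten, List.mem_ofFn]
    rintro (⟨b, -, hb⟩ | ⟨l, ⟨l', ⟨i, rfl⟩, rfl⟩, hl⟩)
    · cases hb
    · simp [(encodeConst_clean _ _).2] at hl
  obtain ⟨h1, h2⟩ := split_inj (key R t) (key R' u) h
  have clean : ∀ (R : Fin S.numRel) (t : Tuple S R),
      ∀ l ∈ (List.ofFn fun i => encodeConst (S.dom R i) (t i)), Γ'.comma ∉ l := by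
    intro R t l hl
    obtain ⟨i, rfl⟩ := List.mem_ofFn.1 hl
    exact (encodeConst_clean _ _).1
  obtain ⟨h3, h4⟩ := segs_inj (by simp) (by simp) (clean R t) (clean R' u) h1
  have hR := Fin.ext (encodeNat_inj (bit_map_inj h3))
  subst hR
  have := List.ofFn_injective h4
  refine ⟨?_, h2⟩
  congr 1
  funext i
  exact encodeConst_inj _ (congrFun this i)

theorem encodeFacts_prefix {S : Schema} : ∀ {L M : List (Fact S)} {X Y : List Γ'},
    L.flatMap encodeFact ++ Γ'.comma :: X = M.flatMap encodeFact ++ Γ'.comma :: Y → L = M ∧ X = Y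
  | [], [], _, _, h => by simpa using h
  | [], q :: M, _, _, h => by simp [encodeFact] at h
  | p :: L, [], _, _, h => by simp [encodeFact] at h
  | p :: L, q :: M, X, Y, h => by
    simp only [List.flatMap_cons, List.append_assoc] at h
    obtain ⟨h1, h2⟩ := encodeFact_prefix h
    obtain ⟨h3, h4⟩ := encodeFacts_prefix h2
    exact ⟨by rw [h1, h3], h4⟩

theorem encodePairs_inj {S : Schema} : ∀ {L M : List (Fact S × Fact S)},
    (L.flatMap fun pq => encodeFact pq.1 ++ encodeFact pq.2) =
      (M.flatMap fun pq => encodeFact pq.1 ++ encodeFact pq.2) → L = M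
  | [], [], _ => rfl
  | [], q :: M, h => by simp [encodeFact] at h
  | p :: L, [], h => by simp [encodeFact] at h
  | p :: L, q :: M, h => by
    simp only [List.flatMap_cons, List.append_assoc] at h
    obtain ⟨h1, h⟩ := encodeFact_prefix h
    obtain ⟨h2, h⟩ := encodeFact_prefix h
    rw [encodePairs_inj h, Prod.ext h1 h2]

theorem encodeInput_injective {S : Schema} : Function.Injective (encodeInput (S := S)) := by
  rintro ⟨L, P⟩ ⟨M, Q⟩ h
  obtain ⟨h1, h2⟩ := encodeFacts_prefix h
  have h3 := encodePairs_inj h2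
  simp_all

open Classical in
/-- Membership in `L` is decidable in polynomial time by a deterministic Turing machine, inputs
being presented to the machine as strings by `enc`. -/
def InPTIME {α Γ : Type} (enc : α → List Γ) (L : Set α) : Prop :=
  Nonempty (Turing.TM2ComputableInPolyTime enc encodeBool fun a => decide (a ∈ L))

end CQA

/-! With at most one dependency `R : X → Y` per relation, agreement on `X` splits an instance into
groups, and agreement on `Y` as well splits each group into parts; facts without a dependency form
singletons. Two facts clash exactly if they lie in the same group but in different parts
(`clash_iff`), so a repair is a free choice of one part from every group.

Optimality then becomes a condition on each chosen part separately: no clashing fact dominates all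
of it (Pareto), no other part of its group dominates it fact by fact (global), or it contains an
undominated fact (common); see `paretoOptimal_iff`, `globallyOptimal_iff`, `commonOptimal_iff`.
Every group has a part that is good in all three senses, since an acyclic relation leaves some fact
of the group undominated. A quantifier-free query sees a repair only through the finitely many facts
that it mentions. Groups being independent, a set of such facts is the trace of a preferred repair
iff every group that meets the query has a good part with the right trace (`preferredAnswer_iff`).
The query is fixed, so this is a fixed first-order condition on the input.

Being a priority is first-order apart from acyclicity. An arrow is marked in a round if all arrows
into its source were marked in the round before; the relation is acyclic iff all arrows are marked
after as many rounds as there are arrows (`acyclic_iff_settled`).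

On the machine, a fact is represented by a suffix of the input that starts with it. A quantifier
over facts is a loop over suffixes, which are linearly many, so polynomial time predicates are
closed under it (`Dec.exists`); the atoms compare two stretches of the input and are decided by
two-head automata (`Dec.agree`). The rounds of marking are counted by a copy of the input
(`inPTIME_of_dec`). -/

namespace CQA

open Turing Computability

/-! ### Structured programs for stack machines -/

section Machine

variable {K : Type} [DecidableEq K] {Γ : K → Type} {σ : Type}

/-- Rename the labels of a statement by `f` and continue with `h` instead of halting. -/
def graft {Λ Λ' : Type} (f : Λ → Λ') (h : TM2.Stmt Γ Λ' σ) : TM2.Stmt Γ Λ σ → TM2.Stmt Γ Λ' σ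
  | .push k g q => .push k g (graft f h q)
  | .peek k g q => .peek k g (graft f h q)
  | .pop k g q => .pop k g (graft f h q)
  | .load g q => .load g (graft f h q)
  | .branch g q₁ q₂ => .branch g (graft f h q₁) (graft f h q₂)
  | .goto l => .goto fun v => f (l v)
  | .halt => h

theorem stepAux_graft {Λ Λ' : Type} (f : Λ → Λ') (h : TM2.Stmt Γ Λ' σ) (q : TM2.Stmt Γ Λ σ) :
    ∀ v S, TM2.stepAux (graft f h q) v S =
      match TM2.stepAux q v S with
      | ⟨some l, v', S'⟩ => ⟨some (f l), v', S'⟩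
      | ⟨none, v', S'⟩ => TM2.stepAux h v' S' := by
  induction q with
  | push k g q ih | peek k g q ih | pop k g q ih => intro v S; exact ih _ _
  | load g q ih => intro v S; exact ih _ _
  | branch g q₁ q₂ ih₁ ih₂ =>
    intro v S
    cases hg : g v <;> simp [graft, hg, ih₁, ih₂]
  | goto l => intro v S; rfl
  | halt => intro v S; rfl

/-- `M` goes from the first to the second configuration in exactly `n` steps. -/
inductive RunsIn {Λ : Type} (M : Λ → TM2.Stmt Γ Λ σ) :
    ℕ → TM2.Cfg Γ Λ σ → TM2.Cfg Γ Λ σ → Prop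
  | refl (c) : RunsIn M 0 c c
  | step {n l v S c} : RunsIn M n (TM2.stepAux (M l) v S) c → RunsIn M (n + 1) ⟨some l, v, S⟩ c

theorem RunsIn.trans {Λ : Type} {M : Λ → TM2.Stmt Γ Λ σ} {n m : ℕ} {a b c : TM2.Cfg Γ Λ σ}
    (h : RunsIn M n a b) (h' : RunsIn M m b c) : RunsIn M (n + m) a c := by
  induction h with
  | refl => simpa using h'
  | step _ ih => rw [Nat.add_right_comm]; exact .step (ih h')

theorem RunsIn.iterate_eq {Λ : Type} {M : Λ → TM2.Stmt Γ Λ σ} {n : ℕ} {a b : TM2.Cfg Γ Λ σ}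
    (h : RunsIn M n a b) : (flip bind (TM2.step M))^[n] (some a) = some b := by
  induction h with
  | refl => rfl
  | step _ ih => rw [Function.iterate_succ_apply]; exact ih

/-- This one simulation serves sequencing, loops and branching, which differ only in the `h` that
replaces halting. As `h` is executed within the step that would have halted, the number of steps
does not change. -/
theorem RunsIn.graft {Λ Λ' : Type} {M : Λ → TM2.Stmt Γ Λ σ} {M' : Λ' → TM2.Stmt Γ Λ' σ}
    {f : Λ → Λ'} {h : TM2.Stmt Γ Λ' σ} (hM : ∀ l, M' (f l) = graft f h (M l)) {v' : σ}
    {S' : ∀ k, List (Γ k)} : ∀ {n l v S}, RunsIn M n ⟨some l, v, S⟩ ⟨none, v', S'⟩ →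
      RunsIn M' n ⟨some (f l), v, S⟩ (TM2.stepAux h v' S') := by
  intro n
  induction n with
  | zero => intro l v S r; cases r
  | succ n ih =>
    intro l v S r
    cases r with
    | step r =>
    refine .step ?_
    rw [hM, stepAux_graft]
    generalize TM2.stepAux (M l) v S = c at r
    obtain ⟨_ | l', w, T⟩ := c
    · cases r; exact .refl _
    · exact ih r

/-- The memory of a machine: the internal state and the stacks. -/
abbrev MachineState (Γ : K → Type) (σ : Type) : Type := σ × ∀ k, List (Γ k)

/-- Some program takes `s` to `t` in at most `n` steps, whenever `P s t n`. -/
def Impl (P : MachineState Γ σ → MachineState Γ σ → ℕ → Prop) : Prop :=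
  ∃ (Λ : Type) (_ : Fintype Λ) (M : Λ → TM2.Stmt Γ Λ σ) (e : Λ), ∀ s t n, P s t n →
    ∃ n' ≤ n, RunsIn M n' ⟨some e, s.1, s.2⟩ ⟨none, t.1, t.2⟩

/-- Specifications may be restricted and time bounds relaxed. Costs are added up exactly while
programs are composed, and this is where they are rounded up to polynomials. -/
theorem Impl.mono {P Q : MachineState Γ σ → MachineState Γ σ → ℕ → Prop} (h : Impl P)
    (hQ : ∀ s t n, Q s t n → ∃ m ≤ n, P s t m) : Impl Q := by
  obtain ⟨Λ, hΛ, M, e, h⟩ := h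
  refine ⟨Λ, hΛ, M, e, fun s t n q => ?_⟩
  obtain ⟨m, hm, p⟩ := hQ s t n q
  obtain ⟨n', hn, r⟩ := h s t m p
  exact ⟨n', hn.trans hm, r⟩

theorem Impl.stmt (q : TM2.Stmt Γ Unit σ) :
    Impl fun s t n => TM2.stepAux q s.1 s.2 = ⟨none, t.1, t.2⟩ ∧ n = 1 := by
  refine ⟨Unit, inferInstance, fun _ => q, (), ?_⟩
  rintro s t n ⟨h, rfl⟩
  refine ⟨1, le_rfl, .step ?_⟩
  rw [h]
  exact .refl _

theorem Impl.seq {P Q : MachineState Γ σ → MachineState Γ σ → ℕ → Prop} (hP : Impl P)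
    (hQ : Impl Q) : Impl fun s u n => ∃ t n₁ n₂, P s t n₁ ∧ Q t u n₂ ∧ n = n₁ + n₂ := by
  obtain ⟨Λ₁, _, M₁, e₁, h₁⟩ := hP
  obtain ⟨Λ₂, _, M₂, e₂, h₂⟩ := hQ
  let M : Λ₁ ⊕ Λ₂ → TM2.Stmt Γ (Λ₁ ⊕ Λ₂) σ := Sum.elim
    (fun l => CQA.graft Sum.inl (.goto fun _ => .inr e₂) (M₁ l))
    (fun l => CQA.graft Sum.inr .halt (M₂ l))
  refine ⟨Λ₁ ⊕ Λ₂, inferInstance, M, .inl e₁, ?_⟩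
  rintro s u _ ⟨t, n₁, n₂, hp, hq, rfl⟩
  obtain ⟨m₁, hm₁, r₁⟩ := h₁ _ _ _ hp
  obtain ⟨m₂, hm₂, r₂⟩ := h₂ _ _ _ hq
  refine ⟨m₁ + m₂, by omega, ?_⟩
  have r₁' := RunsIn.graft (M' := M) (f := Sum.inl) (fun _ => rfl) r₁
  have r₂' := RunsIn.graft (M' := M) (f := Sum.inr) (fun _ => rfl) r₂
  exact r₁'.trans r₂'

/-- Iterations of `P` as long as the internal state satisfies `g` afterwards. -/
inductive Iter {α : Type} (P : α → α → ℕ → Prop) (g : α → Bool) : α → α → ℕ → Prop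
  | last {s t n} : P s t n → g t = false → Iter P g s t n
  | next {s t u n m} : P s t n → g t = true → Iter P g t u m → Iter P g s u (n + m)

/-- The test sits where the body would halt, so it costs no extra step and the body runs at least
once. -/
theorem Impl.doWhile {P : MachineState Γ σ → MachineState Γ σ → ℕ → Prop} (hP : Impl P)
    (g : σ → Bool) : Impl (Iter P fun s => g s.1) := by
  obtain ⟨Λ, _, M, e, h⟩ := hP
  let M' : Λ → TM2.Stmt Γ Λ σ := fun l => CQA.graft id (.branch g (.goto fun _ => e) .halt) (M l)
  refine ⟨Λ, inferInstance, M', e, ?_⟩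
  intro s t n hi
  induction hi with
  | last p hg =>
    obtain ⟨m, hm, r⟩ := h _ _ _ p
    have r' := RunsIn.graft (M' := M') (f := id) (fun _ => rfl) r
    refine ⟨m, hm, ?_⟩
    simpa [hg] using r'
  | next p hg _ ih =>
    obtain ⟨m, hm, r⟩ := h _ _ _ p
    obtain ⟨m', hm', r₂⟩ := ih
    have r' := RunsIn.graft (M' := M') (f := id) (fun _ => rfl) r
    refine ⟨m + m', by omega, RunsIn.trans ?_ r₂⟩
    simpa [hg] using r'

theorem Impl.ite {P Q : MachineState Γ σ → MachineState Γ σ → ℕ → Prop} (hP : Impl P)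
    (hQ : Impl Q) (g : σ → Bool) :
    Impl fun s t n => ∃ m, (if g s.1 then P s t m else Q s t m) ∧ n = m + 1 := by
  obtain ⟨Λ₁, _, M₁, e₁, h₁⟩ := hP
  obtain ⟨Λ₂, _, M₂, e₂, h₂⟩ := hQ
  let M : Option (Λ₁ ⊕ Λ₂) → TM2.Stmt Γ (Option (Λ₁ ⊕ Λ₂)) σ
    | none => .goto fun v => if g v then some (.inl e₁) else some (.inr e₂)
    | some (.inl l) => CQA.graft (some ∘ Sum.inl) .halt (M₁ l)
    | some (.inr l) => CQA.graft (some ∘ Sum.inr) .halt (M₂ l)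
  refine ⟨Option (Λ₁ ⊕ Λ₂), inferInstance, M, none, ?_⟩
  rintro s t _ ⟨n, h, rfl⟩
  cases hg : g s.1
  · simp only [hg, Bool.false_eq_true, if_false] at h
    obtain ⟨m, hm, r⟩ := h₂ _ _ _ h
    have r' := RunsIn.graft (M' := M) (f := some ∘ Sum.inr) (fun _ => rfl) r
    refine ⟨m + 1, by omega, .step ?_⟩
    simpa [M, hg] using r'
  · simp only [hg, if_true] at h
    obtain ⟨m, hm, r⟩ := h₁ _ _ _ h
    have r' := RunsIn.graft (M' := M) (f := some ∘ Sum.inl) (fun _ => rfl) r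
    refine ⟨m + 1, by omega, .step ?_⟩
    simpa [M, hg] using r'

end Machine

end CQA

/-! ### Programs on named stacks, and tests by two-head automata. -/

namespace CQA

open Turing Computability

/-! ### The memory of the evaluator -/

/-- Letters of a word, each carrying a mark. -/
abbrev Cell : Type := Γ' × Bool

/-- Working stacks: the variables, of which variable `0` holds the word, and auxiliary stacks. -/
inductive Mem
  | cnt
  | res
  | auxL
  | auxR
  | var (i : Fin 10)
  deriving DecidableEq, Fintype

/-- Stacks: the input, the output and the working stacks. -/
inductive Stk
  | inp
  | out
  | mem (x : Mem)
  deriving DecidableEq, Fintype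

/-- The alphabets of the stacks. -/
abbrev Sym : Stk → Type
  | .inp => Γ'
  | .out => Bool
  | .mem _ => Cell

/-- Internal states: a truth value, a loop condition and two buffers. -/
structure Ctl where
  flag : Bool
  go : Bool
  bufL : Option Cell
  bufR : Option Cell
  deriving Fintype

/-- The contents of all stacks. -/
def pack (i : List Γ') (o : List Bool) (M : Mem → List Cell) : ∀ k, List (Sym k)
  | .inp => i
  | .out => o
  | .mem x => M x

@[simp] theorem pack_inp (i o M) : pack i o M .inp = i := rfl
@[simp] theorem pack_out (i o M) : pack i o M .out = o := rfl
@[simp] theorem pack_mem (i o M x) : pack i o M (.mem x) = M x := rfl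

@[simp] theorem update_pack_mem (i o M x) (l : List Cell) :
    Function.update (pack i o M) (.mem x) l = pack i o (Function.update M x l) := by
  funext k
  rcases k with _ | _ | y
  · simp
  · simp
  · by_cases h : y = x
    · subst h; simp
    · simp [h]

@[simp] theorem update_pack_inp (i o M) (l : List Γ') :
    Function.update (pack i o M) .inp l = pack l o M := by
  funext k
  rcases k with _ | _ | y <;> simp

@[simp] theorem update_pack_out (i o M) (l : List Bool) :
    Function.update (pack i o M) .out l = pack i l M := by
  funext k
  rcases k with _ | _ | y <;> simp

/-- The loop condition, the truth value and the working stacks. -/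
abbrev MState : Type := Bool × Bool × (Mem → List Cell)

/-- The machine state given by the input and output stacks and the rest of the memory. -/
def embed (i : List Γ') (o : List Bool) (a : MState) : MachineState Sym Ctl :=
  (⟨a.2.1, a.1, none, none⟩, pack i o a.2.2)

/-- Some program that leaves the input and the output alone takes `a` to `b` in at most `n` steps,
whenever `P a b n`. -/
def MImpl (P : MState → MState → ℕ → Prop) : Prop :=
  Impl fun s t n => ∃ i o a b, s = embed i o a ∧ t = embed i o b ∧ P a b n

theorem MImpl.mono {P Q : MState → MState → ℕ → Prop} (h : MImpl P)
    (hQ : ∀ a b n, Q a b n → ∃ m ≤ n, P a b m) : MImpl Q := by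
  refine Impl.mono h ?_
  rintro _ _ n ⟨i, o, a, b, rfl, rfl, q⟩
  obtain ⟨m, hm, p⟩ := hQ _ _ _ q
  exact ⟨m, hm, i, o, a, b, rfl, rfl, p⟩

theorem MImpl.stmt (q : TM2.Stmt Sym Unit Ctl) :
    MImpl fun a b n => (∀ i o, TM2.stepAux q (embed i o a).1 (embed i o a).2 =
      ⟨none, (embed i o b).1, (embed i o b).2⟩) ∧ n = 1 := by
  refine Impl.mono (Impl.stmt q) ?_
  rintro _ _ n ⟨i, o, a, b, rfl, rfl, h, rfl⟩
  exact ⟨1, le_rfl, h i o, rfl⟩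

theorem MImpl.seq {P Q : MState → MState → ℕ → Prop} (hP : MImpl P) (hQ : MImpl Q) :
    MImpl fun a c n => ∃ b n₁ n₂, P a b n₁ ∧ Q b c n₂ ∧ n = n₁ + n₂ := by
  refine Impl.mono (Impl.seq hP hQ) ?_
  rintro _ _ n ⟨i, o, a, c, rfl, rfl, b, n₁, n₂, hp, hq, rfl⟩
  exact ⟨_, le_rfl, embed i o b, n₁, n₂, ⟨i, o, a, b, rfl, rfl, hp⟩, ⟨i, o, b, c, rfl, rfl, hq⟩, rfl⟩

theorem MImpl.doWhile {P : MState → MState → ℕ → Prop} (hP : MImpl P) :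
    MImpl (Iter P fun a => a.1) := by
  refine Impl.mono (Impl.doWhile hP fun v => v.go) ?_
  rintro _ _ n ⟨i, o, a, c, rfl, rfl, h⟩
  refine ⟨n, le_rfl, ?_⟩
  induction h with
  | last p hg => exact .last ⟨i, o, _, _, rfl, rfl, p⟩ hg
  | next p hg _ ih => exact .next ⟨i, o, _, _, rfl, rfl, p⟩ hg ih

theorem MImpl.ite {P Q : MState → MState → ℕ → Prop} (hP : MImpl P) (hQ : MImpl Q) :
    MImpl fun a b n => ∃ m, (if a.2.1 then P a b m else Q a b m) ∧ n = m + 1 := by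
  refine Impl.mono (Impl.ite hP hQ fun v => v.flag) ?_
  rintro _ _ n ⟨i, o, a, b, rfl, rfl, m, h, rfl⟩
  refine ⟨_, le_rfl, m, ?_, rfl⟩
  change if a.2.1 then _ else _
  split_ifs with hf
  · rw [if_pos hf] at h; exact ⟨i, o, a, b, rfl, rfl, h⟩
  · rw [if_neg hf] at h; exact ⟨i, o, a, b, rfl, rfl, h⟩

/-! ### Moving the contents of a stack -/

/-- Push `a` on all stacks in `ys`. -/
def pushAll (ys : List Mem) (a : Cell) (M : Mem → List Cell) : Mem → List Cell :=
  ys.foldl (fun M y => Function.update M y (a :: M y)) M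

/-- Push the first buffer on all stacks in `ys`. -/
def pushStmt {Λ : Type} (ys : List Mem) (q : TM2.Stmt Sym Λ Ctl) : TM2.Stmt Sym Λ Ctl :=
  ys.foldr (fun y q => .push (.mem y) (fun v => v.bufL.getD default) q) q

theorem stepAux_pushStmt {Λ : Type} (ys : List Mem) (q : TM2.Stmt Sym Λ Ctl) (v : Ctl) (i o) :
    ∀ M, TM2.stepAux (pushStmt ys q) v (pack i o M) =
      TM2.stepAux q v (pack i o (pushAll ys (v.bufL.getD default) M)) := by
  induction ys with
  | nil => intro M; rfl
  | cons y ys ih =>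
    intro M
    change TM2.stepAux (.push (.mem y) _ (pushStmt ys q)) _ _ = _
    rw [TM2.stepAux.eq_1, update_pack_mem, ih]
    rfl

theorem pushAll_update {ys : List Mem} {x : Mem} (hx : x ∉ ys) (a : Cell) (l : List Cell) :
    ∀ M, pushAll ys a (Function.update M x l) = Function.update (pushAll ys a M) x l := by
  induction ys with
  | nil => intro M; rfl
  | cons y ys ih =>
    intro M
    simp only [List.mem_cons, not_or] at hx
    change pushAll ys a _ = Function.update (pushAll ys a _) x l
    rw [← ih hx.2]
    beta_reduce
    rw [Function.update_of_ne (Ne.symm hx.1), Function.update_comm hx.1]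

/-- Push the letters of `l`, in order, on all stacks in `ys`. -/
def drainTo (ys : List Mem) : List Cell → (Mem → List Cell) → Mem → List Cell
  | [], M => M
  | a :: l, M => drainTo ys l (pushAll ys a M)

/-- Clearing, moving and duplicating a stack are the same loop with zero, one and two targets. The
letters arrive in reverse order. -/
theorem MImpl.drain (x : Mem) (ys : List Mem) (hx : x ∉ ys) :
    MImpl fun a b n => ∃ g f M, a = (g, f, M) ∧
      b = (g, f, drainTo ys (M x) (Function.update M x [])) ∧ n = (M x).length + 1 := by
  let m : Unit → TM2.Stmt Sym Unit Ctl := fun _ => .pop (.mem x) (fun v a => { v with bufL := a })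
    -- Pushing happens only when the pop has filled the buffer, so the default letter in `pushStmt`
    -- is never used.
    (.branch (fun v => v.bufL.isSome) (pushStmt ys (.goto fun _ => ())) .halt)
  have key : ∀ l i o g f z M, RunsIn m (l.length + 1)
      ⟨some (), ⟨f, g, z, none⟩, pack i o (Function.update M x l)⟩
      ⟨none, ⟨f, g, none, none⟩, pack i o (drainTo ys l (Function.update M x []))⟩ := by
    intro l i o g f
    induction l with
    | nil =>
      intro z M
      refine .step ?_
      simp [m, drainTo]
      exact .refl _
    | cons a l ih =>
      intro z M
      refine .step ?_
      simp only [m, TM2.stepAux.eq_3, TM2.stepAux.eq_5, pack_mem, Function.update_self,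
        List.head?_cons, List.tail_cons, Option.isSome_some, cond_true, update_pack_mem,
        Function.update_idem, stepAux_pushStmt, Option.getD_some, TM2.stepAux.eq_6]
      have := ih (some a) (pushAll ys a M)
      rw [← pushAll_update hx, ← pushAll_update hx] at this
      exact this
  refine ⟨Unit, inferInstance, m, (), ?_⟩
  rintro _ _ _ ⟨i, o, _, _, rfl, rfl, g, f, M, rfl, rfl, rfl⟩
  refine ⟨_, le_rfl, ?_⟩
  have := key (M x) i o g f none M
  rw [Function.update_eq_self] at this
  exact this

theorem drainTo_nil (l : List Cell) (M) : drainTo [] l M = M := by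
  induction l generalizing M with
  | nil => rfl
  | cons a l ih => exact ih M

theorem drainTo_single (y : Mem) (l : List Cell) (M) :
    drainTo [y] l M = Function.update M y (l.reverse ++ M y) := by
  induction l generalizing M with
  | nil => simp [drainTo]
  | cons a l ih => simp [drainTo, pushAll, ih]

theorem drainTo_pair {y z : Mem} (h : y ≠ z) (l : List Cell) (M) : drainTo [y, z] l M =
    Function.update (Function.update M y (l.reverse ++ M y)) z (l.reverse ++ M z) := by
  induction l generalizing M with
  | nil => simp [drainTo]
  | cons a l ih =>
    simp only [drainTo, pushAll, ih, List.foldl_cons, List.foldl_nil, Function.update_self,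
      Function.update_of_ne h, Function.update_of_ne h.symm, List.reverse_cons, List.append_assoc,
      List.cons_append, List.nil_append]
    rw [Function.update_comm h.symm, Function.update_idem, Function.update_idem]

theorem MImpl.clear (x : Mem) :
    MImpl fun a b n => ∃ g f M, a = (g, f, M) ∧ b = (g, f, Function.update M x []) ∧
      n = (M x).length + 1 := by
  simpa only [drainTo_nil] using MImpl.drain x [] (by simp)

theorem MImpl.move {x y : Mem} (h : x ≠ y) :
    MImpl fun a b n => ∃ g f M, a = (g, f, M) ∧
      b = (g, f, Function.update (Function.update M x []) y ((M x).reverse ++ M y)) ∧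
      n = (M x).length + 1 := by
  simpa only [drainTo_single, Function.update_of_ne h.symm] using MImpl.drain x [y] (by simpa using h)

/-- Copy the word to another variable. -/
theorem MImpl.copy {k : Fin 10} (hk : k ≠ 0) :
    MImpl fun a b n => ∃ g f M, a = (g, f, M) ∧ M .auxL = [] ∧ M (.var k) = [] ∧
      b = (g, f, Function.update M (.var k) (M (.var 0))) ∧ n = 2 * (M (.var 0)).length + 2 := by
  have h0 : Mem.var k ≠ .var 0 := by simpa using hk
  -- Two drains, through `auxL`, reverse the word twice.
  refine MImpl.mono (MImpl.seq (MImpl.move (x := .var 0) (y := .auxL) (by simp))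
    (MImpl.drain .auxL [.var 0, .var k] (by simp))) ?_
  rintro _ _ _ ⟨g, f, M, rfl, hX, hV, rfl, rfl⟩
  refine ⟨_, le_rfl, _, _, _, ⟨g, f, M, rfl, rfl, rfl⟩, ⟨g, f, _, rfl, ?_, rfl⟩, ?_⟩
  · rw [drainTo_pair h0.symm]
    refine congrArg _ (congrArg _ ?_)
    funext x
    rcases x with _ | _ | _ | _ | j <;> simp [Function.update_apply, hX, hV]
    by_cases hj : j = k
    · simp [hj]
    · by_cases hj0 : j = 0 <;> simp [hj, hj0]
  · simp [hX]; ring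

/-! ### Two-head automata -/

/-- The outcome `b` of the automaton with the transitions `δ` that reads `s` and `t` from the state
`q`: it answers, or goes to another state and advances on one of the words, or both. -/
inductive Scan {Q : Type} (δ : Q → Option Cell → Option Cell → Bool ⊕ (Q × Bool × Bool)) :
    Q → List Cell → List Cell → Bool → Prop
  | ans {q s t b} : δ q s.head? t.head? = .inl b → Scan δ q s t b
  | popL {q q' a s t b} : δ q (some a) t.head? = .inr (q', true, false) →
      Scan δ q' s t b → Scan δ q (a :: s) t b
  | popR {q q' c s t b} : δ q s.head? (some c) = .inr (q', false, true) →
      Scan δ q' s t b → Scan δ q s (c :: t) b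
  | popB {q q' a c s t b} : δ q (some a) (some c) = .inr (q', true, true) →
      Scan δ q' s t b → Scan δ q (a :: s) (c :: t) b

/-- `M'` arises from `M` by moving letters from the variables `i` and `j` to the auxiliary
stacks. -/
structure Shifted (i j : Fin 10) (M M' : Mem → List Cell) : Prop where
  left : (M' .auxL).reverse ++ M' (.var i) = (M .auxL).reverse ++ M (.var i)
  right : (M' .auxR).reverse ++ M' (.var j) = (M .auxR).reverse ++ M (.var j)
  cnt : M' .cnt = M .cnt
  res : M' .res = M .res
  var : ∀ k, k ≠ i → k ≠ j → M' (.var k) = M (.var k)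

theorem Shifted.trans {i j : Fin 10} {M M' M'' : Mem → List Cell} (h : Shifted i j M M')
    (h' : Shifted i j M' M'') : Shifted i j M M'' :=
  ⟨h'.1.trans h.1, h'.2.trans h.2, h'.3.trans h.3, h'.4.trans h.4,
    fun k hi hj => (h'.5 k hi hj).trans (h.5 k hi hj)⟩

/-- Advance on variable `i`, keeping the letter in the buffer on the first auxiliary stack. -/
def shiftL (i : Fin 10) (M : Mem → List Cell) (a : Cell) : Mem → List Cell :=
  Function.update (Function.update M (.var i) (M (.var i)).tail) .auxL (a :: M .auxL)

/-- Advance on variable `j`, keeping the letter in the buffer on the second auxiliary stack. -/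
def shiftR (j : Fin 10) (M : Mem → List Cell) (a : Cell) : Mem → List Cell :=
  Function.update (Function.update M (.var j) (M (.var j)).tail) .auxR (a :: M .auxR)

theorem shifted_shiftL {i j : Fin 10} (h : i ≠ j) {M : Mem → List Cell} {a : Cell} {s}
    (hM : M (.var i) = a :: s) : Shifted i j M (shiftL i M a) := by
  constructor <;> simp +contextual [shiftL, hM, h.symm]

theorem shifted_shiftR {i j : Fin 10} (h : i ≠ j) {M : Mem → List Cell} {a : Cell} {s}
    (hM : M (.var j) = a :: s) : Shifted i j M (shiftR j M a) := by
  constructor <;> simp +contextual [shiftR, hM, h]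

/-- One move of a two-head automaton on the variables `i` and `j`. -/
def scanStmt {Q : Type} (δ : Q → Option Cell → Option Cell → Bool ⊕ (Q × Bool × Bool))
    (i j : Fin 10) (q : Q) : TM2.Stmt Sym Q Ctl :=
  let adv (d : Q × Bool × Bool → Bool) (v : Ctl) : Bool := (δ q v.bufL v.bufR).elim (fun _ => false) d
  let next : TM2.Stmt Sym Q Ctl := .goto fun v => (δ q v.bufL v.bufR).elim (fun _ => q) fun r => r.1
  let right : TM2.Stmt Sym Q Ctl := .branch (adv fun r => r.2.2)
    (.pop (.mem (.var j)) (fun v _ => v) (.push (.mem .auxR) (fun v => v.bufR.getD default) next))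
    next
  .peek (.mem (.var i)) (fun v a => { v with bufL := a }) <|
  .peek (.mem (.var j)) (fun v a => { v with bufR := a }) <|
  .branch (fun v => (δ q v.bufL v.bufR).isLeft)
    (.load (fun v => ⟨(δ q v.bufL v.bufR).elim id fun _ => false, v.go, none, none⟩) .halt) <|
  .branch (adv fun r => r.2.1)
    (.pop (.mem (.var i)) (fun v _ => v) (.push (.mem .auxL) (fun v => v.bufL.getD default) right))
    right

/-- Every move that does not answer consumes a letter of at least one word, whence the bound on the
number of steps. Consumed letters are kept on `auxL` and `auxR`, which is what `Shifted` records. -/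
theorem Scan.runs {Q : Type} {δ : Q → Option Cell → Option Cell → Bool ⊕ (Q × Bool × Bool)}
    {i j : Fin 10} (hij : i ≠ j) {q : Q} {s t : List Cell} {b : Bool} (h : Scan δ q s t b) :
    ∀ M, M (.var i) = s → M (.var j) = t → ∃ n ≤ s.length + t.length + 1, ∃ M', Shifted i j M M' ∧
      ∀ ip o g f y z, RunsIn (scanStmt δ i j) n ⟨some q, ⟨f, g, y, z⟩, pack ip o M⟩
        ⟨none, ⟨b, g, none, none⟩, pack ip o M'⟩ := by
  induction h with
  | ans h =>
    intro M hs ht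
    refine ⟨1, by omega, M, ⟨rfl, rfl, rfl, rfl, fun _ _ _ => rfl⟩, fun ip o g f y z => .step ?_⟩
    simp [scanStmt, hs, ht, h]
    exact .refl _
  | @popL _ _ a _ t _ h _ ih =>
    intro M hs ht
    obtain ⟨n, hn, M', hM, r⟩ := ih (shiftL i M a) (by simp [shiftL, hs])
      (by simp [shiftL, ht, hij.symm])
    refine ⟨n + 1, by simp; omega, M', (shifted_shiftL hij hs).trans hM,
      fun ip o g f y z => .step ?_⟩
    simp [scanStmt, hs, ht, h]
    simpa [shiftL, hs] using r ip o g f (some a) t.head?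
  | @popR _ _ c s _ _ h _ ih =>
    intro M hs ht
    obtain ⟨n, hn, M', hM, r⟩ := ih (shiftR j M c) (by simp [shiftR, hs, hij])
      (by simp [shiftR, ht])
    refine ⟨n + 1, by simp; omega, M', (shifted_shiftR hij ht).trans hM,
      fun ip o g f y z => .step ?_⟩
    simp [scanStmt, hs, ht, h]
    simpa [shiftR, ht] using r ip o g f s.head? (some c)
  | @popB _ _ a c _ _ _ h _ ih =>
    intro M hs ht
    obtain ⟨n, hn, M', hM, r⟩ := ih (shiftR j (shiftL i M a) c)
      (by simp [shiftR, shiftL, hs, hij]) (by simp [shiftR, shiftL, ht, hij.symm])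
    refine ⟨n + 1, by simp; omega, M', ((shifted_shiftL hij hs).trans
      (shifted_shiftR hij (by simp [shiftL, hij.symm]; exact ht))).trans hM,
      fun ip o g f y z => .step ?_⟩
    simp [scanStmt, hs, ht, h]
    simpa [shiftR, shiftL, hs, ht, hij.symm] using r ip o g f (some a) (some c)

theorem Shifted.restore {i j : Fin 10} (hij : i ≠ j) {M M' : Mem → List Cell}
    (h : Shifted i j M M') (hL : M .auxL = []) (hR : M .auxR = []) :
    Function.update (Function.update (Function.update (Function.update M' .auxL []) (.var i)
      ((M' .auxL).reverse ++ M' (.var i))) .auxR []) (.var j)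
      ((M' .auxR).reverse ++ M' (.var j)) = M := by
  funext x
  rcases x with _ | _ | _ | _ | k
  · simpa using h.cnt
  · simpa using h.res
  · simp [hL]
  · simp [hR]
  · by_cases hj : k = j
    · subst hj; simpa [hR] using h.right
    · by_cases hi : k = i
      · subst hi; simpa [hij, hL] using h.left
      · simpa [hi, hj] using h.var k hi hj

/-- A test has to leave the memory as it was. Draining the auxiliary stacks back rewinds both heads
and at most repeats the cost of reading. -/
theorem MImpl.scan {Q : Type} [Fintype Q]
    (δ : Q → Option Cell → Option Cell → Bool ⊕ (Q × Bool × Bool)) (q₀ : Q) {i j : Fin 10}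
    (hij : i ≠ j) : MImpl fun a c n => ∃ g f M b, a = (g, f, M) ∧ c = (g, b, M) ∧
      M .auxL = [] ∧ M .auxR = [] ∧ Scan δ q₀ (M (.var i)) (M (.var j)) b ∧
      n = 2 * (M (.var i)).length + 2 * (M (.var j)).length + 3 := by
  -- The specification quotes the run itself and so holds trivially; `Scan.runs` supplies the run
  -- below.
  have scanning : MImpl fun a c n => ∃ g f M b M', a = (g, f, M) ∧ c = (g, b, M') ∧
      Shifted i j M M' ∧ n = (M (.var i)).length + (M (.var j)).length + 1 ∧
      ∃ n' ≤ n, ∀ ip o, RunsIn (scanStmt δ i j) n' ⟨some q₀, (embed ip o a).1, (embed ip o a).2⟩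
        ⟨none, (embed ip o c).1, (embed ip o c).2⟩ := by
    refine ⟨Q, inferInstance, scanStmt δ i j, q₀, ?_⟩
    rintro _ _ n ⟨ip, o, a, c, rfl, rfl, g, f, M, b, M', rfl, rfl, -, -, n', hn, h⟩
    exact ⟨n', hn, h ip o⟩
  refine MImpl.mono (MImpl.seq scanning (MImpl.seq (MImpl.move (x := .auxL) (y := .var i) (by simp))
    (MImpl.move (x := .auxR) (y := .var j) (by simp)))) ?_
  rintro _ _ _ ⟨g, f, M, b, rfl, rfl, hL, hR, hs, rfl⟩
  obtain ⟨n, hn, M', hM, r⟩ := hs.runs hij M rfl rfl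
  have hLl := congrArg List.length hM.left
  have hRl := congrArg List.length hM.right
  simp only [List.length_append, List.length_reverse, hL, hR, List.length_nil] at hLl hRl
  refine ⟨_, ?_, (g, b, M'), _, _, ⟨g, f, M, b, M', rfl, rfl, hM, rfl, n, hn, fun ip o =>
    r ip o g f none none⟩, ⟨_, _, _, ⟨g, b, M', rfl, rfl, rfl⟩, ⟨g, b, _, rfl, ?_, rfl⟩, rfl⟩, rfl⟩
  · simp; omega
  · refine congrArg _ (congrArg _ (Eq.trans (hM.restore hij hL hR).symm ?_))
    simp [hij.symm]

end CQA

namespace CQA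

open Turing Computability

/-! ### Polynomial time predicates of words -/

open Classical in
/-- The predicate `P` of the variables is decided in polynomial time by a program that uses the
variables from `k` on as scratch space. -/
def Dec (k : ℕ) (P : (Fin 10 → List Cell) → Prop) : Prop :=
  ∃ p : Polynomial ℕ, MImpl fun a b n => ∃ f M N, a = (false, f, M) ∧
    b = (false, decide (P fun i => M (.var i)), M) ∧ M .auxL = [] ∧ M .auxR = [] ∧
    (∀ i : Fin 10, k ≤ i.val → M (.var i) = []) ∧ (∀ i, (M (.var i)).length ≤ N) ∧ n = p.eval N

theorem Dec.congr {k : ℕ} {P Q : (Fin 10 → List Cell) → Prop} (h : Dec k P) (hPQ : ∀ V, P V ↔ Q V) :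
    Dec k Q := by
  have : P = Q := funext fun V => propext (hPQ V)
  rwa [← this]

/-- `Dec k` makes a claim only about memories whose variables from `k` on are empty, so the
predicates need to agree only there. -/
theorem Dec.congr_of_empty {k : ℕ} {P Q : (Fin 10 → List Cell) → Prop} (h : Dec k P)
    (hPQ : ∀ V, (∀ i : Fin 10, k ≤ i.val → V i = []) → (P V ↔ Q V)) : Dec k Q := by
  obtain ⟨p, h⟩ := h
  refine ⟨p, MImpl.mono h ?_⟩
  rintro _ _ _ ⟨f, M, N, rfl, rfl, hL, hR, hV, hN, rfl⟩
  exact ⟨_, le_rfl, f, M, N, rfl, by rw [decide_eq_decide.2 (hPQ _ hV)], hL, hR, hV, hN, rfl⟩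

theorem Dec.scan {k : ℕ} {Q : Type} [Fintype Q]
    (δ : Q → Option Cell → Option Cell → Bool ⊕ (Q × Bool × Bool)) (q₀ : Q) {i j : Fin 10}
    (hij : i ≠ j) (P : List Cell → List Cell → Prop) (hT : ∀ s t, P s t → Scan δ q₀ s t true)
    (hF : ∀ s t, ¬ P s t → Scan δ q₀ s t false) :
    Dec k fun V => P (V i) (V j) := by
  classical
  refine ⟨4 * .X + 3, MImpl.mono (MImpl.scan δ q₀ hij) ?_⟩
  rintro _ _ _ ⟨f, M, N, rfl, rfl, hL, hR, -, hN, rfl⟩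
  refine ⟨_, ?_, false, f, M, _, rfl, rfl, hL, hR, ?_, rfl⟩
  · have := hN i
    have := hN j
    simp
    omega
  · by_cases h : P (M (.var i)) (M (.var j))
    · simpa [h] using hT _ _ h
    · simpa [h] using hF _ _ h

theorem Dec.not {k : ℕ} {P : (Fin 10 → List Cell) → Prop} (h : Dec k P) : Dec k fun V => ¬ P V := by
  classical
  obtain ⟨p, h⟩ := h
  refine ⟨p + 1, MImpl.mono (MImpl.seq h (MImpl.stmt
    (.load (fun v => { v with flag := !v.flag }) .halt))) ?_⟩
  rintro _ _ _ ⟨f, M, N, rfl, rfl, hL, hR, hV, hN, rfl⟩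
  refine ⟨_, le_rfl, _, _, _, ⟨f, M, N, rfl, rfl, hL, hR, hV, hN, rfl⟩,
    ⟨fun i o => ?_, rfl⟩, by simp⟩
  simp [embed]

theorem MImpl.skip : MImpl fun a b n => a = b ∧ n = 1 := by
  refine MImpl.mono (MImpl.stmt .halt) ?_
  rintro a _ _ ⟨rfl, rfl⟩
  exact ⟨1, le_rfl, fun i o => rfl, rfl⟩

theorem Dec.and {k : ℕ} {P Q : (Fin 10 → List Cell) → Prop} (hP : Dec k P) (hQ : Dec k Q) :
    Dec k fun V => P V ∧ Q V := by
  classical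
  obtain ⟨p, hP⟩ := hP
  obtain ⟨q, hQ⟩ := hQ
  refine ⟨p + q + 2, MImpl.mono (MImpl.seq hP (MImpl.ite hQ MImpl.skip)) ?_⟩
  rintro _ _ _ ⟨f, M, N, rfl, rfl, hL, hR, hV, hN, rfl⟩
  by_cases h : P fun i => M (.var i)
  · refine ⟨_, ?_, _, _, _, ⟨f, M, N, rfl, rfl, hL, hR, hV, hN, rfl⟩, ⟨q.eval N, ?_, rfl⟩, rfl⟩
    · simp; omega
    · simp only [h, decide_true, if_true, true_and]
      exact ⟨_, M, N, rfl, rfl, hL, hR, hV, hN, rfl⟩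
  · refine ⟨_, ?_, _, _, _, ⟨f, M, N, rfl, rfl, hL, hR, hV, hN, rfl⟩, ⟨1, ?_, rfl⟩, rfl⟩
    · simp
    · simp [h]

theorem Dec.const (k : ℕ) (c : Prop) : Dec k fun _ => c := by
  classical
  refine ⟨1, MImpl.mono (MImpl.stmt (.load (fun v => { v with flag := decide c }) .halt)) ?_⟩
  rintro _ _ _ ⟨f, M, N, rfl, rfl, hL, hR, hV, hN, rfl⟩
  exact ⟨1, by simp, fun i o => by simp [embed], rfl⟩

theorem Dec.or {k : ℕ} {P Q : (Fin 10 → List Cell) → Prop} (hP : Dec k P) (hQ : Dec k Q) :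
    Dec k fun V => P V ∨ Q V :=
  (hP.not.and hQ.not).not.congr fun V => by tauto

theorem Dec.imp {k : ℕ} {P Q : (Fin 10 → List Cell) → Prop} (hP : Dec k P) (hQ : Dec k Q) :
    Dec k fun V => P V → Q V :=
  (hP.not.or hQ).congr fun V => by tauto

theorem Dec.iff {k : ℕ} {P Q : (Fin 10 → List Cell) → Prop} (hP : Dec k P) (hQ : Dec k Q) :
    Dec k fun V => P V ↔ Q V :=
  ((hP.imp hQ).and (hQ.imp hP)).congr fun V => by tauto

/-- The set does not depend on the input, so the disjunction is written out in the program instead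
of being searched at run time. -/
theorem Dec.exists_mem {k : ℕ} {β : Type} {s : Set β} (hs : s.Finite)
    {P : β → (Fin 10 → List Cell) → Prop} (h : ∀ b ∈ s, Dec k (P b)) :
    Dec k fun V => ∃ b ∈ s, P b V := by
  induction s, hs using Set.Finite.induction_on with
  | empty => exact (Dec.const k False).congr fun V => by simp
  | insert _ _ ih =>
    exact ((h _ (Set.mem_insert _ _)).or
      (ih fun b hb => h b (Set.mem_insert_of_mem _ hb))).congr fun V => by simp

theorem Dec.forall_mem {k : ℕ} {β : Type} {s : Set β} (hs : s.Finite)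
    {P : β → (Fin 10 → List Cell) → Prop} (h : ∀ b ∈ s, Dec k (P b)) :
    Dec k fun V => ∀ b ∈ s, P b V :=
  (Dec.exists_mem hs fun b hb => (h b hb).not).not.congr fun V => by simp

open Classical in
/-- The specification of the body of the search for a suffix that satisfies `P`. -/
def SearchStep (k : Fin 10) (P : (Fin 10 → List Cell) → Prop) (c : ℕ → ℕ) (a b : MState) (n : ℕ) :
    Prop :=
  ∃ g f M N, a = (g, f, M) ∧
    b = (if P fun i => M (.var i) then (false, true, M) else
      (decide (M (.var k) ≠ []), false, Function.update M (.var k) (M (.var k)).tail)) ∧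
    M .auxL = [] ∧ M .auxR = [] ∧ (∀ i : Fin 10, k < i → M (.var i) = []) ∧
    (∀ i, (M (.var i)).length ≤ N) ∧ n = c N

theorem Dec.searchStep {k : Fin 10} {P : (Fin 10 → List Cell) → Prop} (h : Dec (k + 1) P) :
    ∃ p : Polynomial ℕ, MImpl (SearchStep k P fun N => p.eval N) := by
  classical
  obtain ⟨p, h⟩ := h
  refine ⟨1 + (p + 1), MImpl.mono (MImpl.seq (MImpl.stmt (.load (fun v => { v with go := false })
    .halt)) (MImpl.seq h (MImpl.stmt (.branch (fun v => v.flag) .halt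
    (.pop (.mem (.var k)) (fun _ a => ⟨false, a.isSome, none, none⟩) .halt))))) ?_⟩
  rintro _ _ _ ⟨g, f, M, N, rfl, rfl, hL, hR, hV, hN, rfl⟩
  refine ⟨_, ?_, (false, f, M), _, _, ⟨fun i o => rfl, rfl⟩, ⟨_, _, _,
    ⟨f, M, N, rfl, rfl, hL, hR, fun i hi => hV i hi, hN, rfl⟩, ⟨fun i o => ?_, rfl⟩, rfl⟩, rfl⟩
  · simp
  · by_cases hP : P fun i => M (.var i)
    · simp [embed, hP]
    · simp only [embed, hP]
      rcases hl : M (.var k) with _ | ⟨a, l⟩ <;> simp [hl]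

-- Each failed test drops one letter of variable `k`, so the suffixes of `s` are tested from the
-- longest to the empty one. What is left in the variable when the loop stops is the unspecified
-- `s'`, to be cleared afterwards.
open Classical in
theorem searchStep_iter {k : Fin 10} {P : (Fin 10 → List Cell) → Prop} {c : ℕ → ℕ}
    {M : Mem → List Cell} {N : ℕ} (hL : M .auxL = []) (hR : M .auxR = [])
    (hV : ∀ i : Fin 10, k ≤ i → M (.var i) = []) (hN : ∀ i, (M (.var i)).length ≤ N)
    (s : List Cell) (hs : s.length ≤ N) (g f : Bool) : ∃ s' : List Cell, s'.length ≤ N ∧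
      ∃ n ≤ (s.length + 1) * c N, Iter (SearchStep k P c) (fun a => a.1)
        (g, f, Function.update M (.var k) s)
        (false, decide (∃ t, t <:+ s ∧ P (Function.update (fun i => M (.var i)) k t)),
          Function.update M (.var k) s') n := by
  have hup (t : List Cell) : (fun i => Function.update M (.var k) t (.var i)) =
      Function.update (fun i => M (.var i)) k t := by
    funext i
    by_cases hi : i = k
    · subst hi; simp
    · simp [hi]
  have hlen {t : List Cell} (ht : t.length ≤ N) (i) :
      (Function.update M (.var k) t (.var i)).length ≤ N := by
    by_cases hi : i = k
    · subst hi; simpa using ht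
    · simpa [hi] using hN i
  have hgt (t : List Cell) (i) (hi : k < i) : Function.update M (.var k) t (.var i) = [] := by
    simpa [hi.ne'] using hV i hi.le
  have first {t : List Cell} (ht : t.length ≤ N) (g f : Bool) := show SearchStep k P c
      (g, f, Function.update M (.var k) t) _ (c N) from ⟨g, f, Function.update M (.var k) t, N,
        rfl, rfl, by simpa using hL, by simpa using hR, hgt t, hlen ht, rfl⟩
  simp only [hup, Function.update_self, Function.update_idem] at first
  induction s generalizing g f with
  | nil =>
    refine ⟨[], hs, c N, by simp, .last ?_ rfl⟩
    convert first hs g f using 1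
    by_cases h : P (Function.update (fun i => M (.var i)) k []) <;> simp [h]
  | cons x s ih =>
    by_cases h : P (Function.update (fun i => M (.var i)) k (x :: s))
    · refine ⟨x :: s, hs, c N, by simp [Nat.add_mul], .last ?_ rfl⟩
      convert first hs g f using 1
      have : ∃ t, t <:+ x :: s ∧ P (Function.update (fun i => M (.var i)) k t) :=
        ⟨_, List.suffix_rfl, h⟩
      simp [h, this]
    · have hs' : s.length ≤ N := by simp at hs; omega
      obtain ⟨s', hl, n, hn, it⟩ := ih hs' true false
      refine ⟨s', hl, c N + n, by simp [Nat.add_mul] at hn ⊢; omega, .next (t := (true, false, Function.update M (.var k) s)) ?_ ?_ ?_⟩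
      · convert first hs g f using 1
        simp [h]
      · rfl
      · convert it using 3
        refine decide_eq_decide.2 ⟨?_, fun ⟨t, ht, hP⟩ => ⟨t, ht.trans (List.suffix_cons _ _), hP⟩⟩
        rintro ⟨t, ht, hP⟩
        rcases List.suffix_cons_iff.1 ht with rfl | ht
        · exact absurd hP h
        · exact ⟨t, ht, hP⟩

/-- A word has only one suffix more than it has letters, so a search through all of them stays
polynomial. `hP` says that `P V` ignores the variable `k`, which the search overwrites. -/
theorem Dec.exists (k : Fin 10) (hk : k ≠ 0) {P : (Fin 10 → List Cell) → List Cell → Prop}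
    (h : Dec (k + 1) fun V => P V (V k)) (hP : ∀ V s, P (Function.update V k s) s ↔ P V s) :
    Dec k fun V => ∃ s, s <:+ V 0 ∧ P V s := by
  classical
  obtain ⟨p, step⟩ := Dec.searchStep h
  -- Copying the word costs at most `2N + 2`, clearing the rest `N + 1`, and at most `N + 1`
  -- suffixes are tested.
  refine ⟨3 * .X + 3 + (.X + 1) * p, MImpl.mono (MImpl.seq (MImpl.copy hk) (MImpl.seq
    step.doWhile (MImpl.clear (.var k)))) ?_⟩
  rintro _ _ _ ⟨f, M, N, rfl, rfl, hL, hR, hV, hN, rfl⟩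
  obtain ⟨s', hs', n, hn, hI⟩ := searchStep_iter (c := fun N => p.eval N) (k := k)
    (P := fun V => P V (V k)) hL hR hV hN (M (.var 0)) (hN 0) false f
  simp only [Function.update_self, hP] at hI
  refine ⟨_, ?_, _, _, _, ⟨false, f, M, rfl, hL, hV _ le_rfl, rfl, rfl⟩, ⟨_, _, _, hI,
    ⟨_, _, _, rfl, ?_, rfl⟩, rfl⟩, rfl⟩
  · simp
    have h1 : (M (.var 0)).length ≤ N := hN 0
    have h2 : ((M (.var 0)).length + 1) * p.eval N ≤ (N + 1) * p.eval N :=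
      Nat.mul_le_mul_right _ (by omega)
    omega
  · have := hV k le_rfl
    rw [Function.update_idem, ← this, Function.update_eq_self]

theorem Dec.forall (k : Fin 10) (hk : k ≠ 0) {P : (Fin 10 → List Cell) → List Cell → Prop}
    (h : Dec (k + 1) fun V => P V (V k)) (hP : ∀ V s, P (Function.update V k s) s ↔ P V s) :
    Dec k fun V => ∀ s, s <:+ V 0 → P V s :=
  (Dec.exists (P := fun V s => ¬ P V s) k hk h.not fun V s => not_congr (hP V s)).not.congr fun V => by
    simp

end CQA

/-! ### Iterated marking in polynomial time. -/

namespace CQA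

open Turing Computability

/-! ### Rounds of marking and the decision procedure -/

open Classical in
/-- Mark the suffix `s` of `w` wherever `φ` holds. -/
noncomputable def remark (φ : List Cell → List Cell → Prop) (w : List Cell) : List Cell → List Cell
  | [] => []
  | a :: s => (a.1, decide (φ w (a :: s))) :: remark φ w s

@[simp] theorem length_remark (φ : List Cell → List Cell → Prop) (w s : List Cell) :
    (remark φ w s).length = s.length := by
  induction s with
  | nil => rfl
  | cons a s ih => simp [remark, ih]

open Classical in
/-- The specification of the computation of one mark. -/
def RemarkStep (φ : List Cell → List Cell → Prop) (c : ℕ → ℕ) (a b : MState) (n : ℕ) : Prop :=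
  ∃ g f M N, a = (g, f, M) ∧
    b = (match M (.var 1) with
      | [] => (false, false, M)
      | x :: s => (true, false, Function.update (Function.update M (.var 1) s) .res
          ((x.1, decide (φ (M (.var 0)) (x :: s))) :: M .res))) ∧
    M .auxL = [] ∧ M .auxR = [] ∧ (∀ i : Fin 10, 1 < i → M (.var i) = []) ∧
    (∀ i, (M (.var i)).length ≤ N) ∧ n = c N

theorem Dec.remarkStep {φ : List Cell → List Cell → Prop} (h : Dec 2 fun V => φ (V 0) (V 1)) :
    ∃ p : Polynomial ℕ, MImpl (RemarkStep φ fun N => p.eval N) := by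
  classical
  obtain ⟨p, h⟩ := h
  refine ⟨1 + (p + 1), MImpl.mono (MImpl.seq (MImpl.stmt (.load (fun v => { v with go := false })
    .halt)) (MImpl.seq h (MImpl.stmt (.pop (.mem (.var 1)) (fun v a => { v with bufL := a })
    (.branch (fun v => v.bufL.isSome)
      (.push (.mem .res) (fun v => ((v.bufL.getD default).1, v.flag))
        (.load (fun _ => ⟨false, true, none, none⟩) .halt))
      (.load (fun _ => ⟨false, false, none, none⟩) .halt)))))) ?_⟩
  rintro _ _ _ ⟨g, f, M, N, rfl, rfl, hL, hR, hV, hN, rfl⟩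
  refine ⟨_, ?_, (false, f, M), _, _, ⟨fun i o => rfl, rfl⟩, ⟨_, _, _,
    ⟨f, M, N, rfl, rfl, hL, hR, fun i hi => hV i hi, hN, rfl⟩, ⟨fun i o => ?_, rfl⟩, rfl⟩, rfl⟩
  · simp
  · rcases hl : M (.var 1) with _ | ⟨a, l⟩
    · have : Function.update M (.var 1) [] = M := by rw [← hl, Function.update_eq_self]
      simp [embed, hl, this]
    · simp [embed, hl]

-- The new marks go to `res`, in reverse, while variable `0` keeps the old word. All marks of a
-- round are therefore computed from the marks of the round before.
open Classical in
theorem remarkStep_iter {φ : List Cell → List Cell → Prop} {c : ℕ → ℕ} {N : ℕ} (s : List Cell) :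
    ∀ (M : Mem → List Cell), M .auxL = [] → M .auxR = [] →
    (∀ i : Fin 10, 1 < i → M (.var i) = []) → (∀ i, (M (.var i)).length ≤ N) → M (.var 1) = s →
    ∀ g f, Iter (RemarkStep φ c) (fun a => a.1) (g, f, M)
        (false, false, Function.update (Function.update M (.var 1) []) .res
          ((remark φ (M (.var 0)) s).reverse ++ M .res)) ((s.length + 1) * c N) := by
  induction s with
  | nil =>
    intro M hL hR hV hN hs g f
    refine .last ⟨g, f, M, N, rfl, ?_, hL, hR, hV, hN, by simp⟩ rfl
    simp [hs, remark]
    nth_rw 1 [← hs]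
    simp
  | cons x s ih =>
    intro M hL hR hV hN hs g f
    have := ih (Function.update (Function.update M (.var 1) s) .res
      ((x.1, decide (φ (M (.var 0)) (x :: s))) :: M .res)) (by simpa using hL) (by simpa using hR)
      (fun i hi => by simpa [hi.ne'] using hV i hi) (fun i => ?_) (by simp) true false
    · rw [List.length_cons, show (s.length + 1 + 1) * c N = c N + (s.length + 1) * c N by ring]
      refine .next (t := (true, false, Function.update (Function.update M (.var 1) s) .res
        ((x.1, decide (φ (M (.var 0)) (x :: s))) :: M .res)))
        ⟨g, f, M, N, rfl, ?_, hL, hR, hV, hN, rfl⟩ ?_ ?_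
      · simp only [hs]
      · rfl
      · convert this using 3
        funext y
        rcases y with _ | _ | _ | _ | i <;> simp [remark, Function.update_apply]
        split_ifs <;> rfl
    · have h1 := hN 1
      rw [hs, List.length_cons] at h1
      by_cases hi : i = 1
      · subst hi; simp; omega
      · simpa [hi] using hN i

/-- The specification of one round of marking. -/
def RoundSpec (φ : List Cell → List Cell → Prop) (c : ℕ → ℕ) (a b : MState) (n : ℕ) : Prop :=
  ∃ f M N, a = (false, f, M) ∧
    b = (false, false, Function.update M (.var 0) (remark φ (M (.var 0)) (M (.var 0)))) ∧
    M .auxL = [] ∧ M .auxR = [] ∧ M .res = [] ∧ (∀ i : Fin 10, 0 < i → M (.var i) = []) ∧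
    (M (.var 0)).length ≤ N ∧ n = c N

theorem Dec.round {φ : List Cell → List Cell → Prop} (h : Dec 2 fun V => φ (V 0) (V 1)) :
    ∃ p : Polynomial ℕ, MImpl (RoundSpec φ fun N => p.eval N) := by
  obtain ⟨p, step⟩ := h.remarkStep
  refine ⟨4 * .X + 4 + (.X + 1) * p, MImpl.mono (MImpl.seq (MImpl.copy (k := 1) (by simp))
    (MImpl.seq step.doWhile (MImpl.seq (MImpl.clear (.var 0))
      (MImpl.move (x := .res) (y := .var 0) (by simp))))) ?_⟩
  rintro _ _ _ ⟨f, M, N, rfl, rfl, hL, hR, hS, hV, hN, rfl⟩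
  refine ⟨_, ?_, _, _, _, ⟨false, f, M, rfl, hL, hV 1 (by simp), rfl, rfl⟩, ⟨_, _, _,
    remarkStep_iter (N := N) (M (.var 0)) _ (by simpa using hL) (by simpa using hR)
      (fun i hi => ?_) (fun i => ?_) (by simp) _ _, ⟨_, _, _, ⟨_, _, _, rfl, rfl, rfl⟩,
      ⟨_, _, _, rfl, ?_, rfl⟩, rfl⟩, rfl⟩, rfl⟩
  · have h2 : ((M (.var 0)).length + 1) * p.eval N ≤ (N + 1) * p.eval N :=
      Nat.mul_le_mul_right _ (by omega)
    simp [hS]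
    omega
  · simpa [hi.ne'] using hV i (lt_trans (by simp) hi)
  · by_cases h1 : i = 1
    · subst h1; simpa using hN
    · by_cases h0 : i = 0
      · subst h0; simpa using hN
      · simp [h1, hV i (Fin.pos_iff_ne_zero.2 h0)]
  · refine congrArg _ (congrArg _ ?_)
    funext y
    rcases y with _ | _ | _ | _ | i
    · simp
    · simp [hS]
    · simp
    · simp
    · by_cases h1 : i = 1
      · subst h1; simp [hV 1 (by simp)]
      · by_cases h0 : i = 0
        · subst h0; simp [hS]
        · simp [h1, h0]

/-- The specification of a round of marking that is run as long as the counter is not empty. -/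
def CountedRound (φ : List Cell → List Cell → Prop) (c : ℕ → ℕ) (a b : MState) (n : ℕ) : Prop :=
  ∃ g f M N, a = (g, f, M) ∧
    b = (match M .cnt with
      | [] => (false, false, M)
      | _ :: l => (true, false, Function.update (Function.update M .cnt l) (.var 0)
          (remark φ (M (.var 0)) (M (.var 0))))) ∧
    M .auxL = [] ∧ M .auxR = [] ∧ M .res = [] ∧ (∀ i : Fin 10, 0 < i → M (.var i) = []) ∧
    (M (.var 0)).length ≤ N ∧ n = c N

theorem Dec.countedRound {φ : List Cell → List Cell → Prop} (h : Dec 2 fun V => φ (V 0) (V 1)) :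
    ∃ p : Polynomial ℕ, MImpl (CountedRound φ fun N => p.eval N) := by
  obtain ⟨p, round⟩ := h.round
  refine ⟨p + 3, MImpl.mono (MImpl.seq (MImpl.stmt (.pop (.mem .cnt)
    (fun _ a => ⟨a.isSome, false, none, none⟩) .halt)) (MImpl.ite (MImpl.seq round
      (MImpl.stmt (.load (fun v => { v with go := true }) .halt))) MImpl.skip)) ?_⟩
  rintro _ _ _ ⟨g, f, M, N, rfl, rfl, hL, hR, hS, hV, hN, rfl⟩
  rcases hl : M .cnt with _ | ⟨x, l⟩
  · refine ⟨_, ?_, (false, false, M), _, _, ⟨fun i o => ?_, rfl⟩,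
      ⟨_, by simp only [Bool.false_eq_true, if_false]; exact ⟨trivial, rfl⟩, rfl⟩, rfl⟩
    · simp
    · have : Function.update M .cnt [] = M := by rw [← hl, Function.update_eq_self]
      simp [embed, hl, this]
  · refine ⟨_, ?_, (false, true, Function.update M .cnt l), _, _, ⟨fun i o => ?_, rfl⟩,
      ⟨p.eval N + 1, ?_, rfl⟩, rfl⟩
    · simp; omega
    · simp [embed, hl]
    · simp only [if_true]
      refine ⟨_, _, _, ⟨true, _, N, rfl, rfl, by simpa using hL, by simpa using hR,
        by simpa using hS, by simpa using hV, by simpa using hN, rfl⟩, ⟨fun i o => ?_, rfl⟩, rfl⟩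
      simp [embed]

/-- Each round takes one letter off the counter, so there are as many rounds as it has letters; a
last pass finds it empty. Rounds preserve the length of the word, hence the bound `N`. -/
theorem countedRound_iter {φ : List Cell → List Cell → Prop} {c : ℕ → ℕ} {N : ℕ} (l : List Cell) :
    ∀ (M : Mem → List Cell), M .auxL = [] → M .auxR = [] → M .res = [] →
    (∀ i : Fin 10, 0 < i → M (.var i) = []) → (M (.var 0)).length ≤ N → M .cnt = l →
    ∀ g f, Iter (CountedRound φ c) (fun a => a.1) (g, f, M)
        (false, false, Function.update (Function.update M .cnt []) (.var 0)
          ((fun w => remark φ w w)^[l.length] (M (.var 0)))) ((l.length + 1) * c N) := by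
  induction l with
  | nil =>
    intro M hL hR hS hV hN hl g f
    refine .last ⟨g, f, M, N, rfl, ?_, hL, hR, hS, hV, hN, by simp⟩ rfl
    simp [hl]
    nth_rw 1 [← hl]
    simp
  | cons x l ih =>
    intro M hL hR hS hV hN hl g f
    have := ih (Function.update (Function.update M .cnt l) (.var 0)
      (remark φ (M (.var 0)) (M (.var 0)))) (by simpa using hL) (by simpa using hR)
      (by simpa using hS) (fun i hi => by simpa [hi.ne'] using hV i hi) (by simpa using hN)
      (by simp) true false
    rw [List.length_cons, show (l.length + 1 + 1) * c N = c N + (l.length + 1) * c N by ring]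
    refine .next (t := (true, false, Function.update (Function.update M .cnt l) (.var 0)
        (remark φ (M (.var 0)) (M (.var 0)))))
        ⟨g, f, M, N, rfl, ?_, hL, hR, hS, hV, hN, rfl⟩ rfl ?_
    · simp only [hl]
    · convert this using 3
      funext y
      rcases y with _ | _ | _ | _ | i <;> simp [Function.update_apply]
      split_ifs <;> rfl

/-- The initial internal state. -/
def Ctl.init : Ctl := ⟨false, false, none, none⟩

/-- Read the input as a word without marks, and as many letters into the counter. -/
theorem Impl.load : Impl fun (s t : MachineState Sym Ctl) n => ∃ u : List Γ',
    s = (Ctl.init, pack u [] fun _ => []) ∧ n = u.length + 1 ∧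
    t = (Ctl.init, pack [] [] (drainTo [.auxL, .cnt] (u.map fun a => (a, false)) fun _ => [])) := by
  let m : Unit → TM2.Stmt Sym Unit Ctl := fun _ => .pop .inp
    (fun v a => { v with bufL := a.map fun a => (a, false) })
    (.branch (fun v => v.bufL.isSome) (pushStmt [.auxL, .cnt] (.goto fun _ => ())) .halt)
  have key : ∀ (u : List Γ') z M, RunsIn m (u.length + 1)
      ⟨some (), ⟨false, false, z, none⟩, pack u [] M⟩
      ⟨none, Ctl.init, pack [] [] (drainTo [.auxL, .cnt] (u.map fun a => (a, false)) M)⟩ := by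
    intro u
    induction u with
    | nil =>
      intro z M
      refine .step ?_
      simp [m, drainTo]
      exact .refl _
    | cons a l ih =>
      intro z M
      refine .step ?_
      simp only [m, TM2.stepAux.eq_3, TM2.stepAux.eq_5, pack_inp, Option.map_some,
        List.head?_cons, List.tail_cons, Option.isSome_some, cond_true, update_pack_inp,
        stepAux_pushStmt, Option.getD_some, TM2.stepAux.eq_6]
      exact ih (some (a, false)) _
  refine ⟨Unit, inferInstance, m, (), ?_⟩
  rintro _ _ _ ⟨u, rfl, rfl, rfl⟩
  exact ⟨_, le_rfl, key u none _⟩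

open Classical in
/-- The program that loads a word, marks it in as many rounds as it has letters by the predicate
`φ`, and then evaluates `ψ`. -/
theorem Dec.decide_impl {φ : List Cell → List Cell → Prop} (hφ : Dec 2 fun V => φ (V 0) (V 1))
    {ψ : List Cell → Prop} (hψ : Dec 1 fun V => ψ (V 0)) :
    ∃ p : Polynomial ℕ, Impl fun (s t : MachineState Sym Ctl) n => ∃ u : List Γ',
      s = (Ctl.init, pack u [] fun _ => []) ∧ n = p.eval u.length ∧
      t = (Ctl.init, pack [] [decide (ψ ((fun w => remark φ w w)^[u.length]
        (u.map fun a => (a, false))))] fun _ => []) := by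
  obtain ⟨p, round⟩ := hφ.countedRound
  obtain ⟨q, final⟩ := hψ
  -- Loading, moving and clearing cost `N + 1` each, and writing the output one step.
  refine ⟨3 * .X + 4 + (.X + 1) * p + q, Impl.mono (Impl.seq Impl.load (Impl.seq (MImpl.seq
    (MImpl.move (x := .auxL) (y := .var 0) (by simp)) (MImpl.seq round.doWhile (MImpl.seq final
    (MImpl.clear (.var 0))))) (Impl.stmt (.push .out (fun v => v.flag)
      (.load (fun _ => Ctl.init) .halt))))) ?_⟩
  rintro _ _ _ ⟨u, rfl, rfl, rfl⟩
  set w : List Cell := u.map fun a => (a, false) with hw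
  have hwl : w.length = u.length := by simp [hw]
  -- Moving out of `auxL` restores the order of the letters in variable `0`. The counter stays
  -- reversed, but only its length matters.
  have hload : Function.update (Function.update
      (drainTo [.auxL, .cnt] w fun _ => []) .auxL []) (.var 0)
      ((drainTo [.auxL, .cnt] w (fun _ => []) .auxL).reverse ++
        drainTo [.auxL, .cnt] w (fun _ => []) (.var 0)) =
      Function.update (Function.update (fun _ => []) .cnt w.reverse) (.var 0) w := by
    rw [drainTo_pair (by simp)]
    funext y
    rcases y with _ | _ | _ | _ | i <;> simp [Function.update_apply]
  have hlen (n : ℕ) : ((fun w => remark φ w w)^[n] w).length = w.length := by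
    induction n with
    | zero => rfl
    | succ n ih => rw [Function.iterate_succ_apply']; simp [ih]
  set w' := (fun w => remark φ w w)^[u.length] w with hw'
  set M₀ : Mem → List Cell :=
    Function.update (Function.update (fun _ => []) .cnt w.reverse) (.var 0) w with hM₀
  have hM₁ : Function.update (Function.update M₀ .cnt []) (.var 0)
      ((fun w => remark φ w w)^[w.reverse.length] (M₀ (.var 0))) =
      Function.update (fun _ => []) (.var 0) w' := by
    funext y
    rcases y with _ | _ | _ | _ | i <;> simp [hM₀, Function.update_apply, hw', hwl]
    split_ifs <;> rfl
  have hloop := countedRound_iter (φ := φ) (c := fun N => p.eval N) (N := u.length) w.reverse M₀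
    (by simp [hM₀]) (by simp [hM₀]) (by simp [hM₀]) (fun i hi => by simp [hM₀, hi.ne'])
    (by simp [hM₀, hwl]) (by simp [hM₀]) false false
  rw [hM₁] at hloop
  refine ⟨_, ?_, _, _, _, ⟨u, rfl, rfl, rfl⟩, ⟨_, _, _, ⟨[], [], (false, false, _),
    (false, decide (ψ w'), fun _ => []), rfl, rfl, (false, false, M₀), _, _,
      ⟨_, _, _, rfl, congrArg (fun M => (false, false, M)) hload.symm, rfl⟩, ⟨_, _, _, hloop,
      ⟨(false, decide (ψ w'), Function.update (fun _ => []) (.var 0) w'), _, _,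
        ⟨_, _, u.length, rfl, ?_, rfl, rfl, fun i hi => ?_, fun i => ?_, rfl⟩,
        ⟨_, _, _, rfl, ?_, rfl⟩, rfl⟩, rfl⟩, rfl⟩,
      ⟨?_, rfl⟩, rfl⟩, rfl⟩
  · have h1 : (drainTo [.auxL, .cnt] w (fun _ => []) .auxL).length = u.length := by
      rw [drainTo_pair (by simp)]
      simp [hwl]
    rw [hw] at h1
    have h2 : w'.length = u.length := (hlen _).trans hwl
    simp [h1, h2, hwl]
    omega
  · simp
  · have : i ≠ 0 := by rintro rfl; simp at hi
    simp [this]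
  · by_cases h0 : i = 0
    · subst h0; simp [hw', hlen, hwl]
    · simp [h0]
  · refine congrArg _ (congrArg _ ?_)
    rw [Function.update_idem]
    exact (Function.update_eq_self (.var 0) (fun _ : Mem => ([] : List Cell))).symm
  · simp [embed]

/-- A set of strings is decided in polynomial time if it can be described by rounds of marking by
a polynomial time predicate, followed by another one. -/
theorem inPTIME_of_dec {α : Type} {enc : α → List Γ'} {L : Set α}
    {φ : List Cell → List Cell → Prop} (hφ : Dec 2 fun V => φ (V 0) (V 1))
    {ψ : List Cell → Prop} (hψ : Dec 1 fun V => ψ (V 0))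
    (hL : ∀ a, a ∈ L ↔ ψ ((fun w => remark φ w w)^[(enc a).length]
      ((enc a).map fun c => (c, false)))) : InPTIME enc L := by
  classical
  obtain ⟨p, Λ, _, m, e, h⟩ := Dec.decide_impl hφ hψ
  let tm : FinTM2 :=
    { K := Stk, k₀ := .inp, k₁ := .out, Γ := Sym, Λ := Λ, main := e, σ := Ctl
      initialState := Ctl.init
      Γk₀Fin := inferInstanceAs (Fintype Γ')
      m := m }
  have hi (l : List Γ') : initList tm l = ⟨some e, Ctl.init, pack l [] fun _ => []⟩ := by
    refine congrArg (TM2.Cfg.mk (some e) Ctl.init) (funext fun k => ?_)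
    rcases k with _ | _ | x <;> rfl
  have ho (l : List Bool) : haltList tm l = ⟨none, Ctl.init, pack [] l fun _ => []⟩ := by
    refine congrArg (TM2.Cfg.mk none Ctl.init) (funext fun k => ?_)
    rcases k with _ | _ | x <;> rfl
  refine ⟨{
    tm := tm
    inputAlphabet := Equiv.refl _
    outputAlphabet := Equiv.refl _
    time := p
    -- The structure asks for the run as data, whereas `RunsIn` only provides its existence.
    outputsFun := fun a => Classical.choice ?_ }⟩
  obtain ⟨n, hn, r⟩ := h _ _ _ ⟨enc a, rfl, rfl, rfl⟩
  refine ⟨⟨⟨n, ?_⟩, hn⟩⟩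
  have := r.iterate_eq
  simp only [← hL] at this
  refine Eq.trans (congrArg _ (congrArg some ?_)) (this.trans (congrArg some ?_))
  · exact (hi (List.map id (enc a))).trans (by rw [List.map_id])
  · exact (ho [decide (a ∈ L)]).symm

end CQA

/-! ### Automata for the atomic formulas. -/

namespace CQA

open Turing Computability

/-! ### Basic predicates of words -/

/-- The letters of a marked word. -/
abbrev letters (s : List Cell) : List Γ' := s.map Prod.fst

/-- Automata have two heads on distinct variables; those that need only one leave the other idle on
some other variable. -/
theorem exists_fin_ne (i : Fin 10) : ∃ j, i ≠ j := by
  by_cases h : i = 0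
  · exact ⟨1, by simp [h]⟩
  · exact ⟨0, h⟩

theorem Dec.fold (k : ℕ) {Q : Type} [Fintype Q] (δ : Q → Γ' → Q) (q₀ : Q) (acc : Q → Bool)
    (i : Fin 10) : Dec k fun V => acc ((letters (V i)).foldl δ q₀) = true := by
  obtain ⟨j, hij⟩ := exists_fin_ne i
  let δ' : Q → Option Cell → Option Cell → Bool ⊕ (Q × Bool × Bool)
    | q, none, _ => .inl (acc q)
    | q, some a, _ => .inr (δ q a.1, true, false)
  have key : ∀ s q t, Scan δ' q s t (acc ((letters s).foldl δ q)) := by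
    intro s
    induction s with
    | nil => intro q t; exact .ans rfl
    | cons a s ih => intro q t; exact .popL rfl (ih _ t)
  refine Dec.scan δ' q₀ hij (fun s _ => acc ((letters s).foldl δ q₀) = true) ?_ ?_
  · intro s t h; rw [← h]; exact key s q₀ t
  · intro s t h; rw [← Bool.not_eq_true _ |>.mp h]; exact key s q₀ t

theorem Dec.prefix (k : ℕ) (l : List Γ') (i : Fin 10) : Dec k fun V => l <+: letters (V i) := by
  obtain ⟨j, hij⟩ := exists_fin_ne i
  -- The state is the part of `l` still to be matched; there are finitely many because `l` is fixed.
  let δ : {m // m ∈ l.tails} → Option Cell → Option Cell →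
      Bool ⊕ ({m // m ∈ l.tails} × Bool × Bool)
    | ⟨[], _⟩, _, _ => .inl true
    | ⟨_ :: _, _⟩, none, _ => .inl false
    | ⟨c :: m, h⟩, some a, _ => if a.1 = c then .inr (⟨m, by
        rw [List.mem_tails] at h ⊢; exact (List.suffix_cons c m).trans h⟩, true, false)
        else .inl false
  have key : ∀ s q t, Scan δ q s t (decide (q.1 <+: letters s)) := by
    intro s
    induction s with
    | nil =>
      rintro ⟨_ | ⟨c, m⟩, h⟩ t
      · exact .ans (by simp [δ])
      · exact .ans (by simp [δ])
    | cons a s ih =>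
      rintro ⟨_ | ⟨c, m⟩, h⟩ t
      · exact .ans (by simp [δ])
      · by_cases hc : a.1 = c
        · refine .popL (q' := ⟨m, (List.mem_tails _ _).2
            ((List.suffix_cons c m).trans ((List.mem_tails _ _).1 h))⟩)
            (by simp [δ, hc]) ?_
          convert ih _ t using 2
          simp [hc]
        · exact .ans (by simp [δ, hc, Ne.symm hc])
  refine Dec.scan δ ⟨l, by simp⟩ hij (fun s _ => l <+: letters s) ?_ ?_
  · intro s t h; simpa [h] using key s ⟨l, by simp⟩ t
  · intro s t h; simpa [h] using key s ⟨l, by simp⟩ t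

/-- The first letter carries a mark. -/
def Marked (s : List Cell) : Prop := ∃ c, s.head? = some (c, true)

theorem Dec.marked (k : ℕ) (i : Fin 10) : Dec k fun V => Marked (V i) := by
  obtain ⟨j, hij⟩ := exists_fin_ne i
  refine Dec.scan (Q := Unit) (fun _ a _ => .inl (a.elim false Prod.snd)) () hij
    (fun s _ => Marked s) ?_ ?_
  · rintro s t ⟨c, h⟩
    exact .ans (by simp [h])
  · intro s t h
    refine .ans ?_
    rcases hs : s.head? with _ | ⟨c, _ | _⟩
    · rfl
    · rfl
    · exact absurd ⟨c, hs⟩ h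

/-- Drop the letters up to the `n`-th occurrence of `c`. -/
def skip (c : Γ') : ℕ → List Γ' → List Γ'
  | 0, s => s
  | _ + 1, [] => []
  | n + 1, a :: s => if a = c then skip c n s else skip c (n + 1) s

/-- The two words agree up to the first delimiter. -/
def agree (D : Γ' → Bool) : List Γ' → List Γ' → Bool
  | a :: s, b :: t => if D a || D b then D a && D b else decide (a = b) && agree D s t
  | _, _ => false

/-- The state counts the letters `c` that each head has still to pass. The first head moves to its
place, then the second does, and then both advance together; `h₃`, `h₂` and `h₁` treat these phases.
-/
theorem Dec.agree (k : ℕ) (D : Γ' → Bool) (c : Γ') (n m : ℕ) {i j : Fin 10} (hij : i ≠ j) :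
    Dec k fun V => agree D (skip c n (letters (V i))) (skip c m (letters (V j))) = true := by
  let Q := Fin (n + 1) × Fin (m + 1)
  let δ : Q → Option Cell → Option Cell → Bool ⊕ (Q × Bool × Bool)
    | (⟨_ + 1, _⟩, _), none, _ => .inl false
    | (⟨x + 1, h⟩, y), some a, _ =>
        .inr (if a.1 = c then (⟨x, by omega⟩, y) else (⟨x + 1, h⟩, y), true, false)
    | (⟨0, _⟩, ⟨_ + 1, _⟩), _, none => .inl false
    | (⟨0, h⟩, ⟨y + 1, h'⟩), _, some b =>
        .inr (if b.1 = c then (⟨0, h⟩, ⟨y, by omega⟩) else (⟨0, h⟩, ⟨y + 1, h'⟩), false, true)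
    | (⟨0, h⟩, ⟨0, h'⟩), some a, some b =>
        if D a.1 || D b.1 then .inl (D a.1 && D b.1) else
        if a.1 = b.1 then .inr ((⟨0, h⟩, ⟨0, h'⟩), true, true) else .inl false
    | (⟨0, _⟩, ⟨0, _⟩), _, _ => .inl false
  have h₁ : ∀ s t h h', Scan δ (⟨0, h⟩, ⟨0, h'⟩) s t (CQA.agree D (letters s) (letters t)) := by
    intro s
    induction s with
    | nil => intro t h h'; cases t <;> exact .ans rfl
    | cons a s ih =>
      intro t h h'
      cases t with
      | nil => exact .ans rfl
      | cons b t =>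
        by_cases hD : (D a.1 || D b.1) = true
        · refine .ans ?_
          simp only [δ, List.head?_cons, List.map_cons, CQA.agree, hD, if_true]
        · by_cases hab : a.1 = b.1
          · refine .popB ?_ (q' := (⟨0, h⟩, ⟨0, h'⟩)) ?_
            · simp only [δ, if_neg hD, if_pos hab]
            · simp only [List.map_cons, CQA.agree, if_neg hD, decide_eq_true hab, Bool.true_and]
              exact ih t h h'
          · refine .ans ?_
            simp only [δ, List.head?_cons, List.map_cons, CQA.agree, hD, hab]
            rfl
  have nil₁ (t) : CQA.agree D [] t = false := by cases t <;> rfl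
  have nil₂ (t) : CQA.agree D t [] = false := by cases t <;> rfl
  have h₂ : ∀ t s y h h', Scan δ (⟨0, h⟩, ⟨y, h'⟩) s t
      (CQA.agree D (letters s) (skip c y (letters t))) := by
    intro t
    induction t with
    | nil =>
      intro s y h h'
      cases y with
      | zero => exact h₁ s [] h h'
      | succ y => exact .ans (by simp only [List.map_nil, skip, nil₂]; cases s <;> rfl)
    | cons b t ih =>
      intro s y h h'
      cases y with
      | zero => exact h₁ s (b :: t) h h'
      | succ y =>
        by_cases hb : b.1 = c
        · refine .popR (q' := (⟨0, h⟩, ⟨y, by omega⟩)) (by cases s <;> simp only [δ, hb, if_true]) ?_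
          simpa [skip, hb] using ih s y h _
        · refine .popR (q' := (⟨0, h⟩, ⟨y + 1, h'⟩)) (by cases s <;> simp only [δ, hb, if_false]) ?_
          simpa [skip, hb] using ih s (y + 1) h h'
  have h₃ : ∀ s t x y h h', Scan δ (⟨x, h⟩, ⟨y, h'⟩) s t
      (CQA.agree D (skip c x (letters s)) (skip c y (letters t))) := by
    intro s
    induction s with
    | nil =>
      intro t x y h h'
      cases x with
      | zero => exact h₂ t [] y h h'
      | succ x => exact .ans (by simp only [List.map_nil, skip, nil₁]; cases t <;> rfl)
    | cons a s ih =>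
      intro t x y h h'
      cases x with
      | zero => exact h₂ t (a :: s) y h h'
      | succ x =>
        by_cases ha : a.1 = c
        · refine .popL (q' := (⟨x, by omega⟩, ⟨y, h'⟩)) (by cases t <;> simp only [δ, ha, if_true]) ?_
          simpa [skip, ha] using ih t x y _ h'
        · refine .popL (q' := (⟨x + 1, h⟩, ⟨y, h'⟩)) (by cases t <;> simp only [δ, ha, if_false]) ?_
          simpa [skip, ha] using ih t (x + 1) y h h'
  have h₄ := fun s t => h₃ s t n m (by omega) (by omega)
  refine Dec.scan δ (⟨n, by omega⟩, ⟨m, by omega⟩) hij (fun s t =>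
     CQA.agree D (skip c n (letters s)) (skip c m (letters t)) = true)
    (fun s t h => ?_) (fun s t h => ?_)
  · rw [← h]; exact h₄ s t
  · rw [← Bool.not_eq_true _ |>.mp h]; exact h₄ s t

end CQA

/-! ### The combinatorial core: groups, parts and optimal repairs. -/

namespace CQA

/-! ### Acyclic relations -/

/-- The transitive closure of an acyclic relation is a strict order, and a nonempty finite set has a
minimal element in it. -/
theorem exists_undominated {α : Type} {r : α → α → Prop} (hr : ∀ p, ¬ Relation.TransGen r p p)
    {s : Finset α} (hs : s.Nonempty) : ∃ a ∈ s, ∀ y ∈ s, ¬ r y a := by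
  have : IsStrictOrder α (Relation.TransGen r) :=
    { irrefl := hr, trans := fun _ _ _ => Relation.TransGen.trans }
  have wf : (s : Set α).WellFoundedOn (Relation.TransGen r) := s.finite_toSet.wellFoundedOn
  obtain ⟨x, hx⟩ := hs
  obtain ⟨⟨a, ha⟩, -, h⟩ := WellFounded.has_min wf Set.univ ⟨⟨x, hx⟩, trivial⟩
  exact ⟨a, ha, fun y hy hya => h ⟨y, hy⟩ trivial (.single hya)⟩

/-- Adding arrows that start in undominated points does not create cycles. -/
theorem acyclic_of_undominated {α : Type} {r r' : α → α → Prop} {T : α → Prop}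
    (hr : ∀ p, ¬ Relation.TransGen r p p) (h : ∀ x y, r' x y → r x y ∨ T x)
    (hT : ∀ z x, T x → ¬ r' z x) (p : α) : ¬ Relation.TransGen r' p p := by
  intro hp
  -- A point with a predecessor is not in `T`, so the arrows from it are old. Every later point of a
  -- path has a predecessor too, and on a cycle so does the first.
  have key : ∀ x y, Relation.TransGen r' x y → (∃ z, r' z x) → Relation.TransGen r x y := by
    intro x y hxy
    induction hxy using Relation.TransGen.head_induction_on with
    | single hxy =>
      rintro ⟨z, hz⟩
      exact .single ((h _ _ hxy).resolve_right fun t => hT _ _ t hz)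
    | head hxy _ ih =>
      rintro ⟨z, hz⟩
      exact .head ((h _ _ hxy).resolve_right fun t => hT _ _ t hz) (ih ⟨_, hxy⟩)
  obtain ⟨z, -, hz⟩ := Relation.TransGen.tail'_iff.1 hp
  exact hr p (key p p hp ⟨z, hz⟩)

/-! ### The shape of conflicts under one dependency per relation -/

section Conflicts

variable {S : Schema} {F : Set (FD S)}

/-- The constants of a fact as strings. -/
def segments (p : Fact S) : List (List Computability.Γ') :=
  List.ofFn fun i => encodeConst (S.dom p.1 i) (p.2 i)

/-- The facts `p` and `q` of the relation `R` have the same constants at the positions in `X`. -/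
def AgreeOn (R : Fin S.numRel) (X : Finset (Fin (S.arity R))) (p q : Fact S) : Prop :=
  p.1 = R ∧ q.1 = R ∧ ∀ i ∈ X, (segments p)[i.val]? = (segments q)[i.val]?

/-- `AgreeOn` compares encoded constants, which avoids transport between tuple types and is what the
machine can observe; injectivity of the encoding brings it back to tuples. -/
theorem agreeOn_mk {R : Fin S.numRel} {X : Finset (Fin (S.arity R))} {t u : Tuple S R} :
    AgreeOn R X ⟨R, t⟩ ⟨R, u⟩ ↔ ∀ i ∈ X, t i = u i := by
  simp only [AgreeOn, true_and]
  refine forall₂_congr fun i _ => ?_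
  have h (v : Tuple S R) : (segments ⟨R, v⟩)[i.val]? = some (encodeConst (S.dom R i) (v i)) := by
    simp [segments]
  rw [h, h, Option.some_inj, (encodeConst_inj _).eq_iff]

theorem AgreeOn.symm {R : Fin S.numRel} {X : Finset (Fin (S.arity R))} {p q : Fact S}
    (h : AgreeOn R X p q) : AgreeOn R X q p :=
  ⟨h.2.1, h.1, fun i hi => (h.2.2 i hi).symm⟩

theorem AgreeOn.trans {R : Fin S.numRel} {X : Finset (Fin (S.arity R))} {p q o : Fact S}
    (h : AgreeOn R X p q) (h' : AgreeOn R X q o) : AgreeOn R X p o :=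
  ⟨h.1, h'.2.1, fun i hi => (h.2.2 i hi).trans (h'.2.2 i hi)⟩

theorem FD.violates_iff {f : FD S} {p q : Fact S} :
    f.Violates p q ↔ AgreeOn f.rel f.lhs p q ∧ ¬ AgreeOn f.rel f.rhs p q := by
  constructor
  · rintro ⟨t, u, rfl, rfl, h, h'⟩
    exact ⟨agreeOn_mk.2 h, fun h'' => h' (agreeOn_mk.1 h'')⟩
  · obtain ⟨R, t⟩ := p
    obtain ⟨R', u⟩ := q
    rintro ⟨h, h'⟩
    obtain rfl : R = f.rel := h.1
    obtain rfl : R' = f.rel := h.2.1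
    exact ⟨t, u, rfl, rfl, agreeOn_mk.1 h, fun h'' => h' (agreeOn_mk.2 h'')⟩

/-- `p` and `q` violate a dependency. -/
def Clash (F : Set (FD S)) (p q : Fact S) : Prop := ∃ f ∈ F, f.Violates p q

/-- `p` and `q` agree on the left-hand side of a dependency, or are equal. -/
def SameGroup (F : Set (FD S)) (p q : Fact S) : Prop :=
  p = q ∨ ∃ f ∈ F, AgreeOn f.rel f.lhs p q

/-- `p` and `q` agree on both sides of a dependency, or are equal. -/
def SamePart (F : Set (FD S)) (p q : Fact S) : Prop :=
  p = q ∨ ∃ f ∈ F, AgreeOn f.rel f.lhs p q ∧ AgreeOn f.rel f.rhs p q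

theorem SamePart.sameGroup {p q : Fact S} (h : SamePart F p q) : SameGroup F p q :=
  h.imp_right fun ⟨f, hf, h, _⟩ => ⟨f, hf, h⟩

theorem SameGroup.refl (p : Fact S) : SameGroup F p p := .inl rfl

theorem SamePart.refl (p : Fact S) : SamePart F p p := .inl rfl

theorem SameGroup.symm {p q : Fact S} (h : SameGroup F p q) : SameGroup F q p :=
  h.imp Eq.symm fun ⟨f, hf, h⟩ => ⟨f, hf, h.symm⟩

theorem SamePart.symm {p q : Fact S} (h : SamePart F p q) : SamePart F q p :=
  h.imp Eq.symm fun ⟨f, hf, h, h'⟩ => ⟨f, hf, h.symm, h'.symm⟩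

variable (hF : ∀ f ∈ F, ∀ g ∈ F, f.rel = g.rel → f = g)
include hF

/-- Both agreements concern the relation of `q`, which has only one dependency. With several
dependencies per relation transitivity would fail. -/
theorem SameGroup.trans {p q o : Fact S} (h : SameGroup F p q) (h' : SameGroup F q o) :
    SameGroup F p o := by
  rcases h with rfl | ⟨f, hf, h⟩
  · exact h'
  · rcases h' with rfl | ⟨g, hg, h'⟩
    · exact .inr ⟨f, hf, h⟩
    · obtain rfl := hF f hf g hg (h.2.1.symm.trans h'.1)
      exact .inr ⟨f, hf, h.trans h'⟩

theorem SamePart.trans {p q o : Fact S} (h : SamePart F p q) (h' : SamePart F q o) :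
    SamePart F p o := by
  rcases h with rfl | ⟨f, hf, h⟩
  · exact h'
  · rcases h' with rfl | ⟨g, hg, h'⟩
    · exact .inr ⟨f, hf, h⟩
    · obtain rfl := hF f hf g hg (h.1.2.1.symm.trans h'.1.1)
      exact .inr ⟨f, hf, h.1.trans h'.1, h.2.trans h'.2⟩

/-- Thus the conflict graph of a group is complete multipartite, with the parts as its classes.
Everything below uses conflicts only in this form. -/
theorem clash_iff {p q : Fact S} : Clash F p q ↔ SameGroup F p q ∧ ¬ SamePart F p q := by
  constructor
  · rintro ⟨f, hf, h⟩
    rw [FD.violates_iff] at h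
    refine ⟨.inr ⟨f, hf, h.1⟩, ?_⟩
    rintro (rfl | ⟨g, hg, h'⟩)
    · exact h.2 ⟨h.1.1, h.1.1, fun _ _ => rfl⟩
    · obtain rfl := hF f hf g hg (h.1.1.symm.trans h'.1.1)
      exact h.2 h'.2
  · rintro ⟨rfl | ⟨f, hf, h⟩, h'⟩
    · exact absurd (.refl p) h'
    · exact ⟨f, hf, FD.violates_iff.2 ⟨h, fun h'' => h' (.inr ⟨f, hf, h, h''⟩)⟩⟩

theorem Clash.symm {p q : Fact S} (h : Clash F p q) : Clash F q p := by
  rw [clash_iff hF] at h ⊢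
  exact ⟨h.1.symm, fun h' => h.2 h'.symm⟩

theorem consistent_iff {J : DBInstance S} :
    Consistent F J ↔ ∀ p ∈ J, ∀ q ∈ J, SameGroup F p q → SamePart F p q := by
  constructor
  · intro h p hp q hq hg
    by_contra hs
    obtain ⟨f, hf, hv⟩ := (clash_iff hF).2 ⟨hg, hs⟩
    exact h f hf p hp q hq hv
  · intro h f hf p hp q hq hv
    have := (clash_iff hF).1 ⟨f, hf, hv⟩
    exact this.2 (h p hp q hq this.1)

/-! ### Repairs choose a part of every group -/

/-- Facts of one part clash with the same facts, so `q` can be added to `J` consistently and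
maximality puts it there. -/
theorem IsRepair.closed {I J : DBInstance S} (h : IsRepair F I J) {p q : Fact S} (hp : p ∈ J)
    (hq : q ∈ I) (hpq : SamePart F p q) : q ∈ J := by
  classical
  have hc := (consistent_iff hF).1 h.2.1
  rw [← h.2.2 (insert q J) (Finset.subset_insert _ _) (Finset.insert_subset hq h.1) ?_]
  · exact Finset.mem_insert_self _ _
  · have key : ∀ b ∈ J, SameGroup F q b → SamePart F q b := fun b hb hg =>
      hpq.symm.trans hF (hc p hp b hb (hpq.sameGroup.trans hF hg))
    rw [consistent_iff hF]
    intro a ha b hb hg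
    rcases Finset.mem_insert.1 ha with rfl | ha' <;> rcases Finset.mem_insert.1 hb with rfl | hb'
    · exact .refl _
    · exact key b hb' hg
    · exact (key a ha' hg.symm).symm
    · exact hc a ha' b hb' hg

/-- A fact whose group were missed by `J` would clash with nothing in `J` and could be added. -/
theorem IsRepair.meets {I J : DBInstance S} (h : IsRepair F I J) {p : Fact S} (hp : p ∈ I) :
    ∃ q ∈ J, SameGroup F p q := by
  classical
  by_contra hn
  push Not at hn
  have hc := (consistent_iff hF).1 h.2.1
  have hpJ : p ∈ J := by
    rw [← h.2.2 (insert p J) (Finset.subset_insert _ _) (Finset.insert_subset hp h.1) ?_]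
    · exact Finset.mem_insert_self _ _
    · rw [consistent_iff hF]
      intro a ha b hb hg
      rcases Finset.mem_insert.1 ha with rfl | ha' <;> rcases Finset.mem_insert.1 hb with rfl | hb'
      · exact .refl _
      · exact absurd hg (hn b hb')
      · exact absurd hg.symm (hn a ha')
      · exact hc a ha' b hb' hg
  exact hn p hpJ (.refl p)

/-- In a consistent extension of `J`, any fact shares its group, hence its part, with a fact of `J`,
and `J` contains the whole of that part. -/
theorem isRepair_of {I J : DBInstance S} (hJ : J ⊆ I)
    (hc : ∀ p ∈ J, ∀ q ∈ J, SameGroup F p q → SamePart F p q)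
    (hcl : ∀ p ∈ J, ∀ q ∈ I, SamePart F p q → q ∈ J) (hm : ∀ p ∈ I, ∃ q ∈ J, SameGroup F p q) :
    IsRepair F I J := by
  refine ⟨hJ, (consistent_iff hF).2 hc, fun K hJK hKI hK => Finset.Subset.antisymm ?_ hJK⟩
  intro x hx
  obtain ⟨q, hq, hg⟩ := hm x (hKI hx)
  exact hcl q hq x (hKI hx) ((consistent_iff hF).1 hK x hx q (hJK hq) hg).symm

/-! ### Optimality is decided part by part -/

omit hF in
/-- No fact dominates the whole part of `p`. -/
def ParetoGood (F : Set (FD S)) (I : DBInstance S) (r : Fact S → Fact S → Prop) (p : Fact S) :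
    Prop :=
  ¬ ∃ y ∈ I, Clash F y p ∧ ∀ x ∈ I, SamePart F x p → r y x

omit hF in
/-- No other part dominates the part of `p`. -/
def GlobalGood (F : Set (FD S)) (I : DBInstance S) (r : Fact S → Fact S → Prop) (p : Fact S) :
    Prop :=
  ¬ ∃ z ∈ I, Clash F z p ∧ ∀ x ∈ I, SamePart F x p → ∃ y ∈ I, SamePart F y z ∧ r y x

omit hF in
/-- The part of `p` contains an undominated fact. -/
def CommonGood (F : Set (FD S)) (I : DBInstance S) (r : Fact S → Fact S → Prop) (p : Fact S) :
    Prop :=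
  ∃ a ∈ I, SamePart F a p ∧ ∀ y ∈ I, ¬ r y a

-- This and the next lemma reduce the existence of good parts to the strongest condition, which
-- `exists_commonGood` provides.
omit hF in
theorem CommonGood.globalGood {I : DBInstance S} {r : Fact S → Fact S → Prop} {p : Fact S}
    (h : CommonGood F I r p) : GlobalGood F I r p := by
  obtain ⟨a, ha, hap, hr⟩ := h
  rintro ⟨z, -, -, hx⟩
  obtain ⟨y, hy, -, hya⟩ := hx a ha hap
  exact hr y hy hya

omit hF in
theorem GlobalGood.paretoGood {I : DBInstance S} {r : Fact S → Fact S → Prop} {p : Fact S}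
    (h : GlobalGood F I r p) : ParetoGood F I r p :=
  fun ⟨y, hy, hyp, hx⟩ => h ⟨y, hy, hyp, fun x hxI hxp => ⟨y, hy, .refl y, hx x hxI hxp⟩⟩

theorem Clash.congr {y p q : Fact S} (h : Clash F y p) (hpq : SamePart F p q) : Clash F y q := by
  rw [clash_iff hF] at h ⊢
  exact ⟨h.1.trans hF hpq.sameGroup, fun h' => h.2 (h'.trans hF hpq.symm)⟩

theorem CommonGood.congr {I : DBInstance S} {r : Fact S → Fact S → Prop} {p q : Fact S}
    (hpq : SamePart F p q) (h : CommonGood F I r p) : CommonGood F I r q :=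
  let ⟨a, ha, hap, hr⟩ := h
  ⟨a, ha, hap.trans hF hpq, hr⟩

theorem GlobalGood.congr {I : DBInstance S} {r : Fact S → Fact S → Prop} {p q : Fact S}
    (hpq : SamePart F p q) (h : GlobalGood F I r p) : GlobalGood F I r q :=
  fun ⟨z, hz, hzq, hx⟩ => h ⟨z, hz, hzq.congr hF hpq.symm,
    fun x hxI hxp => hx x hxI (hxp.trans hF hpq)⟩

theorem ParetoGood.congr {I : DBInstance S} {r : Fact S → Fact S → Prop} {p q : Fact S}
    (hpq : SamePart F p q) (h : ParetoGood F I r p) : ParetoGood F I r q :=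
  fun ⟨z, hz, hzq, hx⟩ => h ⟨z, hz, hzq.congr hF hpq.symm,
    fun x hxI hxp => hx x hxI (hxp.trans hF hpq)⟩

/-- A fact of a conflict is its own neighbor, but acyclicity forbids loops; related facts are thus
distinct members of a conflict and clash. -/
theorem isPriority_iff {I : DBInstance S} {r : Fact S → Fact S → Prop} :
    IsPriority F I r ↔ (∀ p, ¬ Relation.TransGen r p p) ∧
      ∀ p q, r p q → p ∈ I ∧ q ∈ I ∧ Clash F p q := by
  classical
  constructor
  · rintro ⟨h1, h2, h3⟩
    refine ⟨h2, fun p q hpq => ⟨(h1 p q hpq).1, (h1 p q hpq).2, ?_⟩⟩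
    obtain ⟨C, ⟨-, f, hf, a, b, rfl, hv⟩, hp, hq⟩ := h3 p q hpq
    have hne : p ≠ q := by
      rintro rfl
      exact h2 p (.single hpq)
    have hc : Clash F a b := ⟨f, hf, hv⟩
    simp only [Finset.mem_insert, Finset.mem_singleton] at hp hq
    rcases hp with rfl | rfl <;> rcases hq with rfl | rfl
    · exact absurd rfl hne
    · exact hc
    · exact hc.symm hF
    · exact absurd rfl hne
  · rintro ⟨h1, h2⟩
    refine ⟨fun p q h => ⟨(h2 p q h).1, (h2 p q h).2.1⟩, h1, fun p q h => ?_⟩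
    obtain ⟨hp, hq, f, hf, hv⟩ := h2 p q h
    refine ⟨{p, q}, ⟨?_, f, hf, p, q, rfl, hv⟩, by simp, by simp⟩
    intro x hx
    simp only [Finset.mem_insert, Finset.mem_singleton] at hx
    rcases hx with rfl | rfl <;> assumption

/-- Whatever dominates a fact lies in its group, so a fact undominated within the group is
undominated in `I`. -/
theorem exists_commonGood {I : DBInstance S} {r : Fact S → Fact S → Prop} (hr : IsPriority F I r)
    {p : Fact S} (hp : p ∈ I) : ∃ q ∈ I, SameGroup F q p ∧ ∀ y ∈ I, ¬ r y q := by
  classical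
  rw [isPriority_iff hF] at hr
  obtain ⟨a, ha, h⟩ := exists_undominated hr.1 (s := I.filter fun q => SameGroup F q p)
    ⟨p, by simp [hp, SameGroup.refl]⟩
  rw [Finset.mem_filter] at ha
  refine ⟨a, ha.1, ha.2, fun y hy hya => h y ?_ hya⟩
  have := ((clash_iff hF).1 (hr.2 y a hya).2.2).1
  exact Finset.mem_filter.2 ⟨hy, this.trans hF ha.2⟩

/-- If `y` dominates the part of `p`, that part can be exchanged for `{y}`. Conversely, given an
improving exchange with `x` removed and `y` added, no fact of the part of `x` can stay beside `y`,
so `y` dominates all of that part. -/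
theorem paretoOptimal_iff {I J : DBInstance S} {r : Fact S → Fact S → Prop}
    (hr : IsPriority F I r) (hJ : IsRepair F I J) :
    ParetoOptimal F I r J ↔ ∀ p ∈ J, ParetoGood F I r p := by
  classical
  have hc := (consistent_iff hF).1 hJ.2.1
  rw [isPriority_iff hF] at hr
  constructor
  · rintro ⟨-, h⟩ p hp ⟨y, hy, hyp, hdom⟩
    rw [clash_iff hF] at hyp
    refine h ⟨J.filter fun x => SameGroup F x p, {y}, ⟨p, by simp [hp, SameGroup.refl]⟩,
      Finset.filter_subset _ _, by simp, ?_, ?_, (consistent_iff hF).2 ?_⟩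
    · simp only [Finset.singleton_subset_iff, Finset.mem_sdiff]
      exact ⟨hy, fun hyJ => hyp.2 (hc y hyJ p hp hyp.1)⟩
    · intro x hx y' hy'
      rw [Finset.mem_singleton.1 hy']
      rw [Finset.mem_filter] at hx
      exact hdom x (hJ.1 hx.1) (hc x hx.1 p hp hx.2)
    · have key : ∀ a ∈ J \ J.filter (fun x => SameGroup F x p), ¬ SameGroup F a y := by
        intro a ha hg
        rw [Finset.mem_sdiff, Finset.mem_filter] at ha
        exact ha.2 ⟨ha.1, hg.trans hF hyp.1⟩
      intro a ha b hb hg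
      rcases Finset.mem_union.1 ha with ha | ha <;> rcases Finset.mem_union.1 hb with hb | hb
      · exact hc a (Finset.mem_sdiff.1 ha).1 b (Finset.mem_sdiff.1 hb).1 hg
      · rw [Finset.mem_singleton.1 hb] at hg
        exact absurd hg (key a ha)
      · rw [Finset.mem_singleton.1 ha] at hg
        exact absurd hg.symm (key b hb)
      · rw [Finset.mem_singleton.1 ha, Finset.mem_singleton.1 hb]
        exact .refl _
  · refine fun h => ⟨hJ.1, ?_⟩
    rintro ⟨X, Y, ⟨x, hx⟩, hXJ, ⟨y, hy⟩, hY, hdom, hcons⟩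
    have hcl := (hr.2 y x (hdom x hx y hy)).2.2
    have hcl' := (clash_iff hF).1 hcl
    refine h x (hXJ hx) ⟨y, (Finset.mem_sdiff.1 (hY hy)).1, hcl, fun x' hx' hs => ?_⟩
    by_contra hn
    have hx'X : x' ∉ X := fun hX => hn (hdom x' hX y hy)
    have hx'J := hJ.closed hF (hXJ hx) hx' hs.symm
    have := (consistent_iff hF).1 hcons y (by simp [hy]) x' (by simp [hx'J, hx'X])
      (hcl'.1.trans hF hs.symm.sameGroup)
    exact hcl'.2 (this.trans hF hs)

/-- A dominating part of `z` can replace the part of `p` as a whole. Conversely, an improving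
exchange must remove the entire part of any removed fact `x`, and the facts that dominate it all lie
in one group, where consistency leaves a single part. -/
theorem globallyOptimal_iff {I J : DBInstance S} {r : Fact S → Fact S → Prop}
    (hr : IsPriority F I r) (hJ : IsRepair F I J) :
    GloballyOptimal F I r J ↔ ∀ p ∈ J, GlobalGood F I r p := by
  classical
  have hc := (consistent_iff hF).1 hJ.2.1
  rw [isPriority_iff hF] at hr
  constructor
  · rintro ⟨-, h⟩ p hp ⟨z, hz, hzp, hdom⟩
    rw [clash_iff hF] at hzp
    refine h ⟨J.filter fun x => SameGroup F x p, I.filter fun y => SamePart F y z,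
      ⟨p, by simp [hp, SameGroup.refl]⟩, Finset.filter_subset _ _, ?_, ?_, (consistent_iff hF).2 ?_⟩
    · intro y hy
      rw [Finset.mem_filter] at hy
      refine Finset.mem_sdiff.2 ⟨hy.1, fun hyJ => hzp.2 (hy.2.symm.trans hF ?_)⟩
      exact hc y hyJ p hp (hy.2.sameGroup.trans hF hzp.1)
    · intro x hx
      rw [Finset.mem_filter] at hx
      obtain ⟨y, hy, hyz, hyx⟩ := hdom x (hJ.1 hx.1) (hc x hx.1 p hp hx.2)
      exact ⟨y, Finset.mem_filter.2 ⟨hy, hyz⟩, hyx⟩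
    · have key : ∀ a ∈ J \ J.filter (fun x => SameGroup F x p),
          ∀ y ∈ I.filter fun y => SamePart F y z, ¬ SameGroup F a y := by
        intro a ha y hy hg
        rw [Finset.mem_sdiff, Finset.mem_filter] at ha
        rw [Finset.mem_filter] at hy
        exact ha.2 ⟨ha.1, hg.trans hF (hy.2.sameGroup.trans hF hzp.1)⟩
      intro a ha b hb hg
      rcases Finset.mem_union.1 ha with ha | ha <;> rcases Finset.mem_union.1 hb with hb | hb
      · exact hc a (Finset.mem_sdiff.1 ha).1 b (Finset.mem_sdiff.1 hb).1 hg
      · exact absurd hg (key a ha b hb)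
      · exact absurd hg.symm (key b hb a ha)
      · exact (Finset.mem_filter.1 ha).2.trans hF (Finset.mem_filter.1 hb).2.symm
  · refine fun h => ⟨hJ.1, ?_⟩
    rintro ⟨X, Y, ⟨x, hx⟩, hXJ, hY, hdom, hcons⟩
    have hcons := (consistent_iff hF).1 hcons
    obtain ⟨y, hy, hyx⟩ := hdom x hx
    have hcl := (hr.2 y x hyx).2.2
    have hcl' := (clash_iff hF).1 hcl
    refine h x (hXJ hx) ⟨y, (Finset.mem_sdiff.1 (hY hy)).1, hcl, fun x' hx' hs => ?_⟩
    have hx'J := hJ.closed hF (hXJ hx) hx' hs.symm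
    have hx'X : x' ∈ X := by
      by_contra hn
      have := hcons y (by simp [hy]) x' (by simp [hx'J, hn])
        (hcl'.1.trans hF hs.symm.sameGroup)
      exact hcl'.2 (this.trans hF hs)
    obtain ⟨y', hy', hyx'⟩ := hdom x' hx'X
    refine ⟨y', (Finset.mem_sdiff.1 (hY hy')).1, hcons y' (by simp [hy']) y (by simp [hy]) ?_, hyx'⟩
    have := ((clash_iff hF).1 (hr.2 y' x' hyx').2.2).1
    exact this.trans hF (hs.sameGroup.trans hF hcl'.1.symm)

-- Priorities are subsets of the finite set `I ×ˢ I`; an extension of `r` with the most arrows is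
-- total.
omit hF in
theorem exists_isTotalPriority {I : DBInstance S} {r : Fact S → Fact S → Prop}
    (hr : IsPriority F I r) : ∃ r', IsTotalPriority F I r' ∧ ∀ p q, r p q → r' p q := by
  classical
  let rel (P : Finset (Fact S × Fact S)) : Fact S → Fact S → Prop := fun p q => (p, q) ∈ P
  have toFin : ∀ r, IsPriority F I r → rel ((I ×ˢ I).filter fun e => r e.1 e.2) = r := by
    intro r hr
    funext p q
    have := hr.1 p q
    simp only [rel, Finset.mem_filter, Finset.mem_product, eq_iff_iff]
    tauto
  obtain ⟨P, hP, hmax⟩ := Finset.exists_max_image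
    ((I ×ˢ I).powerset.filter fun P => IsPriority F I (rel P) ∧ ∀ p q, r p q → rel P p q)
    Finset.card ⟨(I ×ˢ I).filter fun e => r e.1 e.2, by
      rw [Finset.mem_filter, toFin r hr, Finset.mem_powerset]
      exact ⟨Finset.filter_subset _ _, hr, fun _ _ h => h⟩⟩
  rw [Finset.mem_filter] at hP
  refine ⟨rel P, ⟨hP.2.1, fun r' hr' hsub => ?_⟩, hP.2.2⟩
  have hle := hmax ((I ×ˢ I).filter fun e => r' e.1 e.2) (by
    rw [Finset.mem_filter, toFin r' hr', Finset.mem_powerset]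
    exact ⟨Finset.filter_subset _ _, hr', fun p q h => hsub p q (hP.2.2 p q h)⟩)
  rw [Finset.eq_of_subset_of_card_le (s := P) (t := (I ×ˢ I).filter fun e => r' e.1 e.2) ?_ hle,
    toFin r' hr']
  rintro ⟨p, q⟩ he
  exact Finset.mem_filter.2 ⟨Finset.mem_powerset.1 hP.1 he, hsub p q he⟩

/-- An arrow out of an undominated point closes no cycle, so a total priority already contains it.
-/
theorem IsTotalPriority.of_undominated {I : DBInstance S} {r : Fact S → Fact S → Prop}
    (hr : IsTotalPriority F I r) {a x : Fact S} (ha : a ∈ I) (hx : x ∈ I) (hax : Clash F a x)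
    (hu : ∀ y, ¬ r y a) : r a x := by
  have hr' := (isPriority_iff hF).1 hr.1
  have : (fun p q => r p q ∨ (p = a ∧ q = x)) = r := by
    refine hr.2 _ ((isPriority_iff hF).2 ⟨?_, ?_⟩) fun p q h => .inl h
    · refine acyclic_of_undominated (T := fun p => p = a) hr'.1 (fun p q h => h.imp_right And.left) ?_
      rintro z _ rfl (h | ⟨rfl, rfl⟩)
      · exact hu z h
      · exact ((clash_iff hF).1 hax).2 (.refl _)
    · rintro p q (h | ⟨rfl, rfl⟩)
      · exact hr'.2 p q h
      · exact ⟨ha, hx, hax⟩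
  rw [← this]
  exact .inr ⟨rfl, rfl⟩

/-- For a total extension, an undominated fact of the group dominates every fact it clashes with, so
it must lie in the chosen part; it is undominated for `r` as well. Conversely, `r` is extended so
that the undominated facts of `J` dominate all facts they clash with, and such a fact protects its
part. -/
theorem commonOptimal_iff {I J : DBInstance S} {r : Fact S → Fact S → Prop}
    (hr : IsPriority F I r) (hJ : IsRepair F I J) :
    CommonOptimal F I r J ↔ ∀ p ∈ J, CommonGood F I r p := by
  have hc := (consistent_iff hF).1 hJ.2.1
  constructor
  · rintro ⟨-, r', ht, hsub, hg⟩ p hp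
    rw [globallyOptimal_iff hF ht.1 hJ] at hg
    obtain ⟨a, ha, hap, hu⟩ := exists_commonGood hF ht.1 (hJ.1 hp)
    refine ⟨a, ha, ?_, fun y hy h => hu y hy (hsub _ _ h)⟩
    by_contra hn
    refine hg p hp ⟨a, ha, (clash_iff hF).2 ⟨hap, hn⟩, fun x hx hxp => ⟨a, ha, .refl a, ?_⟩⟩
    exact ht.of_undominated hF ha hx (((clash_iff hF).2 ⟨hap, hn⟩).congr hF hxp.symm)
      fun y hya => hu y (ht.1.1 y a hya).1 hya
  · intro h
    have hr' := (isPriority_iff hF).1 hr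
    obtain ⟨r', ht, hsub⟩ := exists_isTotalPriority (F := F) (I := I)
      -- The sources of the new arrows stay undominated: a new arrow between two of them would be a
      -- clash inside `J`.
      (r := fun p q => r p q ∨ ((p ∈ J ∧ ∀ y ∈ I, ¬ r y p) ∧ q ∈ I ∧ Clash F p q)) <| by
      refine (isPriority_iff hF).2 ⟨?_, ?_⟩
      · refine acyclic_of_undominated (T := fun p => p ∈ J ∧ ∀ y ∈ I, ¬ r y p) hr'.1
          (fun p q h => h.imp_right And.left) ?_
        rintro z x ⟨hx, hu⟩ (h | ⟨⟨hz, -⟩, -, hcl⟩)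
        · exact hu z (hr'.2 z x h).1 h
        · rw [clash_iff hF] at hcl
          exact hcl.2 (hc z hz x hx hcl.1)
      · rintro p q (h | ⟨⟨hp, -⟩, hq, hcl⟩)
        · exact hr'.2 p q h
        · exact ⟨hJ.1 hp, hq, hcl⟩
    refine ⟨hJ.1, r', ht, fun p q h => hsub p q (.inl h), (globallyOptimal_iff hF ht.1 hJ).2 ?_⟩
    rintro p hp ⟨z, hz, hzp, hdom⟩
    obtain ⟨a, ha, hap, hu⟩ := h p hp
    obtain ⟨y, hy, -, hya⟩ := hdom a ha hap
    have hcl := (((isPriority_iff hF).1 ht.1).2 y a hya).2.2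
    exact ht.1.2.1 a (.tail (.single (hsub a y (.inr ⟨⟨hJ.closed hF hp ha hap.symm, hu⟩, hy,
      hcl.symm hF⟩))) hya)

/-! ### Preferred answers -/

omit hF in
/-- The facts that occur in a query. -/
def Query.facts : Query S → Finset (Fact S)
  | .fact p => {p}
  | .neg φ => φ.facts
  | .conj φ ψ | .disj φ ψ => φ.facts ∪ ψ.facts
  | _ => ∅

omit hF in
theorem Query.holds_congr {J K : DBInstance S} : ∀ {Q : Query S}, (∀ q ∈ Q.facts, q ∈ J ↔ q ∈ K) →
    (Q.Holds J ↔ Q.Holds K)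
  | .fact p, h => h p (by simp [Query.facts])
  | .nameEq _ _, _ | .nameNe _ _, _ | .comp _ _ _, _ => Iff.rfl
  | .neg φ, h => not_congr (Query.holds_congr (Q := φ) h)
  | .conj φ ψ, h => and_congr
      (Query.holds_congr (Q := φ) fun q hq => h q (Finset.mem_union_left _ hq))
      (Query.holds_congr (Q := ψ) fun q hq => h q (Finset.mem_union_right _ hq))
  | .disj φ ψ, h => or_congr
      (Query.holds_congr (Q := φ) fun q hq => h q (Finset.mem_union_left _ hq))
      (Query.holds_congr (Q := ψ) fun q hq => h q (Finset.mem_union_right _ hq))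

/-- A counterexample repair matters only through its trace `T` on the facts of the query. The
right-hand side forbids each `T` with the wrong truth value by saying that it is not realizable
group by group. A realizable trace comes from a repair because the choices in different groups do
not interact, and `hex` completes the choice in the groups that the query does not meet. -/
theorem preferredAnswer_iff {X : RepairFamily S} {I : DBInstance S} {r : Fact S → Fact S → Prop}
    {good : Fact S → Prop} (hX : ∀ J, J ∈ X F I r ↔ IsRepair F I J ∧ ∀ p ∈ J, good p)
    (hcongr : ∀ p q, SamePart F p q → good p → good q)
    (hex : ∀ p ∈ I, ∃ q ∈ I, SameGroup F q p ∧ good q) (Q : Query S) (b : Bool) :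
    PreferredAnswer X F I r Q b ↔ ∀ T ∈ (Q.facts.powerset : Set (DBInstance S)),
      ¬ (Q.Holds T ↔ b = true) → ¬ ((∀ q ∈ (T : Set (Fact S)), q ∈ I) ∧
      ∀ q ∈ (Q.facts : Set (Fact S)), q ∈ I → ∃ p ∈ I, good p ∧ SameGroup F p q ∧
        ∀ q' ∈ (Q.facts : Set (Fact S)), SameGroup F q q' → (q' ∈ T ↔ q' ∈ I ∧ SamePart F q' p)) := by
  classical
  constructor
  · rintro h T - hT ⟨hTI, hq⟩
    let Φ (g : Set (Fact S)) (p : Fact S) : Prop := p ∈ I ∧ good p ∧ p ∈ g ∧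
      ∀ q' ∈ Q.facts, q' ∈ g → (q' ∈ T ↔ q' ∈ I ∧ SamePart F q' p)
    let grp (x : Fact S) : Set (Fact S) := {y | SameGroup F x y}
    -- The chosen representative depends only on the set `g`, so facts with equal groups are given
    -- the same part.
    let sel (g : Set (Fact S)) (x : Fact S) : Prop := ∃ h : ∃ p, Φ g p, SamePart F x h.choose
    have hgrp {x y : Fact S} (hxy : SameGroup F x y) : grp x = grp y :=
      Set.ext fun z => ⟨hxy.symm.trans hF, hxy.trans hF⟩
    have hΦ (x) (hx : x ∈ I) : ∃ p, Φ (grp x) p := by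
      -- A group without instance facts from the query has an empty trace, so any good part of it
      -- will do.
      by_cases hxq : ∃ q ∈ Q.facts, q ∈ I ∧ SameGroup F x q
      · obtain ⟨q, hqQ, hqI, hxq⟩ := hxq
        obtain ⟨p, hp, hpg, hpq, hp'⟩ := hq q hqQ hqI
        exact ⟨p, hp, hpg, hxq.trans hF hpq.symm, fun q' hq' hxq' =>
          hp' q' hq' (hxq.symm.trans hF hxq')⟩
      · obtain ⟨p, hp, hpx, hpg⟩ := hex x hx
        refine ⟨p, hp, hpg, hpx.symm, fun q' hq' hxq' => ⟨fun ht => ?_, fun hi => ?_⟩⟩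
        · exact absurd ⟨q', hq', hTI q' ht, hxq'⟩ hxq
        · exact absurd ⟨q', hq', hi.1, hxq'⟩ hxq
    have hmem {x : Fact S} : x ∈ I.filter (fun x => sel (grp x) x) ↔ x ∈ I ∧ sel (grp x) x :=
      Finset.mem_filter
    have hpart {g : Set (Fact S)} {x y : Fact S} (hx : sel g x) (hy : sel g y) : SamePart F x y :=
      let ⟨_, hx⟩ := hx
      let ⟨_, hy⟩ := hy
      hx.trans hF hy.symm
    have hJ : I.filter (fun x => sel (grp x) x) ∈ X F I r := by
      refine (hX _).2 ⟨isRepair_of hF (Finset.filter_subset _ _) ?_ ?_ ?_, ?_⟩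
      · intro p hp q hq hg
        have hp := (hmem.1 hp).2
        rw [hgrp hg] at hp
        exact hpart hp (hmem.1 hq).2
      · intro p hp q hq hs
        obtain ⟨h, hp⟩ := (hmem.1 hp).2
        refine hmem.2 ⟨hq, ?_⟩
        rw [← hgrp hs.sameGroup]
        exact ⟨h, hs.symm.trans hF hp⟩
      · intro p hp
        have hc := (hΦ p hp).choose_spec
        refine ⟨_, hmem.2 ⟨hc.1, ?_⟩, hc.2.2.1⟩
        rw [← hgrp hc.2.2.1]
        exact ⟨hΦ p hp, .refl _⟩
      · intro p hp
        obtain ⟨h, hp⟩ := (hmem.1 hp).2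
        exact hcongr _ _ hp.symm h.choose_spec.2.1
    refine hT ((Query.holds_congr fun q hqQ => ?_).trans (h _ hJ))
    rw [hmem]
    constructor
    · intro hqT
      have hc := (hΦ q (hTI q hqT)).choose_spec
      exact ⟨hTI q hqT, hΦ q (hTI q hqT), ((hc.2.2.2 q hqQ (.refl q)).1 hqT).2⟩
    · rintro ⟨hqI, h, hs⟩
      exact (h.choose_spec.2.2.2 q hqQ (.refl q)).2 ⟨hqI, hs⟩
  · intro h J hJ
    by_contra hn
    obtain ⟨hrep, hg⟩ := (hX J).1 hJ
    have hc := (consistent_iff hF).1 hrep.2.1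
    refine h (Q.facts.filter (· ∈ J)) ?_ ?_ ⟨?_, ?_⟩
    · exact Finset.mem_coe.2 (Finset.mem_powerset.2 (Finset.filter_subset _ _))
    · rwa [Query.holds_congr (K := J) (by simp +contextual)]
    · intro q hq
      exact hrep.1 (by simpa using (Finset.mem_filter.1 hq).2)
    · intro q hq hqI
      obtain ⟨p, hp, hqp⟩ := hrep.meets hF hqI
      refine ⟨p, hrep.1 hp, hg p hp, hqp.symm, fun q' hq' hqq' => ?_⟩
      rw [Finset.mem_filter]
      constructor
      · rintro ⟨-, hJ'⟩
        exact ⟨hrep.1 hJ', hc q' hJ' p hp (hqq'.symm.trans hF hqp)⟩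
      · rintro ⟨hI', hs⟩
        exact ⟨hq', hrep.closed hF hp hI' hs.symm⟩

end Conflicts

end CQA

/-! ### Acyclicity by iteration, and the anatomy of input strings. -/

namespace CQA

open Computability (Γ' encodeNat)

/-! ### Acyclicity by rounds of marking -/

/-- After `n` rounds, in each of which the arrows are marked that only follow marked arrows, the
arrow `e` is marked. -/
def Settled {α : Type} (L : List (α × α)) : ℕ → α × α → Prop
  | 0, _ => False
  | n + 1, e => ∀ e' ∈ L, e'.2 = e.1 → Settled L n e'

/-- Without cycles, an arrow has strictly more ancestor arrows than any arrow leading into it, so it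
is settled once the number of rounds exceeds the number of its ancestors; these are fewer than
`L.length`, as it is not its own ancestor. An arrow on a cycle always has a predecessor on a cycle
and is never settled. -/
theorem acyclic_iff_settled {α : Type} (L : List (α × α)) {n : ℕ} (hn : L.length ≤ n) :
    (∀ p, ¬ Relation.TransGen (fun p q => (p, q) ∈ L) p p) ↔ ∀ e ∈ L, Settled L n e := by
  classical
  set r : α → α → Prop := fun p q => (p, q) ∈ L with hr
  constructor
  · intro hac e he
    let anc (e : α × α) : Finset (α × α) :=
      L.toFinset.filter fun e' => Relation.ReflTransGen r e'.2 e.1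
    have hself : ∀ e ∈ L, e ∉ anc e := fun e he h =>
      hac e.1 (.head' (show r e.1 e.2 from he) (Finset.mem_filter.1 h).2)
    have key : ∀ n, ∀ e ∈ L, (anc e).card < n → Settled L n e := by
      intro n
      induction n with
      | zero => intro e _ h; simp at h
      | succ n ih =>
        intro e _ h e' he' hee
        refine ih e' he' (lt_of_lt_of_le (Finset.card_lt_card ?_) (Nat.lt_succ_iff.1 h))
        refine Finset.ssubset_iff_subset_ne.2 ⟨fun d hd => ?_, fun heq => ?_⟩
        · rw [Finset.mem_filter] at hd ⊢
          exact ⟨hd.1, hd.2.tail (show r e'.1 e.1 from hee ▸ he')⟩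
        · refine hself e' he' (heq ▸ Finset.mem_filter.2 ⟨List.mem_toFinset.2 he', ?_⟩)
          rw [hee]
    refine key n e he (lt_of_lt_of_le (Finset.card_lt_card ?_) ((List.toFinset_card_le L).trans hn))
    refine Finset.ssubset_iff_subset_ne.2 ⟨Finset.filter_subset _ _, fun heq => ?_⟩
    exact hself e he (heq ▸ List.mem_toFinset.2 he)
  · intro h p hp
    have key : ∀ n, ∀ e ∈ L, Relation.ReflTransGen r e.2 e.1 → ¬ Settled L n e := by
      intro n
      induction n with
      | zero => intro e _ _ h; exact h
      | succ n ih =>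
        intro e he hc hs
        obtain ⟨z, hz, hze⟩ := Relation.TransGen.tail'_iff.1
          (Relation.TransGen.head' (show r e.1 e.2 from he) hc)
        refine ih (z, e.1) hze ?_ (hs (z, e.1) hze rfl)
        exact hz
    obtain ⟨z, hpz, hzp⟩ := Relation.TransGen.head'_iff.1 hp
    exact key n (p, z) hpz hzp (h _ hpz)

/-! ### Reading encoded inputs -/

section Encoding

variable {S : Schema}

/-- The encoding of a fact without its brackets. -/
def encodeBody (p : Fact S) : List Γ' :=
  (encodeNat p.1.val).map Γ'.bit ++ ((segments p).map (Γ'.comma :: ·)).flatten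

theorem encodeFact_eq (p : Fact S) : encodeFact p = Γ'.bra :: (encodeBody p ++ [Γ'.ket]) := by
  simp [encodeFact, encodeBody, segments]

theorem mem_encodeConst {k : DomainKind} {v : Const k} {c : Γ'} (hc : c ∈ encodeConst k v) :
    c ≠ .bra ∧ c ≠ .ket ∧ c ≠ .comma := by
  cases k
  · simp only [encodeConst, List.mem_append, List.mem_cons, List.mem_map] at hc
    rcases hc with (rfl | ⟨b, -, rfl⟩) | rfl | ⟨b, -, rfl⟩ <;> simp
  · simp only [encodeConst, List.mem_map] at hc
    obtain ⟨b, -, rfl⟩ := hc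
    simp

theorem mem_segments {p : Fact S} {l : List Γ'} (hl : l ∈ segments p) {c : Γ'} (hc : c ∈ l) :
    c ≠ .bra ∧ c ≠ .ket ∧ c ≠ .comma := by
  obtain ⟨i, rfl⟩ := List.mem_ofFn.1 hl
  exact mem_encodeConst hc

theorem mem_encodeBody {p : Fact S} {c : Γ'} (hc : c ∈ encodeBody p) : c ≠ .bra ∧ c ≠ .ket := by
  simp only [encodeBody, List.mem_append, List.mem_map, List.mem_flatten] at hc
  rcases hc with ⟨b, -, rfl⟩ | ⟨_, ⟨l, hl, rfl⟩, hc⟩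
  · simp
  · rcases List.mem_cons.1 hc with rfl | hc
    · simp
    · exact ⟨(mem_segments hl hc).1, (mem_segments hl hc).2.1⟩

/-- The pairs of an input as a string. -/
def encodePairs (L : List (Fact S × Fact S)) : List Γ' :=
  L.flatMap fun pq => encodeFact pq.1 ++ encodeFact pq.2

theorem encodeInput_eq (x : Input S) :
    encodeInput x = x.facts.flatMap encodeFact ++ Γ'.comma :: encodePairs x.pairs := rfl

/-- The state of the automaton that tells the parts of an input apart: whether the current letter
is between brackets, whether there was a comma outside brackets, and the parity of the number of
closing brackets. -/
def regionStep : Bool × Bool × Bool → Γ' → Bool × Bool × Bool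
  | (_, s, p), .bra => (true, s, p)
  | (_, s, p), .ket => (false, s, !p)
  | (true, s, p), .comma => (true, s, p)
  | (false, _, p), .comma => (false, true, p)
  | q, _ => q

/-- The final state of the automaton. -/
def region (l : List Γ') : Bool × Bool × Bool := l.foldl regionStep (false, false, false)

theorem foldl_regionStep_body {l : List Γ'} (hl : ∀ c ∈ l, c ≠ Γ'.bra ∧ c ≠ .ket) (s p : Bool) :
    l.foldl regionStep (true, s, p) = (true, s, p) := by
  induction l with
  | nil => rfl
  | cons c l ih =>
    have hc := hl c (by simp)
    rw [List.foldl_cons, show regionStep (true, s, p) c = (true, s, p) by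
      cases c <;> simp_all [regionStep]]
    exact ih fun c hc => hl c (by simp [hc])

theorem foldl_regionStep_fact (p : Fact S) (i s b : Bool) :
    (encodeFact p).foldl regionStep (i, s, b) = (false, s, !b) := by
  rw [encodeFact_eq, List.foldl_cons, List.foldl_append,
    show regionStep (i, s, b) .bra = (true, s, b) by cases i <;> rfl,
    foldl_regionStep_body fun c hc => mem_encodeBody hc]
  rfl

theorem foldl_regionStep_facts (L : List (Fact S)) (s b : Bool) :
    ∃ b', (L.flatMap encodeFact).foldl regionStep (false, s, b) = (false, s, b') := by
  induction L generalizing b with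
  | nil => exact ⟨b, rfl⟩
  | cons p L ih =>
    rw [List.flatMap_cons, List.foldl_append, foldl_regionStep_fact]
    exact ih _

theorem foldl_regionStep_pairs (L : List (Fact S × Fact S)) (s b : Bool) :
    (encodePairs L).foldl regionStep (false, s, b) = (false, s, b) := by
  induction L generalizing b with
  | nil => rfl
  | cons p L ih =>
    rw [encodePairs, List.flatMap_cons, List.foldl_append, List.foldl_append,
      foldl_regionStep_fact, foldl_regionStep_fact, Bool.not_not]
    exact ih b

/-- The string starts with a fact of the instance. -/
def FactStart (l : List Γ') : Prop := [Γ'.bra] <+: l ∧ (region l).2.1 = true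

/-- The string starts with a pair of the relation. -/
def PairStart (l : List Γ') : Prop :=
  [Γ'.bra] <+: l ∧ (!(region l).2.1 && !(region l).2.2) = true

theorem bra_prefix_encodeFact (p : Fact S) (l : List Γ') : [Γ'.bra] <+: encodeFact p ++ l := by
  rw [encodeFact_eq]
  exact ⟨_, rfl⟩

/-- A suffix reveals its place in the input by what is still to come. A comma outside brackets lies
ahead exactly of the facts of the instance; behind that comma, the parity of the closing brackets
tells the two members of a pair apart. -/
theorem factStart_facts (p : Fact S) (L : List (Fact S)) (M : List (Fact S × Fact S)) :
    FactStart ((p :: L).flatMap encodeFact ++ Γ'.comma :: encodePairs M) := by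
  refine ⟨?_, ?_⟩
  · rw [List.flatMap_cons, List.append_assoc]
    exact bra_prefix_encodeFact _ _
  · obtain ⟨b, hb⟩ := foldl_regionStep_facts (p :: L) false false
    rw [region, List.foldl_append, hb, List.foldl_cons,
      show regionStep (false, false, b) .comma = (false, true, b) from rfl, foldl_regionStep_pairs]

theorem region_pairs (L : List (Fact S × Fact S)) : region (encodePairs L) = (false, false, false) :=
  foldl_regionStep_pairs L false false

theorem region_fact_pairs (p : Fact S) (L : List (Fact S × Fact S)) :
    region (encodeFact p ++ encodePairs L) = (false, false, true) := by
  rw [region, List.foldl_append, foldl_regionStep_fact, foldl_regionStep_pairs]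
  rfl

theorem suffix_append_cases {α : Type} {s a b : List α} (h : s <:+ a ++ b) :
    s <:+ b ∨ ∃ a', a' <:+ a ∧ s = a' ++ b := by
  obtain ⟨t, ht⟩ := h
  rcases List.append_eq_append_iff.1 ht with ⟨c, rfl, rfl⟩ | ⟨c, rfl, rfl⟩
  · exact .inr ⟨c, ⟨t, rfl⟩, rfl⟩
  · exact .inl ⟨c, rfl⟩

/-- The opening bracket occurs in an encoded fact only as its first letter, so a suffix that starts
with one cannot start inside a fact. -/
theorem suffix_encodeFact {p : Fact S} {s l : List Γ'} (h : s <:+ encodeFact p ++ l)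
    (hs : [Γ'.bra] <+: s) : s = encodeFact p ++ l ∨ s <:+ l := by
  rcases suffix_append_cases h with h | ⟨a, ha, rfl⟩
  · exact .inr h
  · rw [encodeFact_eq, List.suffix_cons_iff, ← encodeFact_eq] at ha
    rcases ha with rfl | ha
    · exact .inl rfl
    · rcases a with _ | ⟨c, a⟩
      · exact .inr (by simp)
      · obtain rfl : Γ'.bra = c := by simpa using hs
        have := ha.subset (List.mem_cons_self)
        rcases List.mem_append.1 this with h | h
        · exact absurd rfl (mem_encodeBody h).1
        · simp at h

theorem suffix_encodeFacts {L : List (Fact S)} {s l : List Γ'} (h : s <:+ L.flatMap encodeFact ++ l)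
    (hs : [Γ'.bra] <+: s) :
    (∃ p ∈ L, ∃ M : List (Fact S), s = (p :: M).flatMap encodeFact ++ l) ∨ s <:+ l := by
  induction L with
  | nil => exact .inr h
  | cons p L ih =>
    rw [List.flatMap_cons, List.append_assoc] at h
    rcases suffix_encodeFact h hs with rfl | h
    · exact .inl ⟨p, by simp, L, by simp⟩
    · exact (ih h).imp_left fun ⟨q, hq, h⟩ => ⟨q, List.mem_cons_of_mem _ hq, h⟩

theorem suffix_encodePairs {L : List (Fact S × Fact S)} {s : List Γ'} (h : s <:+ encodePairs L)
    (hs : [Γ'.bra] <+: s) : ∃ pq ∈ L, ∃ M, s = encodePairs (pq :: M) ∨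
      s = encodeFact pq.2 ++ encodePairs M := by
  induction L with
  | nil => rw [List.suffix_nil.1 h] at hs; simp at hs
  | cons pq L ih =>
    rw [encodePairs, List.flatMap_cons, List.append_assoc] at h
    rcases suffix_encodeFact h hs with rfl | h
    · exact ⟨pq, by simp, L, .inl (by simp [encodePairs])⟩
    · rcases suffix_encodeFact h hs with rfl | h
      · exact ⟨pq, by simp, L, .inr (by simp [encodePairs])⟩
      · obtain ⟨pq', h', M, hM⟩ := ih h
        exact ⟨pq', List.mem_cons_of_mem _ h', M, hM⟩

theorem FactStart.exists_mem {x : Input S} {s : List Γ'} (h : s <:+ encodeInput x)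
    (hs : FactStart s) : ∃ p ∈ x.facts, encodeFact p <+: s := by
  rcases suffix_encodeFacts h hs.1 with ⟨p, hp, M, rfl⟩ | h
  · exact ⟨p, hp, by rw [List.flatMap_cons, List.append_assoc]; exact ⟨_, rfl⟩⟩
  · rcases List.suffix_cons_iff.1 h with rfl | h
    · simpa using hs.1
    · obtain ⟨pq, -, M, rfl | rfl⟩ := suffix_encodePairs h hs.1
      · have := hs.2
        simp [region_pairs] at this
      · have := hs.2
        simp [region_fact_pairs] at this

theorem exists_factStart {x : Input S} {p : Fact S} (hp : p ∈ x.facts) :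
    ∃ s, s <:+ encodeInput x ∧ FactStart s ∧ encodeFact p <+: s := by
  obtain ⟨L, M, hL⟩ := List.append_of_mem hp
  refine ⟨_, ?_, factStart_facts p M x.pairs, by
    rw [List.flatMap_cons, List.append_assoc]; exact ⟨_, rfl⟩⟩
  rw [encodeInput_eq, hL, List.flatMap_append, List.append_assoc]
  exact List.suffix_append _ _

theorem PairStart.exists_mem {x : Input S} {s : List Γ'} (h : s <:+ encodeInput x)
    (hs : PairStart s) : ∃ pq ∈ x.pairs, encodeFact pq.1 ++ encodeFact pq.2 <+: s := by
  rw [encodeInput_eq] at h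
  rcases suffix_encodeFacts h hs.1 with ⟨p, hp, M, rfl⟩ | h
  · have := hs.2
    rw [(factStart_facts p M x.pairs).2] at this
    simp at this
  · rcases List.suffix_cons_iff.1 h with rfl | h
    · simpa using hs.1
    · obtain ⟨pq, hpq, M, rfl | rfl⟩ := suffix_encodePairs h hs.1
      · exact ⟨pq, hpq, by rw [encodePairs, List.flatMap_cons]; exact ⟨_, rfl⟩⟩
      · have := hs.2
        simp [region_fact_pairs] at this

theorem exists_pairStart {x : Input S} {pq : Fact S × Fact S} (hp : pq ∈ x.pairs) :
    ∃ s, s <:+ encodeInput x ∧ PairStart s ∧ encodeFact pq.1 ++ encodeFact pq.2 <+: s := by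
  obtain ⟨L, M, hL⟩ := List.append_of_mem hp
  refine ⟨encodePairs (pq :: M), ?_, ⟨?_, by simp [region_pairs]⟩, ?_⟩
  · rw [encodeInput_eq, hL, encodePairs, encodePairs, List.flatMap_append]
    exact (List.suffix_append _ _).trans ((List.suffix_cons _ _).trans (List.suffix_append _ _))
  · rw [encodePairs, List.flatMap_cons, List.append_assoc]
    exact bra_prefix_encodeFact _ _
  · rw [encodePairs, List.flatMap_cons]
    exact ⟨_, rfl⟩

end Encoding

end CQA

namespace CQA

open Computability (Γ' encodeNat)

/-! ### Comparing encoded facts -/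

/-- The delimiters may differ: the same constant can be followed by a comma in one fact and by the
closing bracket in another. -/
theorem agree_append_iff {D : Γ' → Bool} {A B X Y : List Γ'} {c d : Γ'} (hA : ∀ a ∈ A, D a = false)
    (hB : ∀ a ∈ B, D a = false) (hc : D c = true) (hd : D d = true) :
    agree D (A ++ c :: X) (B ++ d :: Y) = true ↔ A = B := by
  induction A generalizing B with
  | nil =>
    rcases B with _ | ⟨b, B⟩
    · simp [agree, hc, hd]
    · simp [agree, hc, hB b (by simp)]
  | cons a A ih =>
    rcases B with _ | ⟨b, B⟩
    · simp [agree, hd, hA a (by simp)]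
    · simp only [List.cons_append, agree, hA a (by simp), hB b (by simp), Bool.or_self,
        Bool.false_eq_true, if_false, Bool.and_eq_true, decide_eq_true_eq, List.cons.injEq]
      rw [ih (fun a ha => hA a (by simp [ha])) fun a ha => hB a (by simp [ha])]

theorem append_inj_of_delim {D : Γ' → Bool} {A B X Y : List Γ'} {c d : Γ'}
    (hA : ∀ a ∈ A, D a = false) (hB : ∀ a ∈ B, D a = false) (hc : D c = true) (hd : D d = true)
    (h : A ++ c :: X = B ++ d :: Y) : A = B := by
  have h₁ := (agree_append_iff (X := X) (Y := X) hA hA hc hc).2 rfl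
  nth_rewrite 2 [h] at h₁
  exact (agree_append_iff hA hB hc hd).1 h₁

theorem skip_append {c : Γ'} {A : List Γ'} (hA : c ∉ A) (n : ℕ) (X : List Γ') :
    skip c (n + 1) (A ++ c :: X) = skip c n X := by
  induction A with
  | nil => simp [skip]
  | cons a A ih =>
    simp only [List.mem_cons, not_or] at hA
    simp [skip, Ne.symm hA.1, ih hA.2]

section Facts

variable {S : Schema}

/-- Tests for the letter that ends a fact. -/
def isKet (c : Γ') : Bool := decide (c = .ket)

/-- Tests for the letters that end a constant. -/
def isSep (c : Γ') : Bool := decide (c = .ket) || decide (c = .comma)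

/-- The marked word starts with the fact `p`. -/
def At (p : Fact S) (s : List Cell) : Prop := encodeFact p <+: letters s

/-- The marked word starts with the pair of `p` and `q`. -/
def PairAt (p q : Fact S) (s : List Cell) : Prop := encodeFact p ++ encodeFact q <+: letters s

theorem PairAt.left {p q : Fact S} {s : List Cell} (h : PairAt p q s) : At p s :=
  (List.prefix_append _ _).trans h

theorem encodeFact_injective : Function.Injective (encodeFact (S := S)) := fun p q h =>
  (encodeFact_prefix (p := p) (q := q) (X := []) (Y := []) (by simpa using h)).1

theorem ket_notMem_bra_encodeBody (p : Fact S) : Γ'.ket ∉ Γ'.bra :: encodeBody p := by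
  intro h
  rcases List.mem_cons.1 h with h | h
  · cases h
  · exact (mem_encodeBody h).2 rfl

theorem agree_encodeFact (p q : Fact S) (X Y : List Γ') :
    agree isKet (encodeFact p ++ X) (encodeFact q ++ Y) = true ↔ p = q := by
  have h (p : Fact S) (X : List Γ') :
      encodeFact p ++ X = (Γ'.bra :: encodeBody p) ++ Γ'.ket :: X := by
    simp [encodeFact_eq]
  have h' (p : Fact S) : ∀ a ∈ Γ'.bra :: encodeBody p, isKet a = false := by
    intro a ha
    refine decide_eq_false ?_
    rintro rfl
    exact ket_notMem_bra_encodeBody p ha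
  rw [h, h, agree_append_iff (h' p) (h' q) rfl rfl]
  refine ⟨fun e => encodeFact_injective ?_, fun e => by rw [e]⟩
  rw [encodeFact_eq, encodeFact_eq, ← List.cons_append, e, List.cons_append]

/-- The two words start with the same fact. -/
def EqFact (s t : List Cell) : Prop :=
  agree isKet (skip .ket 0 (letters s)) (skip .ket 0 (letters t)) = true

theorem eqFact_iff {p q : Fact S} {s t : List Cell} (hs : At p s) (ht : At q t) :
    EqFact s t ↔ p = q := by
  obtain ⟨X, hX⟩ := hs
  obtain ⟨Y, hY⟩ := ht
  rw [EqFact, ← hX, ← hY]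
  exact agree_encodeFact p q X Y

/-- The first word starts with the second fact of the second word. -/
def EqSecond (s t : List Cell) : Prop :=
  agree isKet (skip .ket 0 (letters s)) (skip .ket 1 (letters t)) = true

theorem eqSecond_iff {p q q' : Fact S} {s t : List Cell} (hs : At p s) (ht : PairAt q q' t) :
    EqSecond s t ↔ p = q' := by
  obtain ⟨X, hX⟩ := hs
  obtain ⟨Y, hY⟩ := ht
  have : skip .ket 1 (letters t) = encodeFact q' ++ Y := by
    rw [← hY, encodeFact_eq q, ← List.cons_append, List.append_assoc, List.append_assoc]
    exact skip_append (ket_notMem_bra_encodeBody q) 0 _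
  rw [EqSecond, ← hX, this]
  exact agree_encodeFact p q' X Y

theorem isSep_bits (n : ℕ) : ∀ a ∈ (encodeNat n).map Γ'.bit, isSep a = false := by
  intro a ha
  obtain ⟨b, -, rfl⟩ := List.mem_map.1 ha
  rfl

theorem isSep_segments {p : Fact S} {l : List Γ'} (hl : l ∈ segments p) :
    ∀ a ∈ l, isSep a = false := by
  intro a ha
  have := mem_segments hl ha
  simp [isSep, this.2.1, this.2.2]

theorem sep_cases (L : List (List Γ')) (X : List Γ') : ∃ c Y, isSep c = true ∧
    (L.map (Γ'.comma :: ·)).flatten ++ Γ'.ket :: X = c :: Y := by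
  rcases L with _ | ⟨l, L⟩
  · exact ⟨_, _, rfl, rfl⟩
  · exact ⟨_, _, rfl, rfl⟩

/-- The prefix `A` stands for the relation index in front of the first comma. Constant `i`, counted
from zero, therefore follows comma number `i + 1`. -/
theorem skip_segments (L : List (List Γ')) (hL : ∀ l ∈ L, Γ'.comma ∉ l) (A : List Γ')
    (hA : Γ'.comma ∉ A) (X : List Γ') (i : ℕ) (hi : i < L.length) : ∃ c Y, isSep c = true ∧
      skip .comma (i + 1) (A ++ ((L.map (Γ'.comma :: ·)).flatten ++ Γ'.ket :: X)) = L[i] ++ c :: Y := by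
  induction L generalizing A i with
  | nil => simp at hi
  | cons l L ih =>
    have : A ++ (((l :: L).map (Γ'.comma :: ·)).flatten ++ Γ'.ket :: X) =
        A ++ Γ'.comma :: (l ++ ((L.map (Γ'.comma :: ·)).flatten ++ Γ'.ket :: X)) := by simp
    rw [this, skip_append hA]
    cases i with
    | zero =>
      obtain ⟨c, Y, hc, h⟩ := sep_cases L X
      exact ⟨c, Y, hc, by rw [h]; simp [skip]⟩
    | succ i =>
      exact ih (fun l hl => hL l (by simp [hl])) l (hL l (by simp)) i (by simpa using hi)

/-- The facts at the start of the two words have the same constant at position `i`. -/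
def EqConst (i : ℕ) (s t : List Cell) : Prop :=
  agree isSep (skip .comma (i + 1) (letters s)) (skip .comma (i + 1) (letters t)) = true

theorem eqConst_iff {p q : Fact S} {s t : List Cell} (hs : At p s) (ht : At q t) {i : ℕ}
    (hp : i < (segments p).length) (hq : i < (segments q).length) :
    EqConst i s t ↔ (segments p)[i]? = (segments q)[i]? := by
  have key (p : Fact S) (s : List Cell) (hs : At p s) (hp : i < (segments p).length) :
      ∃ c Y, isSep c = true ∧ skip .comma (i + 1) (letters s) = (segments p)[i] ++ c :: Y := by
    obtain ⟨X, hX⟩ := hs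
    have := skip_segments (segments p) (fun l hl h => (mem_segments hl h).2.2 rfl)
      (Γ'.bra :: (encodeNat p.1.val).map Γ'.bit) (by simp) X i hp
    rw [← hX]
    convert this using 7
    simp [encodeFact_eq, encodeBody]
  obtain ⟨c, X, hc, hX⟩ := key p s hs hp
  obtain ⟨d, Y, hd, hY⟩ := key q t ht hq
  rw [EqConst, hX, hY, agree_append_iff (isSep_segments (List.getElem_mem _))
    (isSep_segments (List.getElem_mem _)) hc hd, List.getElem?_eq_getElem hp,
    List.getElem?_eq_getElem hq, Option.some_inj]

/-- The word starts with a fact of the relation `R`. -/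
def HasRel (R : ℕ) (s : List Cell) : Prop :=
  Γ'.bra :: ((encodeNat R).map Γ'.bit ++ [Γ'.comma]) <+: letters s ∨
    Γ'.bra :: ((encodeNat R).map Γ'.bit ++ [Γ'.ket]) <+: letters s

/-- The index is followed by a comma, or by the closing bracket if the relation has arity zero.
Including that delimiter rules out an index that is a proper prefix of another. -/
theorem hasRel_iff {p : Fact S} {s : List Cell} (hs : At p s) (R : Fin S.numRel) :
    HasRel R s ↔ p.1 = R := by
  obtain ⟨X, hX⟩ := hs
  obtain ⟨c, Y, hc, hY⟩ := sep_cases (segments p) X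
  have hs : letters s = Γ'.bra :: ((encodeNat p.1.val).map Γ'.bit ++ c :: Y) := by
    rw [← hX, ← hY]
    simp [encodeFact_eq, encodeBody]
  have key (d : Γ') (hd : isSep d = true) : Γ'.bra :: ((encodeNat R).map Γ'.bit ++ [d]) <+: letters s →
      p.1 = R := by
    rintro ⟨Z, hZ⟩
    rw [hs] at hZ
    have : (encodeNat R).map Γ'.bit ++ d :: Z = (encodeNat p.1.val).map Γ'.bit ++ c :: Y := by
      simpa using hZ
    exact (Fin.ext (encodeNat_inj (bit_map_inj
      (append_inj_of_delim (isSep_bits _) (isSep_bits _) hd hc this)))).symm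
  constructor
  · rintro (h | h)
    · exact key _ rfl h
    · exact key _ rfl h
  · rintro rfl
    have : c = .comma ∨ c = .ket := by simpa [isSep, or_comm] using hc
    rw [HasRel, hs]
    rcases this with rfl | rfl
    · exact .inl ⟨Y, by simp⟩
    · exact .inr ⟨Y, by simp⟩

end Facts

end CQA

/-! ### First-order conditions on the input are polynomial time. -/

namespace CQA

open Computability (Γ' encodeNat)

/-! ### First-order properties of inputs -/

theorem letters_suffix {s w : List Cell} (h : s <:+ w) : letters s <:+ letters w := h.map _

theorem exists_suffix_of_letters {w : List Cell} {l : List Γ'} (h : l <:+ letters w) :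
    ∃ s, s <:+ w ∧ letters s = l := by
  rw [List.suffix_iff_eq_drop] at h
  exact ⟨_, List.drop_suffix ((letters w).length - l.length) w,
    by rw [letters, List.map_drop]; exact h.symm⟩

theorem Dec.factStart (k : ℕ) (i : Fin 10) : Dec k fun V => FactStart (letters (V i)) :=
  (Dec.prefix k _ i).and (Dec.fold k regionStep (false, false, false) (fun q => q.2.1) i)

theorem Dec.pairStart (k : ℕ) (i : Fin 10) : Dec k fun V => PairStart (letters (V i)) :=
  (Dec.prefix k _ i).and
    (Dec.fold k regionStep (false, false, false) (fun q => !q.2.1 && !q.2.2) i)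

section Definable

variable {S : Schema}

/-- The word assigned to each of the variables `1, …, k - 1` starts with its fact, and variable `0`
holds the input. -/
def Represents (k : ℕ) (x : Input S) (v : Fin 10 → Fact S) (V : Fin 10 → List Cell) : Prop :=
  letters (V 0) = encodeInput x ∧ ∀ i : Fin 10, 0 < i → i.val < k → At (v i) (V i)

/-- A decidable property of inputs and of the facts assigned to the variables `1, …, k - 1`. -/
def FDef (k : ℕ) (P : Input S → (Fin 10 → Fact S) → Prop) : Prop :=
  ∃ D, Dec k D ∧ ∀ x v V, Represents k x v V → (D V ↔ P x v)

namespace FDef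

variable {k : ℕ} {P P' : Input S → (Fin 10 → Fact S) → Prop}

theorem congr (h : FDef k P) (hP : ∀ x v, P x v ↔ P' x v) : FDef k P' :=
  let ⟨D, hD, h⟩ := h
  ⟨D, hD, fun x v V hV => (h x v V hV).trans (hP x v)⟩

theorem const (k : ℕ) (c : Prop) : FDef (S := S) k fun _ _ => c :=
  ⟨_, .const k c, fun _ _ _ _ => Iff.rfl⟩

theorem not (h : FDef k P) : FDef k fun x v => ¬ P x v :=
  let ⟨_, hD, h⟩ := h
  ⟨_, hD.not, fun x v V hV => not_congr (h x v V hV)⟩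

theorem and (h : FDef k P) (h' : FDef k P') : FDef k fun x v => P x v ∧ P' x v :=
  let ⟨_, hD, h⟩ := h
  let ⟨_, hD', h'⟩ := h'
  ⟨_, hD.and hD', fun x v V hV => and_congr (h x v V hV) (h' x v V hV)⟩

theorem or (h : FDef k P) (h' : FDef k P') : FDef k fun x v => P x v ∨ P' x v :=
  let ⟨_, hD, h⟩ := h
  let ⟨_, hD', h'⟩ := h'
  ⟨_, hD.or hD', fun x v V hV => or_congr (h x v V hV) (h' x v V hV)⟩

theorem imp (h : FDef k P) (h' : FDef k P') : FDef k fun x v => P x v → P' x v :=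
  let ⟨_, hD, h⟩ := h
  let ⟨_, hD', h'⟩ := h'
  ⟨_, hD.imp hD', fun x v V hV => imp_congr (h x v V hV) (h' x v V hV)⟩

theorem iff (h : FDef k P) (h' : FDef k P') : FDef k fun x v => P x v ↔ P' x v :=
  let ⟨_, hD, h⟩ := h
  let ⟨_, hD', h'⟩ := h'
  ⟨_, hD.iff hD', fun x v V hV => iff_congr (h x v V hV) (h' x v V hV)⟩

theorem exists_mem {β : Type} {s : Set β} (hs : s.Finite)
    {P : β → Input S → (Fin 10 → Fact S) → Prop} (h : ∀ b ∈ s, FDef k (P b)) :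
    FDef k fun x v => ∃ b ∈ s, P b x v := by
  choose! D hD h using h
  exact ⟨_, Dec.exists_mem hs hD, fun x v V hV =>
    exists_congr fun b => and_congr_right fun hb => h b hb x v V hV⟩

theorem forall_mem {β : Type} {s : Set β} (hs : s.Finite)
    {P : β → Input S → (Fin 10 → Fact S) → Prop} (h : ∀ b ∈ s, FDef k (P b)) :
    FDef k fun x v => ∀ b ∈ s, P b x v := by
  choose! D hD h using h
  exact ⟨_, Dec.forall_mem hs hD, fun x v V hV => forall₂_congr fun b hb => h b hb x v V hV⟩

/-- The quantifier ranges over the suffixes that start with a fact of the instance. The choice among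
several occurrences of a fact is immaterial, because `D` has the same value for all representing
words. -/
theorem exists_inst (k : Fin 10) (hk : k ≠ 0) {P : Input S → (Fin 10 → Fact S) → Prop}
    (h : FDef (k + 1) P) : FDef k fun x v => ∃ f ∈ x.inst, P x (Function.update v k f) := by
  obtain ⟨D, hD, h⟩ := h
  refine ⟨_, Dec.exists k hk (P := fun V s => FactStart (letters s) ∧ D (Function.update V k s))
    ((Dec.factStart _ k).and (by simpa using hD)) (by simp), ?_⟩
  intro x v V ⟨h0, hV⟩
  have rep {f : Fact S} {s : List Cell} (hf : At f s) :
      Represents (k + 1) x (Function.update v k f) (Function.update V k s) := by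
    refine ⟨by simpa [hk.symm] using h0, fun i hi hik => ?_⟩
    by_cases h : i = k
    · subst h; simpa using hf
    · have : i.val ≠ k.val := fun h' => h (Fin.ext h')
      simpa [h] using hV i hi (by omega)
  constructor
  · rintro ⟨s, hs, hs', hDs⟩
    obtain ⟨f, hf, hfs⟩ := hs'.exists_mem (h0 ▸ letters_suffix hs)
    exact ⟨f, List.mem_toFinset.2 hf, (h x _ _ (rep hfs)).1 hDs⟩
  · rintro ⟨f, hf, hP⟩
    obtain ⟨l, hl, hl', hfl⟩ := exists_factStart (List.mem_toFinset.1 hf)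
    obtain ⟨s, hs, rfl⟩ := exists_suffix_of_letters (w := V 0) (h0 ▸ hl)
    exact ⟨s, hs, hl', (h x _ _ (rep hfl)).2 hP⟩

theorem forall_inst (k : Fin 10) (hk : k ≠ 0) {P : Input S → (Fin 10 → Fact S) → Prop}
    (h : FDef (k + 1) P) : FDef k fun x v => ∀ f ∈ x.inst, P x (Function.update v k f) :=
  (FDef.exists_inst k hk h.not).not.congr fun x v => by
    simp only [not_exists, not_and, not_not]

theorem eq {i j : Fin 10} (hij : i ≠ j) (hi : 0 < i) (hj : 0 < j) (hik : i.val < k)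
    (hjk : j.val < k) : FDef (S := S) k fun _ v => v i = v j :=
  ⟨_, Dec.agree k isKet .ket 0 0 hij, fun _ _ _ hV => eqFact_iff (hV.2 i hi hik) (hV.2 j hj hjk)⟩

theorem eqConst (p : Fact S) {i : Fin 10} (hi : 0 < i) (hik : i.val < k) :
    FDef (S := S) k fun _ v => v i = p := by
  refine ⟨_, Dec.prefix k (encodeFact p) i, fun x v V hV => ?_⟩
  obtain ⟨X, hX⟩ := hV.2 i hi hik
  constructor
  · rintro ⟨Y, hY⟩
    exact (encodeFact_prefix (hX.trans hY.symm)).1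
  · rintro rfl
    exact ⟨X, hX⟩

theorem agreeOn (R : Fin S.numRel) (X : Finset (Fin (S.arity R))) {i j : Fin 10} (hij : i ≠ j)
    (hi : 0 < i) (hj : 0 < j) (hik : i.val < k) (hjk : j.val < k) :
    FDef k fun _ v => AgreeOn R X (v i) (v j) := by
  have hrel (i : Fin 10) : Dec k fun V => HasRel R (V i) :=
    (Dec.prefix k _ i).or (Dec.prefix k _ i)
  refine ⟨_, (hrel i).and ((hrel j).and (Dec.forall_mem X.finite_toSet
    (P := fun a V => EqConst a.val (V i) (V j)) fun a _ => Dec.agree k isSep .comma _ _ hij)),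
    fun x v V hV => ?_⟩
  have h₁ := hV.2 i hi hik
  have h₂ := hV.2 j hj hjk
  rw [hasRel_iff h₁, hasRel_iff h₂]
  refine and_congr_right fun e₁ => and_congr_right fun e₂ => forall₂_congr fun a _ => ?_
  exact eqConst_iff h₁ h₂ (by simp [segments, e₁]) (by simp [segments, e₂])

/-- Variable `k` serves as scratch space for a position in the list of pairs; it holds no fact, so
the formula still has only the variables below `k`. -/
theorem prec (k : Fin 10) {i j : Fin 10} (hi : 0 < i) (hj : 0 < j) (hik : i < k) (hjk : j < k) :
    FDef (S := S) k fun x v => x.prec (v i) (v j) := by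
  refine ⟨_, Dec.exists k (hi.trans hik).ne' (P := fun V e => PairStart (letters e) ∧
    EqFact (V i) e ∧ EqSecond (V j) e) ((Dec.pairStart _ k).and
      ((Dec.agree _ isKet .ket 0 0 hik.ne).and (Dec.agree _ isKet .ket 0 1 hjk.ne)))
    (by simp [hik.ne, hjk.ne]), ?_⟩
  intro x v V ⟨h0, hV⟩
  have h₁ := hV i hi hik
  have h₂ := hV j hj hjk
  constructor
  · rintro ⟨e, he, he', hf, hs⟩
    obtain ⟨pq, hpq, hp⟩ := he'.exists_mem (h0 ▸ letters_suffix he)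
    have hp : PairAt pq.1 pq.2 e := hp
    rw [eqFact_iff h₁ hp.left] at hf
    rw [eqSecond_iff h₂ hp] at hs
    rw [hf, hs]
    exact hpq
  · intro h
    obtain ⟨l, hl, hl', hp⟩ := exists_pairStart h
    obtain ⟨e, he, rfl⟩ := exists_suffix_of_letters (w := V 0) (h0 ▸ hl)
    have hp : PairAt (v i) (v j) e := hp
    exact ⟨e, he, hl', (eqFact_iff h₁ hp.left).2 rfl, (eqSecond_iff h₂ hp).2 rfl⟩

section Dependencies

variable {F : Set (FD S)} (hF : ∀ f ∈ F, ∀ g ∈ F, f.rel = g.rel → f = g)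
  {i j : Fin 10} (hij : i ≠ j) (hi : 0 < i) (hj : 0 < j) (hik : i.val < k) (hjk : j.val < k)
include hF hij hi hj hik hjk

-- A dependency is determined by its relation, and there are finitely many relations.
omit hij hi hj hik hjk in
theorem finite_dependencies : F.Finite :=
  Set.Finite.of_finite_image (Set.toFinite (FD.rel '' F)) fun f hf g hg h => hF f hf g hg h

theorem clash : FDef k fun _ v => Clash F (v i) (v j) :=
  exists_mem (finite_dependencies hF) fun f _ => ((agreeOn f.rel f.lhs hij hi hj hik hjk).and
    (agreeOn f.rel f.rhs hij hi hj hik hjk).not).congr fun _ _ => FD.violates_iff.symm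

theorem sameGroup : FDef k fun _ v => SameGroup F (v i) (v j) :=
  (eq hij hi hj hik hjk).or (exists_mem (finite_dependencies hF) fun f _ =>
    agreeOn f.rel f.lhs hij hi hj hik hjk)

theorem samePart : FDef k fun _ v => SamePart F (v i) (v j) :=
  (eq hij hi hj hik hjk).or (exists_mem (finite_dependencies hF) fun f _ =>
    (agreeOn f.rel f.lhs hij hi hj hik hjk).and (agreeOn f.rel f.rhs hij hi hj hik hjk))

end Dependencies

variable {F : Set (FD S)} (hF : ∀ f ∈ F, ∀ g ∈ F, f.rel = g.rel → f = g)
include hF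

theorem paretoGood : FDef 2 fun x v => ParetoGood F x.inst x.prec (v 1) :=
  (FDef.exists_inst 2 (by decide) ((clash hF (i := 2) (j := 1) (by decide) (by decide) (by decide)
      (by decide) (by decide)).and
    (FDef.forall_inst 3 (by decide) ((samePart hF (i := 3) (j := 1) (by decide) (by decide) (by decide)
      (by decide) (by decide)).imp
        (FDef.prec 4 (i := 2) (j := 3) (by decide) (by decide) (by decide) (by decide)))))).not

theorem globalGood : FDef 2 fun x v => GlobalGood F x.inst x.prec (v 1) :=
  (FDef.exists_inst 2 (by decide) ((clash hF (i := 2) (j := 1) (by decide) (by decide) (by decide)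
      (by decide) (by decide)).and
    (FDef.forall_inst 3 (by decide) ((samePart hF (i := 3) (j := 1) (by decide) (by decide) (by decide)
      (by decide) (by decide)).imp
        (FDef.exists_inst 4 (by decide) ((samePart hF (i := 4) (j := 2) (by decide) (by decide)
          (by decide) (by decide) (by decide)).and
            (FDef.prec 5 (i := 4) (j := 3) (by decide) (by decide) (by decide)
              (by decide)))))))).not

theorem commonGood : FDef 2 fun x v => CommonGood F x.inst x.prec (v 1) :=
  FDef.exists_inst 2 (by decide) ((samePart hF (i := 2) (j := 1) (by decide) (by decide) (by decide)
      (by decide) (by decide)).and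
    (FDef.forall_inst 3 (by decide)
      (FDef.prec 4 (i := 3) (j := 2) (by decide) (by decide) (by decide) (by decide)).not))

omit hF in
theorem mem_inst (q : Fact S) (k : Fin 10) (hk : k ≠ 0) : FDef k fun x _ => q ∈ x.inst :=
  (FDef.exists_inst k hk (eqConst q (i := k) (Fin.pos_iff_ne_zero.2 hk) (by simp))).congr
    fun x v => by simp

end FDef

end Definable

end CQA

/-! ### The decision procedure. -/

namespace CQA

open Computability (Γ' encodeNat)

/-! ### Words with given marks -/

open Classical in
/-- The word `u` in which the suffixes with the property `m` are marked. -/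
noncomputable def mark (m : List Γ' → Prop) : List Γ' → List Cell
  | [] => []
  | a :: s => (a, decide (m (a :: s))) :: mark m s

@[simp] theorem letters_mark (m : List Γ' → Prop) (u : List Γ') : letters (mark m u) = u := by
  induction u with
  | nil => rfl
  | cons a u ih => simpa [mark, letters] using ih

theorem remark_mark (φ : List Cell → List Cell → Prop) (w : List Cell) (m : List Γ' → Prop)
    (u : List Γ') : remark φ w (mark m u) = mark (fun l => φ w (mark m l)) u := by
  induction u with
  | nil => rfl
  | cons a u ih =>
    rw [mark, remark, ih, mark, mark]

/-- A mark depends only on the suffix at which it stands, so passing to suffixes and marking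
commute. -/
theorem suffix_mark_iff {m : List Γ' → Prop} {u : List Γ'} {s : List Cell} :
    s <:+ mark m u ↔ ∃ l, l <:+ u ∧ s = mark m l := by
  induction u with
  | nil => simp [mark]
  | cons a u ih =>
    simp only [mark, List.suffix_cons_iff, ih]
    constructor
    · rintro (rfl | ⟨l, hl, rfl⟩)
      · exact ⟨_, .inl rfl, rfl⟩
      · exact ⟨l, .inr hl, rfl⟩
    · rintro ⟨l, rfl | hl, rfl⟩
      · exact .inl rfl
      · exact .inr ⟨l, hl, rfl⟩

theorem marked_mark {m : List Γ' → Prop} {l : List Γ'} (hl : [Γ'.bra] <+: l) :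
    Marked (mark m l) ↔ m l := by
  rcases l with _ | ⟨a, l⟩
  · simp at hl
  · simp [Marked, mark]

theorem mark_false (u : List Γ') : (u.map fun c => (c, false)) = mark (fun _ => False) u := by
  induction u with
  | nil => rfl
  | cons a u ih => simp [mark, ih]

section Acyclic

variable {S : Schema}

/-- Every pair that leads to the first fact of `s` is marked. -/
def Unblocked (w s : List Cell) : Prop :=
  ∀ t, t <:+ w → PairStart (letters t) → EqSecond s t → Marked t

theorem Dec.unblocked : Dec 2 fun V => Unblocked (V 0) (V 1) :=
  Dec.forall 2 (by decide) (P := fun V t => PairStart (letters t) → EqSecond (V 1) t → Marked t)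
    ((Dec.pairStart _ 2).imp ((Dec.agree _ isKet .ket 0 1 (by decide)).imp (Dec.marked _ 2)))
    (by simp)

/-- The marks are those of the pairs that are settled after `n` rounds. -/
def MarksSettled (x : Input S) (n : ℕ) (m : List Γ' → Prop) : Prop :=
  ∀ l, l <:+ encodeInput x → PairStart l → ∀ pq : Fact S × Fact S,
    encodeFact pq.1 ++ encodeFact pq.2 <+: l → (m l ↔ Settled x.pairs n pq)

/-- `Unblocked` is the recursion of `Settled` read off the marked word. A pair may be listed
repeatedly, but all its occurrences carry the same mark. -/
theorem MarksSettled.step {x : Input S} {n : ℕ} {m : List Γ' → Prop} (h : MarksSettled x n m) :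
    MarksSettled x (n + 1) fun l => Unblocked (mark m (encodeInput x)) (mark m l) := by
  intro l hl hl' pq hpq
  have hat : At pq.1 (mark m l) := by
    rw [At, letters_mark]
    exact (List.prefix_append _ _).trans hpq
  have hpair {l' : List Γ'} {e : Fact S × Fact S} (he : encodeFact e.1 ++ encodeFact e.2 <+: l') :
      PairAt e.1 e.2 (mark m l') := by
    rwa [PairAt, letters_mark]
  constructor
  · intro hu e he hee
    obtain ⟨l', hs, hs', hp⟩ := exists_pairStart he
    rw [← h l' hs hs' e hp, ← marked_mark (m := m) hs'.1]
    exact hu _ (suffix_mark_iff.2 ⟨l', hs, rfl⟩) (by rwa [letters_mark])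
      ((eqSecond_iff hat (hpair hp)).2 hee.symm)
  · intro hset t ht ht' hst
    obtain ⟨l', hs, rfl⟩ := suffix_mark_iff.1 ht
    rw [letters_mark] at ht'
    obtain ⟨e, he, hp⟩ := ht'.exists_mem hs
    rw [marked_mark ht'.1, h l' hs ht' e hp]
    exact hset e he ((eqSecond_iff hat (hpair hp)).1 hst).symm

theorem iterate_remark (x : Input S) (n : ℕ) : ∃ m, MarksSettled x n m ∧
    (fun w => remark Unblocked w w)^[n] ((encodeInput x).map fun c => (c, false)) =
      mark m (encodeInput x) := by
  induction n with
  | zero => exact ⟨fun _ => False, fun _ _ _ _ _ => Iff.rfl, mark_false _⟩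
  | succ n ih =>
    obtain ⟨m, hm, h⟩ := ih
    exact ⟨_, hm.step, by rw [Function.iterate_succ_apply', h, remark_mark]⟩

/-- All pairs are marked. -/
def AllMarked (w : List Cell) : Prop := ∀ t, t <:+ w → PairStart (letters t) → Marked t

theorem Dec.allMarked : Dec 1 fun V => AllMarked (V 0) :=
  Dec.forall 1 (by decide) (P := fun _ t => PairStart (letters t) → Marked t)
    ((Dec.pairStart _ 1).imp (Dec.marked _ 1)) (by simp)

theorem length_pairs_le (x : Input S) : x.pairs.length ≤ (encodeInput x).length := by
  have : x.pairs.length ≤ (encodePairs x.pairs).length := by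
    generalize x.pairs = L
    induction L with
    | nil => simp
    | cons pq L ih =>
      rw [encodePairs, List.flatMap_cons, List.length_append, encodeFact_eq]
      have : L.length ≤ (L.flatMap fun pq => encodeFact pq.1 ++ encodeFact pq.2).length := ih
      simp only [List.length_cons, List.length_append]
      omega
  rw [encodeInput_eq, List.length_append, List.length_cons]
  omega

theorem allMarked_mark_iff {x : Input S} {n : ℕ} {m : List Γ' → Prop} (h : MarksSettled x n m) :
    AllMarked (mark m (encodeInput x)) ↔ ∀ e ∈ x.pairs, Settled x.pairs n e := by
  constructor
  · intro ha e he
    obtain ⟨l, hs, hs', hp⟩ := exists_pairStart he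
    rw [← h l hs hs' e hp, ← marked_mark (m := m) hs'.1]
    exact ha _ (suffix_mark_iff.2 ⟨l, hs, rfl⟩) (by rwa [letters_mark])
  · intro ha t ht ht'
    obtain ⟨l, hs, rfl⟩ := suffix_mark_iff.1 ht
    rw [letters_mark] at ht'
    obtain ⟨e, he, hp⟩ := ht'.exists_mem hs
    rw [marked_mark ht'.1, h l hs ht' e hp]
    exact ha e he

end Acyclic

/-! ### The decision problem -/

section Problem

variable {S : Schema} {F : Set (FD S)} (hF : ∀ f ∈ F, ∀ g ∈ F, f.rel = g.rel → f = g)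
include hF

/-- The quantifiers of `FDef` range over facts of the instance, while the members of a pair are not
yet known to belong to it. Variable `1` therefore points to a pair, and variables `2` and `3` search
the instance for its members. -/
theorem dec_clash_pairs [Nonempty (Fact S)] : ∃ D : (Fin 10 → List Cell) → Prop, Dec 1 D ∧
    ∀ (x : Input S) V, letters (V 0) = encodeInput x →
      (D V ↔ ∀ p q, x.prec p q → p ∈ x.inst ∧ q ∈ x.inst ∧ Clash F p q) := by
  obtain ⟨C, hC, hCF⟩ := FDef.clash (k := 4) hF (i := 2) (j := 3) (by decide) (by decide)
    (by decide) (by decide) (by decide)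
  have h₃ := Dec.exists 3 (by decide) (P := fun V t => FactStart (letters t) ∧
    EqSecond t (V 1) ∧ C (Function.update V 3 t)) ((Dec.factStart _ 3).and
      ((Dec.agree _ isKet .ket 0 1 (by decide)).and (by simpa using hC))) (by simp)
  have h₂ := Dec.exists 2 (by decide) (P := fun V s => FactStart (letters s) ∧
    EqFact s (V 1) ∧ ∃ t, t <:+ V 0 ∧ FactStart (letters t) ∧ EqSecond t (V 1) ∧
      C (Function.update (Function.update V 2 s) 3 t)) ((Dec.factStart _ 2).and
      ((Dec.agree _ isKet .ket 0 0 (by decide)).and (by simpa using h₃))) (by simp)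
  have h₁ := Dec.forall 1 (by decide) (P := fun V e => PairStart (letters e) →
    ∃ s, s <:+ V 0 ∧ FactStart (letters s) ∧ EqFact s e ∧ ∃ t, t <:+ V 0 ∧ FactStart (letters t) ∧
      EqSecond t e ∧ C (Function.update (Function.update (Function.update V 1 e) 2 s) 3 t))
    ((Dec.pairStart _ 1).imp (by simpa using h₂)) (by simp)
  refine ⟨_, h₁, fun x V h0 => ?_⟩
  have rep {p q : Fact S} {e s t : List Cell} (he : At p e) (hs : At p s) (ht : At q t) :
      C (Function.update (Function.update (Function.update V 1 e) 2 s) 3 t) ↔ Clash F p q := by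
    -- A word that starts with a pair also starts with its first member, so the word in variable `1`
    -- represents `p`.
    have := hCF x (Function.update (fun _ => p) 3 q)
      (Function.update (Function.update (Function.update V 1 e) 2 s) 3 t) ⟨by simpa using h0, ?_⟩
    · simpa using this
    · intro i hi hi4
      have : i = 1 ∨ i = 2 ∨ i = 3 := by
        have : 0 < i.val := hi
        rcases i with ⟨i, _⟩
        simp only [Fin.ext_iff]
        change i = 1 ∨ i = 2 ∨ i = 3
        simp at hi4 this
        omega
      rcases this with rfl | rfl | rfl
      · simpa using he
      · simpa using hs
      · simpa using ht
  constructor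
  · intro h p q hpq
    obtain ⟨l, hl, hl', hp⟩ := exists_pairStart hpq
    obtain ⟨e, he, rfl⟩ := exists_suffix_of_letters (w := V 0) (h0 ▸ hl)
    have hp : PairAt p q e := hp
    obtain ⟨s, hs, hs', hse, t, ht, ht', hte, hC⟩ := h e he hl'
    obtain ⟨p', hp', hps⟩ := hs'.exists_mem (h0 ▸ letters_suffix hs)
    obtain ⟨q', hq', hqt⟩ := ht'.exists_mem (h0 ▸ letters_suffix ht)
    obtain rfl := (eqFact_iff hps hp.left).1 hse
    obtain rfl := (eqSecond_iff hqt hp).1 hte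
    exact ⟨List.mem_toFinset.2 hp', List.mem_toFinset.2 hq', (rep hp.left hps hqt).1 hC⟩
  · intro h e he he'
    obtain ⟨⟨p, q⟩, hpq, hp⟩ := he'.exists_mem (h0 ▸ letters_suffix he)
    have hp : PairAt p q e := hp
    obtain ⟨hpI, hqI, hc⟩ := h p q hpq
    obtain ⟨l, hl, hl', hpl⟩ := exists_factStart (List.mem_toFinset.1 hpI)
    obtain ⟨s, hs, rfl⟩ := exists_suffix_of_letters (w := V 0) (h0 ▸ hl)
    obtain ⟨l, hl, hl'', hql⟩ := exists_factStart (List.mem_toFinset.1 hqI)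
    obtain ⟨t, ht, rfl⟩ := exists_suffix_of_letters (w := V 0) (h0 ▸ hl)
    exact ⟨s, hs, hl', (eqFact_iff hpl hp.left).2 rfl, t, ht, hl'', (eqSecond_iff hql hp).2 rfl,
      (rep hp.left hpl hql).2 hc⟩

/-- The facts of the query and their subsets are fixed, so quantifiers over them are finite
conjunctions. To relate a fixed fact `q` to a variable, `group` and `part` find `q` in the instance;
they are used only where membership of `q` is assumed or demanded anyway. -/
theorem FDef.answer {good : Input S → Fact S → Prop} (hgood : FDef 2 fun x v => good x (v 1))
    (Q : Query S) (b : Bool) : FDef 1 fun x _ =>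
      ∀ T ∈ (Q.facts.powerset : Set (DBInstance S)), ¬ (Q.Holds T ↔ b = true) →
        ¬ ((∀ q ∈ (T : Set (Fact S)), q ∈ x.inst) ∧ ∀ q ∈ (Q.facts : Set (Fact S)), q ∈ x.inst →
          ∃ p ∈ x.inst, good x p ∧ SameGroup F p q ∧ ∀ q' ∈ (Q.facts : Set (Fact S)),
            SameGroup F q q' → (q' ∈ T ↔ q' ∈ x.inst ∧ SamePart F q' p)) := by
  have group (q : Fact S) : FDef 2 fun x v => q ∈ x.inst ∧ SameGroup F (v 1) q :=
    (FDef.exists_inst 2 (by decide) ((FDef.eqConst q (i := 2) (by decide) (by decide)).and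
      (FDef.sameGroup hF (i := 1) (j := 2) (by decide) (by decide) (by decide) (by decide)
        (by decide)))).congr fun x v => ⟨fun ⟨f, hf, h, h'⟩ => by
        obtain rfl : f = q := by simpa using h
        exact ⟨hf, by simpa using h'⟩, fun ⟨h, h'⟩ => ⟨q, h, by simp, by simpa using h'⟩⟩
  have part (q : Fact S) : FDef 2 fun x v => q ∈ x.inst ∧ SamePart F q (v 1) :=
    (FDef.exists_inst 2 (by decide) ((FDef.eqConst q (i := 2) (by decide) (by decide)).and
      (FDef.samePart hF (i := 2) (j := 1) (by decide) (by decide) (by decide) (by decide)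
        (by decide)))).congr fun x v => ⟨fun ⟨f, hf, h, h'⟩ => by
        obtain rfl : f = q := by simpa using h
        exact ⟨hf, by simpa using h'⟩, fun ⟨h, h'⟩ => ⟨q, h, by simp, by simpa using h'⟩⟩
  refine FDef.forall_mem (Finset.finite_toSet _) fun T _ => (FDef.const 1 _).imp
    (FDef.and (FDef.forall_mem (Finset.finite_toSet _) fun q _ => FDef.mem_inst q 1 (by decide))
      (FDef.forall_mem (Finset.finite_toSet _) fun q _ => ?_)).not
  refine ((FDef.mem_inst q 1 (by decide)).imp (FDef.exists_inst 1 (by decide) (hgood.and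
    ((group q).and (FDef.forall_mem Q.facts.finite_toSet fun q' _ =>
      (FDef.const 2 (SameGroup F q q')).imp ((FDef.const 2 (q' ∈ T)).iff (part q'))))))).congr
    fun x v => ?_
  refine imp_congr_right fun hq => exists_congr fun p => and_congr_right fun _ => ?_
  simp [hq]

theorem answerProblem_inPTIME {X : RepairFamily S} {good : Input S → Fact S → Prop}
    (hgood : FDef 2 fun x v => good x (v 1))
    (hX : ∀ x : Input S, IsPriority F x.inst x.prec → ∀ J, J ∈ X F x.inst x.prec ↔
      IsRepair F x.inst J ∧ ∀ p ∈ J, good x p)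
    (hcongr : ∀ x p q, SamePart F p q → good x p → good x q)
    (hex : ∀ x : Input S, IsPriority F x.inst x.prec → ∀ p ∈ x.inst,
      ∃ q ∈ x.inst, SameGroup F q p ∧ good x q) (Q : Query S) (b : Bool) :
    InPTIME encodeInput (answerProblem X F Q b) := by
  -- `FDef` refers to assignments of facts, which exist only if there are facts. Otherwise the empty
  -- input is the only one.
  by_cases hS : Nonempty (Fact S)
  · obtain ⟨C, hC, hCx⟩ := dec_clash_pairs hF
    obtain ⟨A, hA, hAx⟩ := FDef.answer hF hgood Q b
    -- At `k = 1` all variables but `0` are empty, so a predicate of the memory becomes one of a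
    -- single word, as `inPTIME_of_dec` requires.
    have hempty (D : (Fin 10 → List Cell) → Prop) (hD : Dec 1 D) :
        Dec 1 fun V => D (Function.update (fun _ => []) 0 (V 0)) := by
      refine hD.congr_of_empty fun V hV => iff_of_eq (congrArg D (funext fun i => ?_))
      by_cases hi : i = 0
      · simp [hi]
      · simpa [hi] using hV i (Nat.one_le_iff_ne_zero.2 fun h => hi (Fin.ext h))
    refine inPTIME_of_dec Dec.unblocked
      (ψ := fun w => AllMarked w ∧ C (Function.update (fun _ => []) 0 w) ∧
        A (Function.update (fun _ => []) 0 w)) (Dec.allMarked.and ((hempty C hC).and (hempty A hA)))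
      fun x => ?_
    obtain ⟨m, hm, h⟩ := iterate_remark x (encodeInput x).length
    rw [h, allMarked_mark_iff hm, ← acyclic_iff_settled _ (length_pairs_le x),
      hCx x _ (by simp), hAx x (Classical.arbitrary _) _
        ⟨by simp, fun i hi hi' => absurd (show 0 < i.val from hi) (by omega)⟩, ← and_assoc]
    change _ ↔ ((∀ p, ¬ Relation.TransGen x.prec p p) ∧ _) ∧ _
    rw [← isPriority_iff hF]
    refine and_congr_right fun hr => ?_
    exact preferredAnswer_iff hF (hX x hr) (hcongr x) (hex x hr) Q b
  · rw [not_nonempty_iff] at hS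
    have hsub (x : Input S) : x = ⟨[], []⟩ := by
      rcases x with ⟨L, M⟩
      obtain rfl := List.eq_nil_iff_forall_not_mem.2 fun a (_ : a ∈ L) => isEmptyElim a
      obtain rfl := List.eq_nil_iff_forall_not_mem.2 fun a (_ : a ∈ M) => isEmptyElim a.1
      rfl
    exact inPTIME_of_dec (φ := fun _ _ => True) (Dec.const 2 True)
      (ψ := fun _ => (⟨[], []⟩ : Input S) ∈ answerProblem X F Q b) (Dec.const 1 _)
      fun x => by rw [← hsub x]

end Problem

end CQA

theorem mainTheorem6 (S : CQA.Schema) (F : Set (CQA.FD S))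
    (hF : ∀ f ∈ F, ∀ g ∈ F, f.rel = g.rel → f = g)
    (Q : CQA.Query S) (b : Bool) :
    CQA.InPTIME CQA.encodeInput (CQA.answerProblem (CQA.paretoRep S) F Q b) ∧
    CQA.InPTIME CQA.encodeInput (CQA.answerProblem (CQA.globalRep S) F Q b) ∧
    CQA.InPTIME CQA.encodeInput (CQA.answerProblem (CQA.commonRep S) F Q b) := by
  have hex (x : CQA.Input S) (hr : CQA.IsPriority F x.inst x.prec) (p) (hp : p ∈ x.inst) :
      ∃ q ∈ x.inst, CQA.SameGroup F q p ∧ CQA.CommonGood F x.inst x.prec q :=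
    let ⟨q, hq, hqp, h⟩ := CQA.exists_commonGood hF hr hp
    ⟨q, hq, hqp, q, hq, .refl q, h⟩
  refine ⟨CQA.answerProblem_inPTIME hF (CQA.FDef.paretoGood hF)
      (fun x hr J => and_congr_right fun hJ => CQA.paretoOptimal_iff hF hr hJ)
      (fun x p q => CQA.ParetoGood.congr hF)
      (fun x hr p hp => (hex x hr p hp).imp fun q h =>
        ⟨h.1, h.2.1, h.2.2.globalGood.paretoGood⟩) Q b,
    CQA.answerProblem_inPTIME hF (CQA.FDef.globalGood hF)
      (fun x hr J => and_congr_right fun hJ => CQA.globallyOptimal_iff hF hr hJ)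
      (fun x p q => CQA.GlobalGood.congr hF)
      (fun x hr p hp => (hex x hr p hp).imp fun q h => ⟨h.1, h.2.1, h.2.2.globalGood⟩) Q b,
    CQA.answerProblem_inPTIME hF (CQA.FDef.commonGood hF)
      (fun x hr J => and_congr_right fun hJ => CQA.commonOptimal_iff hF hr hJ)
      (fun x p q => CQA.CommonGood.congr hF) hex Q b⟩
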